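/- Let $1<\alpha<2$. For $\xi\in\mathbb R^2$ put $$m(\xi)=\frac{|\xi|^{\alpha}\xi_1}{(1+|\xi|^2)^{\alpha/2}}-\xi_1,\qquad \tilde m(\xi)=(1+|\xi|^2)^{1/2}\,m(\xi).$$ For a bounded measurable function $a$ on $\mathbb R^2$ let $T_a$ be the Fourier multiplier with symbol $a$, given on Schwartz functions by $\widehat{T_af}=a\hat f$, where $\hat f(\xi)=\int f(x)e^{-ix\cdot\xi}\,dx$. Let $N=((I-\Delta)^{-\alpha/2}(-\Delta)^{\alpha/2}-I)\partial_1$, that is, the Fourier multiplier with symbol $i\,m(\xi)$. Then: 1. $\tilde m$ satisfies the Hörmander–Mikhlin condition: it is $C^\infty$ on $\mathbb R^2\setminus\{0\}$, and for every $k\in\mathbb N_0$ there is a constant $C_k$ (which may depend on $\alpha$) such that $|\partial^{\beta}\tilde m(\xi)|\le C_k|\xi|^{-k}$ for all $\xi\ne0$ and all multi-indices $\beta$ with $|\beta|=k$. 2. For every $1<q<\infty$, $T_{\tilde m}$ extends to a bounded linear operator on $L^q(\mathbb R^2)$: there is $C=C(\alpha,q)$ with $\|T_{\tilde m}f\|_{L^q}\le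 C\|f\|_{L^q}$ for all $f\in L^q(\mathbb R^2)$. 3. For every $1<q<\infty$, $N$ extends to a bounded linear operator on $L^q(\mathbb R^2)$ and is smoothing of order one: for every $f\in L^q(\mathbb R^2)$ the distributional gradient $\nabla Nf$ belongs to $L^q$, and $$\|Nf\|_{L^q}+\|\nabla Nf\|_{L^q}\le C\|f\|_{L^q}$$ with $C=C(\alpha,q)$ independent of $f$. (The extensions in 2 and 3 are unique, since Schwartz functions are dense in $L^q$.) -/

import Mathlib

open MeasureTheory SchwartzMap FourierTransform LineDeriv
open scoped ENNReal ContDiff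

noncomputable section

/-- The plane `ℝ²` with its Euclidean norm. -/
abbrev Plane : Type := EuclideanSpace ℝ (Fin 2)

/-- The real function
`m(ξ) = |ξ|^α ξ₁ / (1 + |ξ|²)^{α/2} - ξ₁`. -/
def symbolM (α : ℝ) (ξ : Plane) : ℝ :=
  ‖ξ‖ ^ α * ξ 0 / (1 + ‖ξ‖ ^ 2) ^ (α / 2) - ξ 0

/-- `m̃(ξ) = (|ξ|² + 1)^{1/2} m(ξ)`. -/
def symbolMTilde (α : ℝ) (ξ : Plane) : ℝ :=
  (‖ξ‖ ^ 2 + 1) ^ ((1 : ℝ) / 2) * symbolM α ξ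

/-- The Fourier symbol of `N = ((I - Δ)^{-α/2} (-Δ)^{α/2} - I) ∂₁`: the operators `(I - Δ)^{-α/2}`,
`(-Δ)^{α/2}` and `∂₁` have the symbols `(1 + |ξ|²)^{-α/2}`, `|ξ|^α` and `i ξ₁`. -/
def symbolN (α : ℝ) (ξ : Plane) : ℂ :=
  (((1 + ‖ξ‖ ^ 2) ^ (-(α / 2)) * ‖ξ‖ ^ α - 1 : ℝ) : ℂ) * (Complex.I * (ξ 0 : ℂ))

theorem symbolN_eq (α : ℝ) (ξ : Plane) : symbolN α ξ = Complex.I * (symbolM α ξ : ℂ) := by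
  have h : (0 : ℝ) ≤ 1 + ‖ξ‖ ^ 2 := by positivity
  simp only [symbolN, symbolM, Real.rpow_neg h]
  push_cast
  ring

/-- The Hörmander–Mikhlin condition: `a` is smooth away from the origin, and for every `k` its
derivatives of order `k` are bounded by a constant times `|ξ|^{-k}`. -/
def HormanderMikhlin (a : Plane → ℂ) : Prop :=
  ContDiffOn ℝ ∞ a {0}ᶜ ∧
    ∀ k : ℕ, ∃ C : ℝ, ∀ ξ : Plane, ξ ≠ 0 → ‖iteratedFDeriv ℝ k a ξ‖ ≤ C / ‖ξ‖ ^ k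

/-- The Fourier multiplier with the (bounded, measurable) symbol `a`, on Schwartz functions:
`T_a f` is the inverse Fourier transform of `a f̂`, where `f̂(ξ) = ∫ f(x) e^{-i x·ξ} dx`.
Mathlib's transform is `𝓕 f(η) = ∫ f(x) e^{-2πi x·η} dx = f̂(2πη)`, hence the factor `2π`
in the argument of `a`. -/
def multiplierOnSchwartz (a : Plane → ℂ) (f : 𝓢(Plane, ℂ)) : Plane → ℂ :=
  𝓕⁻ (fun η : Plane => a ((2 * Real.pi) • η) * 𝓕 (f : Plane → ℂ) η)

/-- `T` is the Fourier multiplier with symbol `a` on `L^q(ℝ²)`: the bounded linear operator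
on `L^q` that extends the Fourier multiplier on Schwartz functions. -/
def IsLqMultiplier (a : Plane → ℂ) (q : ℝ≥0∞) [Fact (1 ≤ q)]
    (T : Lp ℂ q (volume : Measure Plane) →L[ℂ] Lp ℂ q (volume : Measure Plane)) : Prop :=
  ∀ f : 𝓢(Plane, ℂ), (T (f.toLp q volume) : Plane → ℂ) =ᵐ[volume] multiplierOnSchwartz a f

/-- For `q < ∞` the symbol determines the operator on `L^q`. -/
theorem IsLqMultiplier.unique {a : Plane → ℂ} {q : ℝ≥0∞} [Fact (1 ≤ q)] (hq : q ≠ ⊤)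
    {T T' : Lp ℂ q (volume : Measure Plane) →L[ℂ] Lp ℂ q (volume : Measure Plane)}
    (hT : IsLqMultiplier a q T) (hT' : IsLqMultiplier a q T') : T = T' := by
  have hd : DenseRange (SchwartzMap.toLpCLM ℂ (E := Plane) ℂ q volume) :=
    SchwartzMap.denseRange_toLpCLM hq
  have h : (T : _ → _) = T' :=
    hd.equalizer T.continuous T'.continuous (by
      funext f
      exact Lp.ext ((hT f).trans (hT' f).symm))
  exact DFunLike.coe_injective h

/-- `G ∈ L^q(ℝ²; ℂ²)` is the distributional gradient of `u ∈ L^q(ℝ²)`. -/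
def IsGradient {q : ℝ≥0∞} [Fact (1 ≤ q)] (u : Lp ℂ q (volume : Measure Plane))
    (G : Lp (EuclideanSpace ℂ (Fin 2)) q (volume : Measure Plane)) : Prop :=
  ∀ j : Fin 2, ∂_{(EuclideanSpace.single j 1 : Plane)} (u : 𝓢'(Plane, ℂ)) =
    (((EuclideanSpace.proj j : EuclideanSpace ℂ (Fin 2) →L[ℂ] ℂ).compLp G :
      Lp ℂ q (volume : Measure Plane)) : 𝓢'(Plane, ℂ))

end

/-! Write t = (1+|ξ|²)⁻¹, ρ_j = ξ_j t^{1/2} and ψ = ((1-t)^{α/2} - 1)/t. Since 1-t = |ξ|²/(1+|ξ|²),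
one has m = ξ₁((1-t)^{α/2} - 1) = ξ₁ t ψ. Hence m̃ = ψ ρ₁, the symbol of N is i t^{1/2} ψ ρ₁, and
that of ∂_j N is -ψ ρ₁ ρ_j (`symbolMTilde_eq_psiSymbol`, `symbolN_eq_psiSymbol`,
`gradient_symbolN_eq_psiSymbol`; coordinates are numbered from 0 in the code). The L^q bounds follow
from this factorisation alone; the Hörmander–Mikhlin condition is proved independently and not used
for them.

For 0 < s ≤ 1 all binomial coefficients of (1-t)^s after the first have one sign, so the series
converges absolutely up to t = 1. Multiplication by t^s is an average of Gaussians, which are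
averages of translations, so it is an L^q contraction. Therefore ψ, a power series in t with
absolutely summable coefficients, preserves L^q multipliers (`IsMult.psi_mul`). Also ρ_j =
(ξ_j/|ξ|)(1-t)^{1/2} reduces to a Riesz transform.

The Riesz transforms come from the Hilbert transform by the method of rotations (`isMult_riesz`).
The Hilbert transform is bounded by M. Riesz's complex argument: for f ≥ 0 the Cauchy integral F has
positive real part, ∫ F^p over horizontal lines vanishes, and a pointwise inequality bounds |F|^p by
(Re F)^p and Re F^p (`lintegral_enorm_cauchyExt_le`). This settles 1 < p ≤ 2; duality gives the
other exponents.

Multipliers are handled through the form ∫ b f̂ ǧ on Schwartz functions (`IsMult`), stable under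
averages, limits and transposition; duality and density turn a bounded form into an operator
(`exists_isLqMultiplier`).

For the Mikhlin condition, m̃ is a product of homogeneous functions and smooth functions of |ξ|²
near the origin, and of degree-zero functions and smooth functions of |ξ|⁻² near infinity. -/

section

open Filter Topology Complex

/-! ### Integral inequalities and the pointwise inequality of M. Riesz. -/

/-- Jensen's inequality for the (unnormalised) weight `ψ`. -/
theorem lintegral_mul_rpow_le {β : Type*} [MeasurableSpace β] {μ : Measure β} {p : ℝ} (hp : 1 < p)
    {φ ψ : β → ℝ≥0∞} (hφ : AEMeasurable φ μ) (hψ : AEMeasurable ψ μ) :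
    (∫⁻ t, φ t * ψ t ∂μ) ^ p ≤ (∫⁻ t, ψ t ∂μ) ^ (p - 1) * ∫⁻ t, φ t ^ p * ψ t ∂μ := by
  have hpq := Real.HolderConjugate.conjExponent hp
  set q := p.conjExponent
  have hp0 : 0 < p := by linarith
  have hq0 : 0 < q := hpq.symm.pos
  have e1 : ∀ t, φ t * ψ t = ((fun t => φ t * ψ t ^ (1 / p)) * (fun t => ψ t ^ (1 / q))) t := by
    intro t
    simp only [Pi.mul_apply, mul_assoc]
    rw [← ENNReal.rpow_add_of_nonneg _ _ (by positivity) (by positivity)]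
    have : 1 / p + 1 / q = 1 := by simpa using hpq.inv_add_inv_eq_one
    rw [this, ENNReal.rpow_one]
  have h := ENNReal.lintegral_mul_le_Lp_mul_Lq μ hpq (f := fun t => φ t * ψ t ^ (1 / p))
    (g := fun t => ψ t ^ (1 / q)) (hφ.mul (hψ.pow_const _)) (hψ.pow_const _)
  simp_rw [← e1] at h
  have e2 : ∀ t, (φ t * ψ t ^ (1 / p)) ^ p = φ t ^ p * ψ t := fun t => by
    rw [ENNReal.mul_rpow_of_nonneg _ _ hp0.le, ← ENNReal.rpow_mul, one_div_mul_cancel hp0.ne',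
      ENNReal.rpow_one]
  have e3 : ∀ t, (ψ t ^ (1 / q)) ^ q = ψ t := fun t => by
    rw [← ENNReal.rpow_mul, one_div_mul_cancel hq0.ne', ENNReal.rpow_one]
  simp_rw [e2, e3] at h
  calc _ ≤ ((∫⁻ t, φ t ^ p * ψ t ∂μ) ^ (1 / p) * (∫⁻ t, ψ t ∂μ) ^ (1 / q)) ^ p := by gcongr
    _ = _ := by
      rw [ENNReal.mul_rpow_of_nonneg _ _ hp0.le, ← ENNReal.rpow_mul, one_div_mul_cancel hp0.ne',
        ENNReal.rpow_one, ← ENNReal.rpow_mul, mul_comm]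
      congr 2
      rw [one_div, inv_mul_eq_div, hpq.div_conj_eq_sub_one]

/-- Young's inequality `L^p * L^1 ⊆ L^p` for nonnegative functions. -/
theorem lintegral_conv_rpow_le {p : ℝ} (hp : 1 < p) {φ ψ : ℝ → ℝ≥0∞} (hφ : Measurable φ)
    (hψ : Measurable ψ) :
    ∫⁻ x, (∫⁻ t, φ t * ψ (x - t)) ^ p ≤ (∫⁻ t, ψ t) ^ p * ∫⁻ t, φ t ^ p := by
  have hm : Measurable fun z : ℝ × ℝ => φ z.2 ^ p * ψ (z.1 - z.2) := by fun_prop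
  calc ∫⁻ x, (∫⁻ t, φ t * ψ (x - t)) ^ p
      ≤ ∫⁻ x, (∫⁻ t, ψ t) ^ (p - 1) * ∫⁻ t, φ t ^ p * ψ (x - t) := by
        refine lintegral_mono fun x => ?_
        refine (lintegral_mul_rpow_le hp hφ.aemeasurable (by fun_prop)).trans_eq ?_
        rw [lintegral_sub_left_eq_self ψ x]
    _ = (∫⁻ t, ψ t) ^ (p - 1) * ∫⁻ t, ∫⁻ x, φ t ^ p * ψ (x - t) := by
        rw [lintegral_const_mul _ hm.lintegral_prod_right', lintegral_lintegral_swap hm.aemeasurable]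
    _ = (∫⁻ t, ψ t) ^ (p - 1) * ((∫⁻ t, φ t ^ p) * ∫⁻ t, ψ t) := by
        congr 1
        rw [← lintegral_mul_const _ (by fun_prop)]
        refine lintegral_congr fun t => ?_
        rw [lintegral_const_mul _ (by fun_prop), lintegral_sub_right_eq_self ψ t]
    _ = _ := by
        have : p = (p - 1) + 1 := by ring
        conv_rhs => rw [this, ENNReal.rpow_add_of_nonneg _ _ (by linarith) zero_le_one,
          ENNReal.rpow_one]
        rw [sub_add_cancel]
        ring

/-- With w = |w|e^{iθ}, |θ| < π/2, this compares 1 with A cos^p θ - B cos pθ. Near |θ| = π/2 the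
cosine of pθ is negative because p > 1, and elsewhere cos θ is bounded below. The bound p ≤ 2 keeps
p|θ| within [0, π], where the cosine decreases. -/
theorem exists_norm_rpow_le {p : ℝ} (hp : 1 < p) (hp2 : p ≤ 2) :
    ∃ A B : ℝ, 0 < A ∧ 0 < B ∧ ∀ w : ℂ, 0 < w.re →
      ‖w‖ ^ p ≤ A * w.re ^ p - B * (w ^ (p : ℂ)).re := by
  -- The threshold angle lies midway between π/(2p), where cos pθ changes sign, and π/2, where cos θ
  -- vanishes.
  set φ₀ := (Real.pi / (2 * p) + Real.pi / 2) / 2 with hφ₀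
  have hpi := Real.pi_pos
  have hp0 : 0 < p := by linarith
  have e : p * φ₀ = (Real.pi / 2 + p * Real.pi / 2) / 2 := by rw [hφ₀]; field_simp
  have h1 : Real.pi / 2 < p * φ₀ := by rw [e]; nlinarith
  have h2 : p * φ₀ ≤ Real.pi := by rw [e]; nlinarith
  have h3 : φ₀ < Real.pi / 2 := by
    have : Real.pi / (2 * p) < Real.pi / 2 := by
      apply div_lt_div_of_pos_left hpi (by norm_num); linarith
    linarith
  have h4 : 0 < φ₀ := by positivity
  have hc : Real.cos (p * φ₀) < 0 := Real.cos_neg_of_pi_div_two_lt_of_lt h1 (by linarith)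
  have hc' : 0 < Real.cos φ₀ := Real.cos_pos_of_mem_Ioo ⟨by linarith, h3⟩
  set B := 1 / (-Real.cos (p * φ₀)) with hB
  have hB0 : 0 < B := by rw [hB]; apply one_div_pos.2; linarith
  have hBc : B * Real.cos (p * φ₀) = -1 := by
    rw [hB]; field_simp [hc.ne]
  -- B makes the second term at least 1 beyond φ₀; A makes the first at least 1 + B below φ₀, which
  -- absorbs B cos pθ ≤ B.
  refine ⟨(1 + B) / Real.cos φ₀ ^ p, B, by positivity, hB0, fun w hw => ?_⟩
  have hw0 : w ≠ 0 := by rintro rfl; simp at hw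
  have hr : 0 < ‖w‖ := norm_pos_iff.2 hw0
  have harg : |w.arg| < Real.pi / 2 := Complex.abs_arg_lt_pi_div_two_iff.2 (Or.inl hw)
  have hre : w.re = ‖w‖ * Real.cos w.arg := by
    rw [Complex.cos_arg hw0]; field_simp
  have hpow : (w ^ (p : ℂ)).re = ‖w‖ ^ p * Real.cos (p * w.arg) := by
    rw [Complex.cpow_ofReal_re, mul_comm p]
  have hca : 0 < Real.cos w.arg := Real.cos_pos_of_mem_Ioo (abs_lt.1 harg)
  rw [hpow, hre, Real.mul_rpow hr.le hca.le]
  have hrp : 0 < ‖w‖ ^ p := by positivity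
  suffices h : 1 ≤ (1 + B) / Real.cos φ₀ ^ p * Real.cos w.arg ^ p - B * Real.cos (p * w.arg) by
    nlinarith [mul_le_mul_of_nonneg_left h hrp.le]
  have hcosabs : Real.cos (p * w.arg) = Real.cos (p * |w.arg|) := by
    rw [← Real.cos_abs, abs_mul, abs_of_pos hp0]
  rcases le_total φ₀ |w.arg| with h | h
  · have : Real.cos (p * w.arg) ≤ Real.cos (p * φ₀) := by
      rw [hcosabs]
      apply Real.cos_le_cos_of_nonneg_of_le_pi (by positivity)
      · nlinarith
      · gcongr
    have h6 : 0 ≤ (1 + B) / Real.cos φ₀ ^ p * Real.cos w.arg ^ p := by positivity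
    nlinarith
  · have : Real.cos φ₀ ≤ Real.cos w.arg := by
      rw [← Real.cos_abs w.arg]
      exact Real.cos_le_cos_of_nonneg_of_le_pi (abs_nonneg _) (by linarith) h
    have h6 : 1 + B ≤ (1 + B) / Real.cos φ₀ ^ p * Real.cos w.arg ^ p := by
      rw [div_mul_eq_mul_div, le_div_iff₀ (by positivity)]
      gcongr
    nlinarith [Real.cos_le_one (p * w.arg)]

/-! ### The Cauchy integral on the upper half plane. -/

/-- The (unnormalised) Cauchy integral `∫ i f(t) / (z - t) dt`. -/
noncomputable def cauchyExt (f : ℝ → ℝ) (z : ℂ) : ℂ := ∫ t : ℝ, (f t : ℂ) * (I / (z - t))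

theorem sub_ofReal_ne_zero {z : ℂ} (hz : 0 < z.im) (t : ℝ) : z - t ≠ 0 := by
  intro h
  have := congrArg Complex.im h
  simp at this
  linarith

theorem im_le_norm_sub_ofReal (z : ℂ) (t : ℝ) : z.im ≤ ‖z - t‖ := by
  simpa using (le_abs_self _).trans (Complex.abs_im_le_norm (z - t))

theorem norm_I_div_sub_le {z : ℂ} (hz : 0 < z.im) (t : ℝ) : ‖I / (z - t)‖ ≤ 1 / z.im := by
  rw [norm_div, norm_I]
  exact one_div_le_one_div_of_le hz (im_le_norm_sub_ofReal z t)

theorem continuous_I_div_sub {z : ℂ} (hz : 0 < z.im) : Continuous fun t : ℝ => I / (z - t) :=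
  continuous_const.div (by fun_prop) (sub_ofReal_ne_zero hz)

theorem integrable_cauchyExt {f : ℝ → ℝ} (hf : Integrable f) {z : ℂ} (hz : 0 < z.im) :
    Integrable fun t : ℝ => (f t : ℂ) * (I / (z - t)) :=
  hf.ofReal.mul_bdd (c := 1 / z.im) (continuous_I_div_sub hz).aestronglyMeasurable
    (ae_of_all _ fun t => norm_I_div_sub_le hz t)

theorem norm_cauchyExt_le {f : ℝ → ℝ} (hf : Integrable f) {z : ℂ} (hz : 0 < z.im) :
    ‖cauchyExt f z‖ ≤ (∫ t, ‖f t‖) / z.im := by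
  refine (norm_integral_le_of_norm_le (hf.norm.div_const z.im) (ae_of_all _ fun t => ?_)).trans_eq
    (integral_div _ _)
  rw [norm_mul, Complex.norm_real, div_eq_mul_one_div ‖f t‖]
  gcongr
  exact norm_I_div_sub_le hz t

/-- The real part of the Cauchy kernel is the Poisson kernel, the imaginary part its conjugate, both
without the factor 1/π. -/
theorem re_I_div_sub (z : ℂ) (t : ℝ) :
    (I / (z - t)).re = z.im / ((z.re - t) ^ 2 + z.im ^ 2) := by
  simp [Complex.div_re, Complex.normSq_apply, pow_two]

theorem im_I_div_sub (z : ℂ) (t : ℝ) :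
    (I / (z - t)).im = (z.re - t) / ((z.re - t) ^ 2 + z.im ^ 2) := by
  simp [Complex.div_im, Complex.normSq_apply, pow_two]

theorem cauchyExt_re {f : ℝ → ℝ} (hf : Integrable f) {z : ℂ} (hz : 0 < z.im) :
    (cauchyExt f z).re = ∫ t, f t * (z.im / ((z.re - t) ^ 2 + z.im ^ 2)) := by
  have := integral_re (integrable_cauchyExt hf hz)
  simp only [RCLike.re_eq_complex_re, Complex.re_ofReal_mul, re_I_div_sub] at this
  exact this.symm

theorem cauchyExt_im {f : ℝ → ℝ} (hf : Integrable f) {z : ℂ} (hz : 0 < z.im) :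
    (cauchyExt f z).im = ∫ t, f t * ((z.re - t) / ((z.re - t) ^ 2 + z.im ^ 2)) := by
  have := integral_im (integrable_cauchyExt hf hz)
  simp only [RCLike.im_eq_complex_im, Complex.im_ofReal_mul, im_I_div_sub] at this
  exact this.symm

/-- The Poisson kernel is positive. This keeps the values off the branch cut, so that the p-th power
of the Cauchy integral is holomorphic. -/
theorem cauchyExt_re_pos {f : ℝ → ℝ} (hf : Integrable f) (h0 : ∀ t, 0 ≤ f t)
    (hpos : 0 < ∫ t, f t) {z : ℂ} (hz : 0 < z.im) : 0 < (cauchyExt f z).re := by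
  rw [cauchyExt_re hf hz]
  have hk : ∀ t, 0 < z.im / ((z.re - t) ^ 2 + z.im ^ 2) := fun t => by positivity
  have hi := (integrable_cauchyExt hf hz).re
  simp only [RCLike.re_eq_complex_re, Complex.re_ofReal_mul, re_I_div_sub] at hi
  rw [integral_pos_iff_support_of_nonneg h0 hf] at hpos
  rw [integral_pos_iff_support_of_nonneg (fun t => mul_nonneg (h0 t) (hk t).le) hi]
  convert hpos using 2
  ext t
  rw [Function.mem_support, Function.mem_support, mul_ne_zero_iff, and_iff_left (hk t).ne']

theorem differentiableAt_cauchyExt {f : ℝ → ℝ} (hf : Integrable f) {z : ℂ} (hz : 0 < z.im) :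
    DifferentiableAt ℂ (cauchyExt f) z := by
  -- On this ball the kernel and its derivative have bounds independent of w and t.
  have hball : ∀ w ∈ Metric.ball z (z.im / 2), z.im / 2 < w.im := by
    intro w hw
    have h1 := (Complex.abs_im_le_norm (w - z)).trans_lt (mem_ball_iff_norm.1 hw)
    rw [Complex.sub_im] at h1
    linarith [(abs_lt.1 h1).1]
  have hz2 : 0 < z.im / 2 := by positivity
  have := hasDerivAt_integral_of_dominated_loc_of_deriv_le (𝕜 := ℂ) (μ := volume)
    (F := fun (w : ℂ) (t : ℝ) => (f t : ℂ) * (I / (w - t)))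
    (F' := fun (w : ℂ) (t : ℝ) => (f t : ℂ) * (-I / (w - t) ^ 2)) (x₀ := z)
    (s := Metric.ball z (z.im / 2))
    (bound := fun t => ‖f t‖ * (1 / (z.im / 2) ^ 2)) (Metric.ball_mem_nhds z hz2)
    ?_ (integrable_cauchyExt hf hz) ?_ ?_ ?_ ?_
  · exact this.2.differentiableAt
  · filter_upwards [Metric.ball_mem_nhds z hz2] with w hw
    exact (integrable_cauchyExt hf (hz2.trans (hball w hw))).aestronglyMeasurable
  · refine hf.ofReal.aestronglyMeasurable.mul ?_
    refine Continuous.aestronglyMeasurable ?_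
    exact continuous_const.div (by fun_prop) fun t => pow_ne_zero _ (sub_ofReal_ne_zero hz t)
  · refine ae_of_all _ fun t w hw => ?_
    rw [norm_mul, Complex.norm_real, norm_div, norm_neg, norm_I, norm_pow]
    gcongr
    exact (hball w hw).le.trans (im_le_norm_sub_ofReal w t)
  · exact hf.norm.mul_const _
  · refine ae_of_all _ fun t w hw => ?_
    have hne := sub_ofReal_ne_zero (hz2.trans (hball w hw)) t
    have h := ((hasDerivAt_const w I).div ((hasDerivAt_id w).sub_const (t : ℂ)) hne).const_mul (f t : ℂ)
    simpa using h

theorem tendsto_cauchyExt {f : ℝ → ℝ} (hf : Integrable f) {y : ℝ} (hy : 0 < y)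
    {ι : Type*} {l : Filter ι} [l.IsCountablyGenerated] {X : ι → ℝ}
    (hX : Tendsto (fun i => |X i|) l atTop) :
    Tendsto (fun i => cauchyExt f (X i + y * I)) l (𝓝 0) := by
  have him : ∀ i, ((X i : ℂ) + y * I).im = y := by simp
  have h0 : (0 : ℂ) = ∫ t : ℝ, (0 : ℂ) := by simp
  rw [h0]
  refine tendsto_integral_filter_of_dominated_convergence (fun t => ‖f t‖ * (1 / y)) ?_ ?_
    (hf.norm.mul_const _) ?_
  · exact Eventually.of_forall fun i =>
      (integrable_cauchyExt hf (by rw [him]; exact hy)).aestronglyMeasurable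
  · refine Eventually.of_forall fun i => ae_of_all _ fun t => ?_
    rw [norm_mul, Complex.norm_real]
    gcongr
    have := norm_I_div_sub_le (z := X i + y * I) (by rw [him]; exact hy) t
    rwa [him] at this
  · refine ae_of_all _ fun t => ?_
    have : Tendsto (fun i => I / ((X i : ℂ) + y * I - t)) l (𝓝 0) := by
      rw [tendsto_zero_iff_norm_tendsto_zero]
      simp only [norm_div, norm_I]
      refine Tendsto.div_atTop tendsto_const_nhds ?_
      refine tendsto_atTop_mono (fun i => ?_) (tendsto_atTop_add_const_right _ (-|t|) hX)
      have h1 := Complex.abs_re_le_norm ((X i : ℂ) + y * I - t)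
      simp only [sub_re, add_re, ofReal_re, mul_re, I_re, mul_zero, ofReal_im, I_im, mul_one,
        sub_self, add_zero] at h1
      have h2 := abs_sub_abs_le_abs_sub (X i) t
      linarith
    simpa using this.const_mul (f t : ℂ)

theorem norm_cpow_ofReal {w : ℂ} (p : ℝ) (hw : w ≠ 0) : ‖w ^ (p : ℂ)‖ = ‖w‖ ^ p := by
  rw [Complex.norm_cpow_of_ne_zero hw]
  simp

theorem enorm_integral_cauchyExt_le (f : ℝ → ℝ) (x y : ℝ) :
    ‖cauchyExt f (x + y * I)‖ₑ ≤ ∫⁻ t, ‖(((x - t : ℝ) : ℂ) + y * I)⁻¹‖ₑ * ‖f t‖ₑ := by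
  refine (enorm_integral_le_lintegral_enorm _).trans_eq (lintegral_congr fun t => ?_)
  rw [enorm_mul, mul_comm, div_eq_mul_inv, enorm_mul]
  have h1 : ‖I‖ₑ = 1 := by simp [enorm_eq_nnnorm]
  have h2 : ‖(f t : ℂ)‖ₑ = ‖f t‖ₑ := by simp [enorm_eq_nnnorm]
  rw [h1, h2, one_mul]
  congr 3
  push_cast; ring

/-- Young's inequality with f in L^1 and the kernel in L^p. The bound is not uniform in y, but gives
finiteness and decay as y → ∞. -/
theorem lintegral_enorm_cauchyExt_rpow_le {f : ℝ → ℝ} (hf : Measurable f) {p : ℝ} (hp : 1 < p)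
    (y : ℝ) :
    ∫⁻ x : ℝ, ‖cauchyExt f (x + y * I)‖ₑ ^ p ≤
      (∫⁻ t, ‖f t‖ₑ) ^ p * ∫⁻ t : ℝ, ‖((t : ℂ) + y * I)⁻¹‖ₑ ^ p := by
  calc _ ≤ ∫⁻ x : ℝ, (∫⁻ t : ℝ, ‖((t : ℂ) + y * I)⁻¹‖ₑ * ‖f (x - t)‖ₑ) ^ p := by
        refine lintegral_mono fun x => ?_
        gcongr
        refine (enorm_integral_cauchyExt_le f x y).trans_eq ?_
        rw [← lintegral_sub_left_eq_self _ x]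
        simp
    _ ≤ _ := by
        refine lintegral_conv_rpow_le (φ := fun t => ‖((t : ℂ) + y * I)⁻¹‖ₑ)
          (ψ := fun t => ‖f t‖ₑ) hp (by fun_prop) (by fun_prop)

/-- Substitute t = ys. The exponent 1 - p is negative, which supplies the decay at large heights. -/
theorem lintegral_inv_rpow_eq {p y : ℝ} (hp : 1 < p) (hy : 0 < y) :
    ∫⁻ t : ℝ, ‖((t : ℂ) + y * I)⁻¹‖ₑ ^ p =
      ENNReal.ofReal (y ^ (1 - p) * ∫ s : ℝ, (1 + ‖s‖ ^ 2) ^ (-p / 2)) := by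
  have h_integrable : Integrable fun s : ℝ => (1 + ‖s‖ ^ 2) ^ (-p / 2) :=
    integrable_rpow_neg_one_add_norm_sq (by simpa using hp)
  have e : ∀ t : ℝ, ‖((t : ℂ) + y * I)⁻¹‖ₑ ^ p =
      ENNReal.ofReal (y ^ (-p) * (1 + ‖y⁻¹ * t‖ ^ 2) ^ (-p / 2)) := by
    intro t
    rw [← ofReal_norm, ENNReal.ofReal_rpow_of_nonneg (norm_nonneg _) (by linarith)]
    congr 1
    rw [norm_inv, Complex.norm_add_mul_I, Real.sqrt_eq_rpow, ← Real.rpow_neg (by positivity),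
      ← Real.rpow_mul (by positivity)]
    have : t ^ 2 + y ^ 2 = y ^ 2 * (1 + ‖y⁻¹ * t‖ ^ 2) := by
      rw [Real.norm_eq_abs, sq_abs]; field_simp; ring
    rw [this, Real.mul_rpow (by positivity) (by positivity), ← Real.rpow_natCast,
      ← Real.rpow_mul hy.le]
    congr 2 <;> push_cast <;> ring
  simp_rw [e]
  rw [← ofReal_integral_eq_lintegral_ofReal]
  · rw [integral_const_mul, Measure.integral_comp_mul_left (fun s : ℝ => (1 + ‖s‖ ^ 2) ^ (-p / 2)),
      inv_inv, abs_of_pos hy, smul_eq_mul, ← mul_assoc]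
    congr 2
    rw [sub_eq_neg_add, Real.rpow_add hy, Real.rpow_one]
  · exact (h_integrable.comp_mul_left' (inv_ne_zero hy.ne')).const_mul _
  · exact ae_of_all _ fun t => by positivity

/-! ### Contour integration of the p-th power of the Cauchy integral. -/

section Contour

variable {f : ℝ → ℝ} {p : ℝ}

theorem continuous_cauchyExt_line (hf : Integrable f) {y : ℝ} (hy : 0 < y) :
    Continuous fun x : ℝ => cauchyExt f (x + y * I) := by
  rw [continuous_iff_continuousAt]
  intro x
  have h := (differentiableAt_cauchyExt hf (z := x + y * I) (by simpa using hy)).continuousAt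
  exact ContinuousAt.comp (f := fun x : ℝ => (x : ℂ) + y * I) h (by fun_prop)

theorem lintegral_enorm_cauchyExt_rpow_lt_top (hm : Measurable f) (hf : Integrable f) (hp : 1 < p)
    {y : ℝ} (hy : 0 < y) : ∫⁻ x : ℝ, ‖cauchyExt f (x + y * I)‖ₑ ^ p < ⊤ := by
  refine (lintegral_enorm_cauchyExt_rpow_le hm hp y).trans_lt ?_
  rw [lintegral_inv_rpow_eq hp hy]
  exact ENNReal.mul_lt_top (ENNReal.rpow_lt_top_of_nonneg (by linarith) hf.2.ne)
    ENNReal.ofReal_lt_top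

theorem integrable_cauchyExt_cpow (hm : Measurable f) (hf : Integrable f) (h0 : ∀ t, 0 ≤ f t)
    (hpos : 0 < ∫ t, f t) (hp : 1 < p) {y : ℝ} (hy : 0 < y) :
    Integrable fun x : ℝ => cauchyExt f (x + y * I) ^ (p : ℂ) := by
  have hre : ∀ x : ℝ, 0 < (cauchyExt f (x + y * I)).re := fun x =>
    cauchyExt_re_pos hf h0 hpos (by simpa using hy)
  have hne : ∀ x : ℝ, cauchyExt f (x + y * I) ≠ 0 := fun x h => by
    have := hre x; rw [h] at this; simp at this
  refine ⟨Continuous.aestronglyMeasurable ?_, ?_⟩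
  · exact (continuous_cauchyExt_line hf hy).cpow continuous_const fun x => Or.inl (hre x)
  · refine lt_of_le_of_lt (le_of_eq ?_) (lintegral_enorm_cauchyExt_rpow_lt_top hm hf hp hy)
    refine lintegral_congr fun x => ?_
    rw [← ofReal_norm, ← ofReal_norm, norm_cpow_ofReal p (hne x),
      ENNReal.ofReal_rpow_of_nonneg (norm_nonneg _) (by linarith)]

theorem differentiableAt_cauchyExt_cpow (hf : Integrable f) (h0 : ∀ t, 0 ≤ f t)
    (hpos : 0 < ∫ t, f t) {z : ℂ} (hz : 0 < z.im) :
    DifferentiableAt ℂ (fun z => cauchyExt f z ^ (p : ℂ)) z :=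
  (differentiableAt_cauchyExt hf hz).cpow (differentiableAt_const _)
    (Or.inl (cauchyExt_re_pos hf h0 hpos hz))

/-- The vertical sides of the rectangles vanish in the limit: at fixed height F tends to 0, and |F|
≤ ‖f‖₁/y dominates. -/
theorem tendsto_vertical_cauchyExt (hf : Integrable f) (h0 : ∀ t, 0 ≤ f t)
    (hpos : 0 < ∫ t, f t) (hp : 1 < p) {y Y : ℝ} (hy : 0 < y) (hyY : y ≤ Y) {X : ℕ → ℝ}
    (hX : Tendsto (fun i => |X i|) atTop atTop) :
    Tendsto (fun n => ∫ s in y..Y, cauchyExt f (X n + s * I) ^ (p : ℂ)) atTop (𝓝 0) := by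
  have hs : ∀ s ∈ Set.uIoc y Y, 0 < s := fun s hs => by
    rw [Set.uIoc_of_le hyY] at hs; exact hy.trans hs.1
  have hne : ∀ (x s : ℝ), 0 < s → cauchyExt f (x + s * I) ≠ 0 := fun x s hs h => by
    have := cauchyExt_re_pos hf h0 hpos (z := x + s * I) (by simpa using hs)
    rw [h] at this; simp at this
  have h00 : (0 : ℂ) = ∫ s in y..Y, (0 : ℂ) := by simp
  rw [h00]
  refine intervalIntegral.tendsto_integral_filter_of_dominated_convergence
    (fun _ => ((∫ t, ‖f t‖) / y) ^ p) ?_ ?_ intervalIntegrable_const ?_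
  · refine Eventually.of_forall fun n => ?_
    refine ContinuousOn.aestronglyMeasurable (fun s hs' => ?_) measurableSet_uIoc
    refine ContinuousAt.continuousWithinAt ?_
    have h := (differentiableAt_cauchyExt_cpow (p := p) hf h0 hpos (z := X n + s * I)
      (by simpa using hs s hs')).continuousAt
    exact ContinuousAt.comp (f := fun s : ℝ => (X n : ℂ) + s * I) h (by fun_prop)
  · refine Eventually.of_forall fun n => ae_of_all _ fun s hs' => ?_
    rw [norm_cpow_ofReal p (hne _ _ (hs s hs'))]
    have h1 := norm_cauchyExt_le hf (z := X n + s * I) (by simpa using hs s hs')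
    have h2 : ((X n : ℂ) + s * I).im = s := by simp
    rw [h2] at h1
    rw [Set.uIoc_of_le hyY] at hs'
    gcongr
    refine h1.trans ?_
    gcongr
    exact hs'.1.le
  · refine ae_of_all _ fun s hs' => ?_
    rw [tendsto_zero_iff_norm_tendsto_zero]
    simp_rw [norm_cpow_ofReal p (hne _ _ (hs s hs'))]
    have := (tendsto_cauchyExt hf (hs s hs') hX).norm.rpow_const (p := p)
      (Or.inr (by linarith))
    simpa [Real.zero_rpow (by linarith : p ≠ 0)] using this

/-- Cauchy's theorem on the rectangles [-n, n] × [y, Y], with n → ∞. -/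
theorem integral_cauchyExt_cpow_eq (hm : Measurable f) (hf : Integrable f) (h0 : ∀ t, 0 ≤ f t)
    (hpos : 0 < ∫ t, f t) (hp : 1 < p) {y Y : ℝ} (hy : 0 < y) (hyY : y ≤ Y) :
    ∫ x : ℝ, cauchyExt f (x + y * I) ^ (p : ℂ) = ∫ x : ℝ, cauchyExt f (x + Y * I) ^ (p : ℂ) := by
  have hX : Tendsto (fun n : ℕ => (n : ℝ)) atTop atTop := tendsto_natCast_atTop_atTop
  have hX' : Tendsto (fun n : ℕ => -(n : ℝ)) atTop atBot := tendsto_neg_atTop_atBot.comp hX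
  have l1 := intervalIntegral_tendsto_integral
    (integrable_cauchyExt_cpow hm hf h0 hpos hp hy) hX' hX
  have l2 := intervalIntegral_tendsto_integral
    (integrable_cauchyExt_cpow hm hf h0 hpos hp (hy.trans_le hyY)) hX' hX
  have l3 := tendsto_vertical_cauchyExt hf h0 hpos hp hy hyY (X := fun n => (n : ℝ))
    (by simpa using hX)
  have l4 := tendsto_vertical_cauchyExt hf h0 hpos hp hy hyY (X := fun n => -(n : ℝ))
    (by simpa using hX)
  have key : ∀ n : ℕ, (((∫ x in (-(n : ℝ))..n, cauchyExt f (x + y * I) ^ (p : ℂ)) -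
      ∫ x in (-(n : ℝ))..n, cauchyExt f (x + Y * I) ^ (p : ℂ)) +
      I • ∫ s in y..Y, cauchyExt f ((n : ℝ) + s * I) ^ (p : ℂ)) -
      I • ∫ s in y..Y, cauchyExt f ((-(n : ℝ) : ℝ) + s * I) ^ (p : ℂ) = 0 := by
    intro n
    have := Complex.integral_boundary_rect_eq_zero_of_differentiableOn
      (fun z => cauchyExt f z ^ (p : ℂ)) (⟨-n, y⟩ : ℂ) (⟨n, Y⟩ : ℂ) ?_
    · exact this
    · intro z hz
      have him := hz.2
      simp only [Set.mem_preimage, Set.uIcc_of_le hyY] at him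
      exact (differentiableAt_cauchyExt_cpow hf h0 hpos (hy.trans_le him.1)).differentiableWithinAt
  have lim := ((l1.sub l2).add (l3.const_smul I)).sub (l4.const_smul I)
  rw [tendsto_congr key] at lim
  have := tendsto_nhds_unique tendsto_const_nhds lim
  simp only [smul_zero, add_zero, sub_zero] at this
  exact (sub_eq_zero.1 this.symm)

/-- The integral does not depend on the height and is O(Y^{1-p}) at height Y, so letting Y → ∞
forces it to vanish. -/
theorem integral_cauchyExt_cpow_eq_zero (hm : Measurable f) (hf : Integrable f) (h0 : ∀ t, 0 ≤ f t)
    (hpos : 0 < ∫ t, f t) (hp : 1 < p) {y : ℝ} (hy : 0 < y) :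
    ∫ x : ℝ, cauchyExt f (x + y * I) ^ (p : ℂ) = 0 := by
  set K := ∫ s : ℝ, (1 + ‖s‖ ^ 2) ^ (-p / 2)
  set M := (∫⁻ t, ‖f t‖ₑ) ^ p with hM
  have hMt : M ≠ ⊤ := ENNReal.rpow_ne_top_of_nonneg (by linarith) hf.2.ne
  have hb : ∀ Y, y ≤ Y → ‖∫ x : ℝ, cauchyExt f (x + y * I) ^ (p : ℂ)‖ₑ ≤
      M * ENNReal.ofReal (Y ^ (1 - p) * K) := by
    intro Y hY
    have hne : ∀ x : ℝ, cauchyExt f (x + Y * I) ≠ 0 := fun x h => by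
      have := cauchyExt_re_pos hf h0 hpos (z := x + Y * I) (by simpa using hy.trans_le hY)
      rw [h] at this; simp at this
    rw [integral_cauchyExt_cpow_eq hm hf h0 hpos hp hy hY, ← lintegral_inv_rpow_eq hp (hy.trans_le hY)]
    refine (enorm_integral_le_lintegral_enorm _).trans (le_trans (le_of_eq ?_)
      (lintegral_enorm_cauchyExt_rpow_le hm hp Y))
    refine lintegral_congr fun x => ?_
    rw [← ofReal_norm, ← ofReal_norm, norm_cpow_ofReal p (hne x),
      ENNReal.ofReal_rpow_of_nonneg (norm_nonneg _) (by linarith)]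
  have hlim : Tendsto (fun Y : ℝ => M * ENNReal.ofReal (Y ^ (1 - p) * K)) atTop (𝓝 0) := by
    have h1 : Tendsto (fun Y : ℝ => Y ^ (1 - p) * K) atTop (𝓝 0) := by
      have := (tendsto_rpow_neg_atTop (y := p - 1) (by linarith)).mul_const K
      simpa using this
    have h2 := ENNReal.Tendsto.const_mul (ENNReal.tendsto_ofReal h1) (Or.inr hMt)
    simpa using h2
  have := ge_of_tendsto hlim (eventually_atTop.2 ⟨y, hb⟩)
  simpa using this

end Contour

/-! ### Uniform L^p bounds for conjugate Poisson integrals on the line. -/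

/-- The `L^p` estimate for the analytic extension of a nonnegative function. -/
theorem lintegral_enorm_cauchyExt_le {p : ℝ} (hp : 1 < p) (hp2 : p ≤ 2) :
    ∃ A : ℝ, 0 < A ∧ ∀ f : ℝ → ℝ, Measurable f → Integrable f → (∀ t, 0 ≤ f t) → ∀ y : ℝ, 0 < y →
      ∫⁻ x : ℝ, ‖cauchyExt f (x + y * I)‖ₑ ^ p ≤ ENNReal.ofReal A * ∫⁻ t, ‖f t‖ₑ ^ p := by
  obtain ⟨A, B, hA, hB, hAB⟩ := exists_norm_rpow_le hp hp2
  have hp0 : 0 < p := by linarith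
  refine ⟨A * Real.pi ^ p, by positivity, fun f hm hf h0 y hy => ?_⟩
  -- If f = 0 almost everywhere, then F = 0 and the real part is not positive; this case is trivial
  -- but separate.
  rcases (integral_nonneg h0 : 0 ≤ ∫ t, f t).eq_or_lt with hz | hpos
  · have hae := (integral_eq_zero_iff_of_nonneg h0 hf).1 hz.symm
    have : ∀ z, cauchyExt f z = 0 := fun z => by
      rw [cauchyExt, integral_eq_zero_of_ae]
      filter_upwards [hae] with t ht
      simp [ht]
    simp [this, hp0]
  have him : ∀ x : ℝ, 0 < ((x : ℂ) + y * I).im := fun x => by simpa using hy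
  have hre : ∀ x : ℝ, 0 < (cauchyExt f (x + y * I)).re := fun x => cauchyExt_re_pos hf h0 hpos (him x)
  have hcont := continuous_cauchyExt_line hf hy
  have hintp := integrable_cauchyExt_cpow hm hf h0 hpos hp hy
  have hne : ∀ x : ℝ, cauchyExt f (x + y * I) ≠ 0 := fun x h => by
    have := hre x; rw [h] at this; simp at this
  have hN : Integrable fun x : ℝ => ‖cauchyExt f (x + y * I)‖ ^ p := by
    simpa only [norm_cpow_ofReal p (hne _)] using hintp.norm
  have hR : Integrable fun x : ℝ => (cauchyExt f (x + y * I)).re ^ p := by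
    refine hN.mono' ?_ (ae_of_all _ fun x => ?_)
    · exact ((Complex.continuous_re.comp hcont).rpow_const fun x => Or.inr hp0.le).aestronglyMeasurable
    · rw [Real.norm_of_nonneg (Real.rpow_nonneg (hre x).le _)]
      exact Real.rpow_le_rpow (hre x).le (Complex.re_le_norm _) hp0.le
  have hRe : Integrable fun x : ℝ => (cauchyExt f (x + y * I) ^ (p : ℂ)).re := hintp.re
  have hI : ∫ x : ℝ, (cauchyExt f (x + y * I) ^ (p : ℂ)).re = 0 := by
    have := integral_re hintp
    rw [integral_cauchyExt_cpow_eq_zero hm hf h0 hpos hp hy] at this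
    simpa using this
  -- Integrating the pointwise inequality removes the Re F^p term, whose integral is zero.
  have hmain : ∫ x : ℝ, ‖cauchyExt f (x + y * I)‖ ^ p ≤
      A * ∫ x : ℝ, (cauchyExt f (x + y * I)).re ^ p := by
    calc _ ≤ ∫ x : ℝ, (A * (cauchyExt f (x + y * I)).re ^ p -
          B * (cauchyExt f (x + y * I) ^ (p : ℂ)).re) :=
          integral_mono hN ((hR.const_mul A).sub (hRe.const_mul B)) fun x => hAB _ (hre x)
      _ = _ := by
          rw [integral_sub (hR.const_mul A) (hRe.const_mul B), integral_const_mul,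
            integral_const_mul, hI]
          simp
  have hmain' : ∫⁻ x : ℝ, ‖cauchyExt f (x + y * I)‖ₑ ^ p ≤
      ENNReal.ofReal A * ∫⁻ x : ℝ, ENNReal.ofReal (cauchyExt f (x + y * I)).re ^ p := by
    have e1 : ∫⁻ x : ℝ, ‖cauchyExt f (x + y * I)‖ₑ ^ p =
        ENNReal.ofReal (∫ x : ℝ, ‖cauchyExt f (x + y * I)‖ ^ p) := by
      rw [ofReal_integral_eq_lintegral_ofReal hN (ae_of_all _ fun x => by positivity)]
      refine lintegral_congr fun x => ?_
      rw [← ofReal_norm, ENNReal.ofReal_rpow_of_nonneg (norm_nonneg _) hp0.le]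
    have e2 : ∫⁻ x : ℝ, ENNReal.ofReal (cauchyExt f (x + y * I)).re ^ p =
        ENNReal.ofReal (∫ x : ℝ, (cauchyExt f (x + y * I)).re ^ p) := by
      rw [ofReal_integral_eq_lintegral_ofReal hR
        (ae_of_all _ fun x => Real.rpow_nonneg (hre x).le _)]
      refine lintegral_congr fun x => ?_
      rw [ENNReal.ofReal_rpow_of_nonneg (hre x).le hp0.le]
    rw [e1, e2, ← ENNReal.ofReal_mul hA.le]
    exact ENNReal.ofReal_le_ofReal hmain
  refine hmain'.trans ?_
  rw [ENNReal.ofReal_mul hA.le, mul_assoc]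
  gcongr
  -- The mass π is the same for every y, so Young's inequality bounds Re F uniformly in y.
  have hP : ∫⁻ s : ℝ, ENNReal.ofReal (y / (s ^ 2 + y ^ 2)) = ENNReal.ofReal Real.pi := by
    have e : ∀ s : ℝ, y / (s ^ 2 + y ^ 2) = y⁻¹ * (1 + (y⁻¹ * s) ^ 2)⁻¹ := fun s => by
      field_simp; ring
    simp_rw [e]
    rw [← ofReal_integral_eq_lintegral_ofReal]
    · rw [integral_const_mul, Measure.integral_comp_mul_left (fun s : ℝ => (1 + s ^ 2)⁻¹),
        integral_univ_inv_one_add_sq, inv_inv, abs_of_pos hy, smul_eq_mul,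
        inv_mul_cancel_left₀ hy.ne']
    · exact (integrable_inv_one_add_sq.comp_mul_left' (inv_ne_zero hy.ne')).const_mul _
    · exact ae_of_all _ fun t => by positivity
  calc _ ≤ ∫⁻ x : ℝ, (∫⁻ t, ‖f t‖ₑ * ENNReal.ofReal (y / ((x - t) ^ 2 + y ^ 2))) ^ p := by
        refine lintegral_mono fun x => ?_
        gcongr
        rw [cauchyExt_re hf (him x)]
        refine (ENNReal.ofReal_le_ofReal (le_abs_self _)).trans ?_
        rw [← Real.norm_eq_abs, ofReal_norm]
        refine (enorm_integral_le_lintegral_enorm _).trans_eq (lintegral_congr fun t => ?_)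
        rw [enorm_mul]
        congr 1
        simp only [add_im, ofReal_im, mul_im, ofReal_re, I_im, mul_one, I_re, mul_zero, add_zero,
          zero_add, add_re, mul_re, sub_self]
        rw [Real.enorm_of_nonneg (by positivity)]
    _ ≤ _ := by
        refine (lintegral_conv_rpow_le (φ := fun t => ‖f t‖ₑ)
          (ψ := fun s => ENNReal.ofReal (y / (s ^ 2 + y ^ 2))) hp (by fun_prop)
          (by fun_prop)).trans_eq ?_
        rw [hP, ENNReal.ofReal_rpow_of_nonneg Real.pi_pos.le hp0.le]

/-- The conjugate Poisson kernel (without the factor `1/π`). -/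
noncomputable def conjKernel (y s : ℝ) : ℝ := s / (s ^ 2 + y ^ 2)

theorem continuous_conjKernel {y : ℝ} (hy : 0 < y) : Continuous (conjKernel y) :=
  continuous_id.div (by fun_prop) fun s => by positivity

theorem norm_conjKernel_le {y : ℝ} (hy : 0 < y) (s : ℝ) : ‖conjKernel y s‖ ≤ 1 / y := by
  rw [conjKernel, norm_div, Real.norm_eq_abs, Real.norm_of_nonneg (by positivity),
    div_le_div_iff₀ (by positivity) hy]
  nlinarith [sq_nonneg (|s| - y), sq_abs s, abs_nonneg s, sq_nonneg s]

theorem integrable_conjKernel_mul {f : ℝ → ℂ} (hf : Integrable f) {y : ℝ} (hy : 0 < y) (x : ℝ) :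
    Integrable fun t => (conjKernel y (x - t) : ℂ) * f t :=
  hf.bdd_mul (c := 1 / y) (Continuous.aestronglyMeasurable (by
    have := continuous_conjKernel hy
    fun_prop)) (ae_of_all _ fun t => by
      rw [Complex.norm_real]; exact norm_conjKernel_le hy _)

theorem continuous_conjConv {f : ℝ → ℂ} (hf : Integrable f) {y : ℝ} (hy : 0 < y) :
    Continuous fun x => ∫ t, (conjKernel y (x - t) : ℂ) * f t := by
  refine continuous_of_dominated (bound := fun t => 1 / y * ‖f t‖)
    (fun x => (integrable_conjKernel_mul hf hy x).aestronglyMeasurable)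
    (fun x => ae_of_all _ fun t => ?_) (hf.norm.const_mul _) (ae_of_all _ fun t => ?_)
  · rw [norm_mul, Complex.norm_real]
    gcongr
    exact norm_conjKernel_le hy _
  · have := continuous_conjKernel hy
    fun_prop

/-- The convolution is the imaginary part of the Cauchy integral, hence dominated by its modulus. -/
theorem eLpNorm_conjConv_nonneg_le {p : ℝ} (hp : 1 < p) (hp2 : p ≤ 2) :
    ∃ A : ℝ, 0 < A ∧ ∀ f : ℝ → ℝ, Measurable f → Integrable f → (∀ t, 0 ≤ f t) → ∀ y : ℝ, 0 < y →
      eLpNorm (fun x => ∫ t, (conjKernel y (x - t) : ℂ) * (f t : ℂ)) (ENNReal.ofReal p) volume ≤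
        ENNReal.ofReal A * eLpNorm f (ENNReal.ofReal p) volume := by
  obtain ⟨A, hA, h⟩ := lintegral_enorm_cauchyExt_le hp hp2
  have hp0 : 0 < p := by linarith
  refine ⟨A ^ (1 / p), by positivity, fun f hm hf h0 y hy => ?_⟩
  have h1 := h f hm hf h0 y hy
  have hpne : ENNReal.ofReal p ≠ 0 := by simpa using hp0
  rw [eLpNorm_eq_lintegral_rpow_enorm_toReal hpne ENNReal.ofReal_ne_top,
    eLpNorm_eq_lintegral_rpow_enorm_toReal hpne ENNReal.ofReal_ne_top, ENNReal.toReal_ofReal hp0.le,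
    ← ENNReal.ofReal_rpow_of_pos hA, ← ENNReal.mul_rpow_of_nonneg _ _ (by positivity)]
  gcongr
  refine le_trans (lintegral_mono fun x => ?_) h1
  gcongr
  have him : 0 < ((x : ℂ) + y * I).im := by simpa using hy
  have e : ∫ t, (conjKernel y (x - t) : ℂ) * (f t : ℂ) = ((cauchyExt f (x + y * I)).im : ℂ) := by
    rw [cauchyExt_im hf him, ← integral_complex_ofReal]
    refine integral_congr_ae (ae_of_all _ fun t => ?_)
    simp [conjKernel, mul_comm]
  rw [e, ← ofReal_norm, ← ofReal_norm, Complex.norm_real]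
  exact ENNReal.ofReal_le_ofReal (Complex.abs_im_le_norm _)

/-- The conjugate Poisson integrals are uniformly bounded on `L^p(ℝ)`. -/
theorem eLpNorm_conjConv_le {p : ℝ} (hp : 1 < p) (hp2 : p ≤ 2) :
    ∃ A : ℝ, 0 < A ∧ ∀ f : ℝ → ℂ, Measurable f → Integrable f → ∀ y : ℝ, 0 < y →
      eLpNorm (fun x => ∫ t, (conjKernel y (x - t) : ℂ) * f t) (ENNReal.ofReal p) volume ≤
        ENNReal.ofReal A * eLpNorm f (ENNReal.ofReal p) volume := by
  obtain ⟨A, hA, h⟩ := eLpNorm_conjConv_nonneg_le hp hp2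
  have hp1 : 1 ≤ ENNReal.ofReal p := by simpa using hp.le
  have hreal : ∀ g : ℝ → ℝ, Measurable g → Integrable g → ∀ y : ℝ, 0 < y →
      eLpNorm (fun x => ∫ t, (conjKernel y (x - t) : ℂ) * (g t : ℂ)) (ENNReal.ofReal p) volume ≤
        ENNReal.ofReal (2 * A) * eLpNorm g (ENNReal.ofReal p) volume := by
    intro g hm hg y hy
    have hg1 : Integrable fun t => ((max (g t) 0 : ℝ) : ℂ) := hg.pos_part.ofReal
    have hg2 : Integrable fun t => ((max (-g t) 0 : ℝ) : ℂ) := hg.neg_part.ofReal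
    have hsplit : (fun x => ∫ t, (conjKernel y (x - t) : ℂ) * (g t : ℂ)) =
        (fun x => ∫ t, (conjKernel y (x - t) : ℂ) * ((max (g t) 0 : ℝ) : ℂ)) -
        fun x => ∫ t, (conjKernel y (x - t) : ℂ) * ((max (-g t) 0 : ℝ) : ℂ) := by
      funext x
      rw [Pi.sub_apply, ← integral_sub (integrable_conjKernel_mul hg1 hy x)
        (integrable_conjKernel_mul hg2 hy x)]
      refine integral_congr_ae (ae_of_all _ fun t => ?_)
      simp only []
      rw [← mul_sub, ← Complex.ofReal_sub, max_zero_sub_max_neg_zero_eq_self]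
    have hpn : eLpNorm (fun t => max (g t) 0) (ENNReal.ofReal p) volume ≤
        eLpNorm g (ENNReal.ofReal p) volume := eLpNorm_mono fun t => by
      rw [Real.norm_of_nonneg (le_max_right _ _)]
      exact max_le (le_abs_self _) (abs_nonneg _)
    have hnn : eLpNorm (fun t => max (-g t) 0) (ENNReal.ofReal p) volume ≤
        eLpNorm g (ENNReal.ofReal p) volume := eLpNorm_mono fun t => by
      rw [Real.norm_of_nonneg (le_max_right _ _)]
      exact max_le (neg_le_abs _) (abs_nonneg _)
    rw [hsplit]
    refine (eLpNorm_sub_le (continuous_conjConv hg1 hy).aestronglyMeasurable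
      (continuous_conjConv hg2 hy).aestronglyMeasurable hp1).trans ?_
    refine (add_le_add (h _ (hm.max measurable_const) hg.pos_part (fun t => le_max_right _ _) y hy)
      (h _ (hm.neg.max measurable_const) hg.neg_part (fun t => le_max_right _ _) y hy)).trans ?_
    rw [ENNReal.ofReal_mul zero_le_two, ENNReal.ofReal_ofNat, mul_assoc, two_mul]
    exact add_le_add (mul_le_mul_right hpn _) (mul_le_mul_right hnn _)
  -- One factor 2 comes from real and imaginary parts, the other from positive and negative parts.
  refine ⟨2 * (2 * A), by positivity, fun f hm hf y hy => ?_⟩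
  have hre : Integrable fun t => (f t).re := hf.re
  have him : Integrable fun t => (f t).im := hf.im
  have hre' : Integrable fun t => ((f t).re : ℂ) := hre.ofReal
  have him' : Integrable fun t => ((f t).im : ℂ) := him.ofReal
  have hsplit : (fun x => ∫ t, (conjKernel y (x - t) : ℂ) * f t) =
      (fun x => ∫ t, (conjKernel y (x - t) : ℂ) * ((f t).re : ℂ)) +
      I • fun x => ∫ t, (conjKernel y (x - t) : ℂ) * ((f t).im : ℂ) := by
    funext x
    rw [Pi.add_apply, Pi.smul_apply, smul_eq_mul, ← integral_const_mul,
      ← integral_add (integrable_conjKernel_mul hre' hy x)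
      ((integrable_conjKernel_mul him' hy x).const_mul I)]
    refine integral_congr_ae (ae_of_all _ fun t => ?_)
    conv_lhs => simp only []; rw [← Complex.re_add_im (f t)]
    ring
  rw [hsplit]
  refine (eLpNorm_add_le (continuous_conjConv hre' hy).aestronglyMeasurable
    ((continuous_conjConv him' hy).aestronglyMeasurable.const_smul I) hp1).trans ?_
  rw [eLpNorm_const_smul]
  have hI : ‖I‖ₑ = 1 := by simp [enorm_eq_nnnorm]
  rw [hI, one_mul]
  refine (add_le_add (hreal _ (by fun_prop) hre y hy) (hreal _ (by fun_prop) him y hy)).trans ?_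
  have n1 : eLpNorm (fun t => (f t).re) (ENNReal.ofReal p) volume ≤
      eLpNorm f (ENNReal.ofReal p) volume := eLpNorm_mono fun t => Complex.abs_re_le_norm _
  have n2 : eLpNorm (fun t => (f t).im) (ENNReal.ofReal p) volume ≤
      eLpNorm f (ENNReal.ofReal p) volume := eLpNorm_mono fun t => Complex.abs_im_le_norm _
  rw [ENNReal.ofReal_mul (p := 2) (q := 2 * A) zero_le_two, ENNReal.ofReal_ofNat,
    mul_assoc 2 (ENNReal.ofReal (2 * A)), two_mul (ENNReal.ofReal (2 * A) * _)]
  exact add_le_add (mul_le_mul_right n1 _) (mul_le_mul_right n2 _)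

/-! ### Multipliers as bilinear forms, and their symmetries. -/

/-- The bilinear form `∫ (T_b f) g` of the Fourier multiplier with symbol `b` (with respect to
Mathlib's normalisation of the Fourier transform), written on the Fourier side. -/
noncomputable def multForm (b : Plane → ℂ) (f g : 𝓢(Plane, ℂ)) : ℂ :=
  ∫ η, b η * (𝓕 f η * 𝓕⁻ g η)

/-- `b` is the symbol of a Fourier multiplier with `|∫ (T_b f) g| ≤ C ‖f‖_p ‖g‖_q`. -/
def IsMult (p q : ℝ≥0∞) (C : ℝ) (b : Plane → ℂ) : Prop :=
  ∀ f g : 𝓢(Plane, ℂ), ‖multForm b f g‖ ≤ C * (‖f.toLp p volume‖ * ‖g.toLp q volume‖)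

theorem integrable_fourier_mul (f g : 𝓢(Plane, ℂ)) : Integrable fun η => 𝓕 f η * 𝓕⁻ g η :=
  (𝓕 f).integrable.mul_bdd (c := SchwartzMap.seminorm ℝ 0 0 (𝓕⁻ g))
    (𝓕⁻ g).continuous.aestronglyMeasurable
    (ae_of_all _ fun η => (𝓕⁻ g).norm_le_seminorm ℝ η)

theorem integrable_multForm {b : Plane → ℂ} (hb : AEStronglyMeasurable b volume) {M : ℝ}
    (hM : ∀ η, ‖b η‖ ≤ M) (f g : 𝓢(Plane, ℂ)) : Integrable fun η => b η * (𝓕 f η * 𝓕⁻ g η) :=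
  (integrable_fourier_mul f g).bdd_mul (c := M) hb (ae_of_all _ hM)

theorem IsMult.congr {p q : ℝ≥0∞} {C : ℝ} {b b' : Plane → ℂ} (h : IsMult p q C b)
    (hb : b =ᵐ[volume] b') : IsMult p q C b' := by
  intro f g
  have : multForm b' f g = multForm b f g := by
    refine integral_congr_ae ?_
    filter_upwards [hb] with η hη
    rw [hη]
  rw [this]
  exact h f g

theorem IsMult.const_mul {p q : ℝ≥0∞} {C : ℝ} {b : Plane → ℂ} (h : IsMult p q C b) (c : ℂ) :
    IsMult p q (‖c‖ * C) fun η => c * b η := by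
  intro f g
  have : multForm (fun η => c * b η) f g = c * multForm b f g := by
    simp only [multForm, mul_assoc, integral_const_mul]
  rw [this, norm_mul, mul_assoc]
  gcongr
  exact h f g

/-- Fubini's theorem, since the weight is integrable, the symbols are uniformly bounded and f̂ ǧ is
integrable. -/
theorem multForm_average {Ω : Type*} [MeasurableSpace Ω] {ν : Measure Ω} [SFinite ν]
    {B : Ω → Plane → ℂ} {w : Ω → ℂ} {b : Plane → ℂ} {M : ℝ}
    (hw : Integrable w ν) (hB : AEStronglyMeasurable (Function.uncurry B) (ν.prod volume))
    (hM : ∀ o η, ‖B o η‖ ≤ M) (hb : ∀ᵐ η, b η = ∫ o, w o * B o η ∂ν) (f g : 𝓢(Plane, ℂ)) :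
    multForm b f g = ∫ o, w o * multForm (B o) f g ∂ν := by
  have h_integrable : Integrable (fun z : Ω × Plane => (w z.1 * (𝓕 f z.2 * 𝓕⁻ g z.2)) * B z.1 z.2)
      (ν.prod volume) :=
    (hw.mul_prod (integrable_fourier_mul f g)).mul_bdd (c := M) hB
      (ae_of_all _ fun z => hM z.1 z.2)
  calc multForm b f g = ∫ η, ∫ o, (w o * (𝓕 f η * 𝓕⁻ g η)) * B o η ∂ν := by
        refine integral_congr_ae ?_
        filter_upwards [hb] with η hη
        rw [hη, ← integral_mul_const]
        refine integral_congr_ae (ae_of_all _ fun o => ?_)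
        simp only []
        ring
    _ = ∫ o, (∫ η, (w o * (𝓕 f η * 𝓕⁻ g η)) * B o η) ∂ν := (integral_integral_swap h_integrable).symm
    _ = _ := by
        refine integral_congr_ae (ae_of_all _ fun o => ?_)
        simp only [multForm]
        rw [← integral_const_mul]
        refine integral_congr_ae (ae_of_all _ fun η => ?_)
        simp only []
        ring

/-- Averages of multipliers are multipliers. -/
theorem IsMult.average {p q : ℝ≥0∞} {C : ℝ} {Ω : Type*} [MeasurableSpace Ω]
    {ν : Measure Ω} [SFinite ν] {B : Ω → Plane → ℂ} {w : Ω → ℂ} {b : Plane → ℂ} {M : ℝ}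
    (hw : Integrable w ν) (hB : AEStronglyMeasurable (Function.uncurry B) (ν.prod volume))
    (hM : ∀ o η, ‖B o η‖ ≤ M) (hb : ∀ᵐ η, b η = ∫ o, w o * B o η ∂ν)
    (h : ∀ᵐ o ∂ν, IsMult p q C (B o)) : IsMult p q ((∫ o, ‖w o‖ ∂ν) * C) b := by
  intro f g
  rw [multForm_average hw hB hM hb, mul_assoc, ← integral_mul_const]
  refine norm_integral_le_of_norm_le (hw.norm.mul_const _) ?_
  filter_upwards [h] with o ho
  rw [norm_mul]
  gcongr
  exact ho f g

/-- Bounded pointwise limits of multipliers are multipliers. -/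
theorem IsMult.of_tendsto {p q : ℝ≥0∞} {C : ℝ} {B : ℕ → Plane → ℂ} {b : Plane → ℂ} {M : ℝ}
    (hB : ∀ n, AEStronglyMeasurable (B n) volume) (hM : ∀ n η, ‖B n η‖ ≤ M)
    (hb : ∀ᵐ η, Tendsto (fun n => B n η) atTop (𝓝 (b η)))
    (h : ∀ n, IsMult p q C (B n)) : IsMult p q C b := by
  intro f g
  have hlim : Tendsto (fun n => multForm (B n) f g) atTop (𝓝 (multForm b f g)) := by
    refine tendsto_integral_of_dominated_convergence (fun η => M * ‖𝓕 f η * 𝓕⁻ g η‖)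
      (fun n => (integrable_multForm (hB n) (hM n) f g).aestronglyMeasurable)
      ((integrable_fourier_mul f g).norm.const_mul M) (fun n => ae_of_all _ fun η => ?_) ?_
    · rw [norm_mul]
      gcongr
      exact hM n η
    · filter_upwards [hb] with η hη
      exact hη.mul_const _
  exact le_of_tendsto hlim.norm (Eventually.of_forall fun n => h n f g)

theorem norm_toLp_compSubConst (f : 𝓢(Plane, ℂ)) (y : Plane) (p : ℝ≥0∞) :
    ‖(f.compSubConstCLM ℂ y).toLp p volume‖ = ‖f.toLp p volume‖ := by
  rw [SchwartzMap.norm_toLp, SchwartzMap.norm_toLp]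
  congr 1
  exact eLpNorm_comp_measurePreserving (f := fun x => x - y) f.continuous.aestronglyMeasurable
    (measurePreserving_sub_right volume y)

theorem fourier_compSubConst (f : 𝓢(Plane, ℂ)) (y η : Plane) :
    𝓕 (f.compSubConstCLM ℂ y) η = Complex.exp ((-2 * Real.pi * inner ℝ y η : ℝ) * I) * 𝓕 f η := by
  rw [SchwartzMap.fourier_coe, SchwartzMap.fourier_coe, Real.fourier_eq', Real.fourier_eq',
    ← integral_const_mul, ← integral_add_right_eq_self _ y]
  refine integral_congr_ae (ae_of_all _ fun x => ?_)
  simp only [SchwartzMap.compSubConstCLM_apply, add_sub_cancel_right, smul_eq_mul]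
  rw [← mul_assoc, ← Complex.exp_add]
  congr 2
  rw [inner_add_left]
  push_cast
  ring

/-- Translating the first argument modulates the symbol. -/
theorem multForm_exp_mul (b : Plane → ℂ) (y : Plane) (f g : 𝓢(Plane, ℂ)) :
    multForm (fun η => Complex.exp ((2 * Real.pi * inner ℝ y η : ℝ) * I) * b η) f g =
      multForm b (f.compSubConstCLM ℂ (-y)) g := by
  refine integral_congr_ae (ae_of_all _ fun η => ?_)
  simp only [fourier_compSubConst, inner_neg_left]
  rw [show (-2 * Real.pi * -inner ℝ y η : ℝ) = 2 * Real.pi * inner ℝ y η by ring]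
  ring

theorem IsMult.exp_mul {p q : ℝ≥0∞} {C : ℝ} {b : Plane → ℂ} (h : IsMult p q C b) (y : Plane) :
    IsMult p q C fun η => Complex.exp ((2 * Real.pi * inner ℝ y η : ℝ) * I) * b η := by
  intro f g
  rw [multForm_exp_mul, ← norm_toLp_compSubConst f (-y)]
  exact h _ _

/-- Transposing the form reflects the symbol. -/
theorem IsMult.swap {p q : ℝ≥0∞} {C : ℝ} {b : Plane → ℂ} (h : IsMult p q C b) :
    IsMult q p C fun η => b (-η) := by
  intro f g
  have : multForm (fun η => b (-η)) f g = multForm b g f := by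
    rw [multForm, ← integral_neg_eq_self]
    refine integral_congr_ae (ae_of_all _ fun η => ?_)
    simp only [neg_neg, SchwartzMap.fourier_coe, SchwartzMap.fourierInv_coe,
      Real.fourierInv_eq_fourier_neg]
    ring
  rw [this, mul_comm ‖f.toLp q volume‖]
  exact h g f

/-- Multipliers can be rotated. -/
theorem IsMult.comp_isometry {p q : ℝ≥0∞} {C : ℝ} {b : Plane → ℂ} (h : IsMult p q C b)
    (A : Plane ≃ₗᵢ[ℝ] Plane) : IsMult p q C fun η => b (A η) := by
  intro f g
  let R : 𝓢(Plane, ℂ) → 𝓢(Plane, ℂ) := fun f =>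
    SchwartzMap.compCLMOfContinuousLinearEquiv ℂ (A.symm.toContinuousLinearEquiv) f
  have hR : ∀ f : 𝓢(Plane, ℂ), ⇑(R f) = f ∘ A.symm := fun f => rfl
  have hn : ∀ (f : 𝓢(Plane, ℂ)) (p : ℝ≥0∞), ‖(R f).toLp p volume‖ = ‖f.toLp p volume‖ := by
    intro f p
    rw [SchwartzMap.norm_toLp, SchwartzMap.norm_toLp, hR]
    congr 1
    exact eLpNorm_comp_measurePreserving f.continuous.aestronglyMeasurable
      A.symm.measurePreserving
  -- The Fourier transform commutes with isometries, so rotating the symbol amounts to rotating both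
  -- arguments, which preserves their norms.
  have e : multForm (fun η => b (A η)) f g = multForm b (R f) (R g) := by
    rw [multForm, multForm]
    refine Eq.trans ?_ (A.measurePreserving.integral_comp A.toHomeomorph.measurableEmbedding
      fun η => b η * (𝓕 (R f) η * 𝓕⁻ (R g) η))
    refine integral_congr_ae (ae_of_all _ fun η => ?_)
    simp only [SchwartzMap.fourier_coe, SchwartzMap.fourierInv_coe,
      Real.fourierInv_eq_fourier_neg, hR]
    rw [Real.fourier_comp_linearIsometry, Real.fourier_comp_linearIsometry]
    simp
  rw [e, ← hn f, ← hn g]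
  exact h _ _

theorem multForm_one (f g : 𝓢(Plane, ℂ)) : multForm (fun _ => 1) f g = ∫ x, f x * g x := by
  have := SchwartzMap.integral_fourier_smul_eq f (𝓕⁻ g)
  simpa [multForm] using this

/-! ### The regularised sign function and its Fourier transform. -/

/-- A continuous, integrable approximation of the sign function. -/
noncomputable def softSign (y Y η : ℝ) : ℝ :=
  (Real.exp (-(2 * Real.pi * y) * max η 0) - Real.exp (-(2 * Real.pi * Y) * max η 0)) -
    (Real.exp (-(2 * Real.pi * y) * max (-η) 0) - Real.exp (-(2 * Real.pi * Y) * max (-η) 0))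

theorem continuous_softSign (y Y : ℝ) : Continuous (softSign y Y) := by
  unfold softSign; fun_prop

theorem softSign_of_pos {η : ℝ} (y Y : ℝ) (h : 0 < η) : softSign y Y η =
    Real.exp (-(2 * Real.pi * y) * η) - Real.exp (-(2 * Real.pi * Y) * η) := by
  simp [softSign, max_eq_left h.le, max_eq_right (neg_nonpos.2 h.le)]

theorem softSign_of_nonpos {η : ℝ} (y Y : ℝ) (h : η ≤ 0) : softSign y Y η =
    -(Real.exp ((2 * Real.pi * y) * η) - Real.exp ((2 * Real.pi * Y) * η)) := by
  simp [softSign, max_eq_right h, max_eq_left (neg_nonneg.2 h)]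

theorem norm_softSign_le {y Y : ℝ} (hy : 0 < y) (hY : 0 < Y) (η : ℝ) : ‖softSign y Y η‖ ≤ 2 := by
  have h : ∀ {c r : ℝ}, 0 < c → 0 ≤ r → Real.exp (-(2 * Real.pi * c) * r) ≤ 1 := fun hc hr =>
    Real.exp_le_one_iff.2 (by
      have := mul_nonneg (mul_pos (mul_pos two_pos Real.pi_pos) hc).le hr
      linarith)
  have e := Real.exp_pos
  have h1 := h hy (le_max_right η 0)
  have h2 := h hY (le_max_right η 0)
  have h3 := h hy (le_max_right (-η) 0)
  have h4 := h hY (le_max_right (-η) 0)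
  have e1 := e (-(2 * Real.pi * y) * max η 0)
  have e2 := e (-(2 * Real.pi * Y) * max η 0)
  have e3 := e (-(2 * Real.pi * y) * max (-η) 0)
  have e4 := e (-(2 * Real.pi * Y) * max (-η) 0)
  rw [Real.norm_eq_abs, abs_le, softSign]
  constructor <;> linarith

theorem tendsto_softSign {η : ℝ} (hη : η ≠ 0) :
    Tendsto (fun n : ℕ => softSign (1 / ((n : ℝ) + 1)) ((n : ℝ) + 1) η) atTop
      (𝓝 (Real.sign η)) := by
  have key : ∀ {r : ℝ}, 0 < r → Tendsto (fun n : ℕ =>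
      Real.exp (-(2 * Real.pi * (1 / ((n : ℝ) + 1))) * r) -
        Real.exp (-(2 * Real.pi * ((n : ℝ) + 1)) * r)) atTop (𝓝 (1 - 0)) := by
    intro r hr
    refine Tendsto.sub ?_ ?_
    · have h : Tendsto (fun n : ℕ => -(2 * Real.pi * (1 / ((n : ℝ) + 1))) * r) atTop
          (𝓝 (-(2 * Real.pi * 0) * r)) :=
        (((tendsto_one_div_add_atTop_nhds_zero_nat (𝕜 := ℝ)).const_mul _).neg).mul_const r
      simpa [Function.comp_def] using (Real.continuous_exp.tendsto _).comp h
    · refine Real.tendsto_exp_atBot.comp ?_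
      have h1 : Tendsto (fun n : ℕ => (n : ℝ) + 1) atTop atTop :=
        tendsto_atTop_add_const_right _ _ tendsto_natCast_atTop_atTop
      have h2 := tendsto_neg_atTop_atBot.comp
        ((h1.const_mul_atTop (mul_pos two_pos Real.pi_pos)).atTop_mul_const hr)
      refine h2.congr fun n => ?_
      simp
  rcases lt_or_gt_of_ne hη with h | h
  · rw [Real.sign_of_neg h]
    have := (key (neg_pos.2 h)).neg
    rw [sub_zero] at this
    refine this.congr fun n => ?_
    rw [softSign_of_nonpos _ _ h.le]
    congr 3 <;> ring
  · rw [Real.sign_of_pos h]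
    have := key h
    rw [sub_zero] at this
    refine this.congr fun n => ?_
    rw [softSign_of_pos _ _ h]

theorem integrableOn_exp_mul_softSign {y Y : ℝ} (hy : 0 < y) (hY : 0 < Y) (t : ℝ) :
    IntegrableOn (fun η : ℝ => Complex.exp ((-2 * Real.pi * (η * t) : ℝ) * I) * softSign y Y η)
      (Set.Ioi 0) ∧
    IntegrableOn (fun η : ℝ => Complex.exp ((-2 * Real.pi * (η * t) : ℝ) * I) * softSign y Y η)
      (Set.Iic 0) ∧
    (∫ η in Set.Ioi (0 : ℝ), Complex.exp ((-2 * Real.pi * (η * t) : ℝ) * I) * softSign y Y η =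
      1 / (2 * Real.pi * (y + t * I)) - 1 / (2 * Real.pi * (Y + t * I))) ∧
    (∫ η in Set.Iic (0 : ℝ), Complex.exp ((-2 * Real.pi * (η * t) : ℝ) * I) * softSign y Y η =
      -(1 / (2 * Real.pi * (y - t * I)) - 1 / (2 * Real.pi * (Y - t * I)))) := by
  have hpi := Real.pi_pos
  have re1 : ∀ {c : ℝ}, 0 < c → (-(2 * Real.pi * (c + t * I)) : ℂ).re < 0 := by
    intro c hc; simp; positivity
  have re2 : ∀ {c : ℝ}, 0 < c → 0 < (2 * Real.pi * (c - t * I) : ℂ).re := by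
    intro c hc; simp; positivity
  have e1 : ∀ η ∈ Set.Ioi (0 : ℝ),
      Complex.exp ((-2 * Real.pi * (η * t) : ℝ) * I) * softSign y Y η =
      Complex.exp (-(2 * Real.pi * (y + t * I)) * η) -
        Complex.exp (-(2 * Real.pi * (Y + t * I)) * η) := by
    intro η hη
    rw [softSign_of_pos _ _ hη]
    push_cast
    rw [mul_sub, ← Complex.exp_add, ← Complex.exp_add]
    congr 2 <;> ring
  have e2 : ∀ η ∈ Set.Iic (0 : ℝ),
      Complex.exp ((-2 * Real.pi * (η * t) : ℝ) * I) * softSign y Y η =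
      -(Complex.exp ((2 * Real.pi * (y - t * I)) * η) -
        Complex.exp ((2 * Real.pi * (Y - t * I)) * η)) := by
    intro η hη
    rw [softSign_of_nonpos _ _ hη]
    push_cast
    rw [mul_neg, mul_sub, ← Complex.exp_add, ← Complex.exp_add]
    congr 3 <;> ring
  have i1 := fun {c : ℝ} (hc : 0 < c) => integrableOn_exp_mul_complex_Ioi (re1 hc) 0
  have i2 := fun {c : ℝ} (hc : 0 < c) => integrableOn_exp_mul_complex_Iic (re2 hc) 0
  refine ⟨?_, ?_, ?_, ?_⟩
  · exact ((i1 hy).sub (i1 hY)).congr_fun (fun η hη => (e1 η hη).symm) measurableSet_Ioi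
  · exact ((i2 hy).sub (i2 hY)).neg.congr_fun (fun η hη => (e2 η hη).symm) measurableSet_Iic
  · rw [setIntegral_congr_fun measurableSet_Ioi e1, integral_sub (i1 hy) (i1 hY),
      integral_exp_mul_complex_Ioi (re1 hy), integral_exp_mul_complex_Ioi (re1 hY)]
    simp [neg_div_neg_eq]
  · rw [setIntegral_congr_fun measurableSet_Iic e2, integral_neg, integral_sub (i2 hy) (i2 hY),
      integral_exp_mul_complex_Iic (re2 hy), integral_exp_mul_complex_Iic (re2 hY)]
    simp

/-- On each half line the symbol is a difference of exponentials, and 1/(y+it) - 1/(y-it) =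
-2it/(t²+y²). -/
theorem fourier_softSign {y Y : ℝ} (hy : 0 < y) (hY : 0 < Y) (t : ℝ) :
    𝓕 (fun η => (softSign y Y η : ℂ)) t =
      (-(I / Real.pi)) * ((conjKernel y t - conjKernel Y t : ℝ) : ℂ) := by
  obtain ⟨h1, h2, h3, h4⟩ := integrableOn_exp_mul_softSign hy hY t
  have e : 𝓕 (fun η => (softSign y Y η : ℂ)) t =
      ∫ η : ℝ, Complex.exp ((-2 * Real.pi * (η * t) : ℝ) * I) * softSign y Y η := by
    rw [Real.fourier_eq']
    refine integral_congr_ae (ae_of_all _ fun η => ?_)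
    simp [mul_comm]
  have hpi : (Real.pi : ℂ) ≠ 0 := by exact_mod_cast Real.pi_pos.ne'
  have n1 : ∀ {c : ℝ}, 0 < c → (c + t * I : ℂ) ≠ 0 := fun {c} hc h => by
    have := congrArg Complex.re h; simp at this; exact hc.ne' this
  have n2 : ∀ {c : ℝ}, 0 < c → (c - t * I : ℂ) ≠ 0 := fun {c} hc h => by
    have := congrArg Complex.re h; simp at this; exact hc.ne' this
  have sq : ∀ {c : ℝ}, 0 < c → ((conjKernel c t : ℝ) : ℂ) = t / ((c + t * I) * (c - t * I)) := by
    intro c hc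
    have : ((c : ℂ) + t * I) * (c - t * I) = ((t ^ 2 + c ^ 2 : ℝ) : ℂ) := by
      push_cast; ring_nf; rw [I_sq]; ring
    rw [this, conjKernel]; push_cast; rfl
  rw [e, ← setIntegral_univ, ← Set.Iic_union_Ioi (a := (0 : ℝ)),
    setIntegral_union (Set.Iic_disjoint_Ioi le_rfl) measurableSet_Ioi h2 h1, h3, h4,
    Complex.ofReal_sub, sq hy, sq hY]
  have a1 := n1 hy
  have a2 := n2 hy
  have a3 := n1 hY
  have a4 := n2 hY
  field_simp
  ring

theorem integrable_softSign {y Y : ℝ} (hy : 0 < y) (hY : 0 < Y) :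
    Integrable fun η => (softSign y Y η : ℂ) := by
  obtain ⟨h1, h2, -, -⟩ := integrableOn_exp_mul_softSign hy hY 0
  have := h2.union h1
  rw [Set.Iic_union_Ioi, integrableOn_univ] at this
  simpa using this

/-- A single conjugate Poisson kernel decays only like 1/t; in the difference the leading terms
cancel. This is why the approximation has a second parameter Y: Fourier inversion needs both sides
integrable. -/
theorem integrable_conjKernel_sub {y Y : ℝ} (hy : 0 < y) (hY : 0 < Y) :
    Integrable fun t => conjKernel y t - conjKernel Y t := by
  have hi : Integrable fun t : ℝ => |Y ^ 2 - y ^ 2| / y * (Y ^ 2)⁻¹ * (1 + (Y⁻¹ * t) ^ 2)⁻¹ :=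
    (integrable_inv_one_add_sq.comp_mul_left' (inv_ne_zero hY.ne')).const_mul _
  refine hi.mono' ((continuous_conjKernel hy).sub (continuous_conjKernel hY)).aestronglyMeasurable
    (ae_of_all _ fun t => ?_)
  have e : conjKernel y t - conjKernel Y t =
      -- The last two factors together are 1/(t²+Y²).
      conjKernel y t * ((Y ^ 2 - y ^ 2) * ((Y ^ 2)⁻¹ * (1 + (Y⁻¹ * t) ^ 2)⁻¹)) := by
    have h1 : t ^ 2 + y ^ 2 ≠ 0 := by positivity
    have h2 : t ^ 2 + Y ^ 2 ≠ 0 := by positivity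
    have h3 : (Y ^ 2)⁻¹ * (1 + (Y⁻¹ * t) ^ 2)⁻¹ = (t ^ 2 + Y ^ 2)⁻¹ := by
      rw [← mul_inv]; congr 1; field_simp; ring
    rw [h3, conjKernel, conjKernel]
    field_simp
    ring
  rw [e, norm_mul, norm_mul, Real.norm_of_nonneg (by positivity :
    0 ≤ (Y ^ 2)⁻¹ * (1 + (Y⁻¹ * t) ^ 2)⁻¹), Real.norm_eq_abs (Y ^ 2 - y ^ 2)]
  calc _ ≤ 1 / y * (|Y ^ 2 - y ^ 2| * ((Y ^ 2)⁻¹ * (1 + (Y⁻¹ * t) ^ 2)⁻¹)) := by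
        gcongr
        exact norm_conjKernel_le hy t
    _ = _ := by ring

theorem softSign_eq_integral {y Y : ℝ} (hy : 0 < y) (hY : 0 < Y) (η : ℝ) :
    (softSign y Y η : ℂ) = ∫ t : ℝ, (-(I / Real.pi)) * ((conjKernel y t - conjKernel Y t : ℝ) : ℂ) *
      Complex.exp ((2 * Real.pi * (t * η) : ℝ) * I) := by
  have hF : 𝓕 (fun η => (softSign y Y η : ℂ)) = fun t =>
      (-(I / Real.pi)) * ((conjKernel y t - conjKernel Y t : ℝ) : ℂ) :=
    funext (fourier_softSign hy hY)
  have := congrFun (Continuous.fourierInv_fourier_eq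
    (Complex.continuous_ofReal.comp (continuous_softSign y Y)) (integrable_softSign hy hY)
    (by
      change Integrable (𝓕 (fun η => (softSign y Y η : ℂ)))
      rw [hF]; exact (integrable_conjKernel_sub hy hY).ofReal.const_mul _)) η
  change 𝓕⁻ (𝓕 (fun η => (softSign y Y η : ℂ))) η = (softSign y Y η : ℂ) at this
  rw [← this, hF, Real.fourierInv_eq']
  refine integral_congr_ae (ae_of_all _ fun t => ?_)
  simp [mul_comm]

/-! ### The Hilbert transform in the first variable of the plane. -/

/-- The first coordinate vector. -/
noncomputable def e₀ : Plane := EuclideanSpace.single 0 1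

/-- The identification `ℝ × ℝ ≃ Plane`. -/
noncomputable def planeEquiv : ℝ × ℝ ≃ᵐ Plane :=
  (MeasurableEquiv.finTwoArrow (α := ℝ)).symm.trans (MeasurableEquiv.toLp 2 (Fin 2 → ℝ))

theorem measurePreserving_planeEquiv : MeasurePreserving planeEquiv volume volume :=
  ((EuclideanSpace.volume_preserving_symm_measurableEquiv_toLp (Fin 2)).symm _).comp
    ((volume_preserving_finTwoArrow ℝ).symm _)

theorem planeEquiv_add_smul (a b t : ℝ) : planeEquiv (a, b) + t • e₀ = planeEquiv (a + t, b) := by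
  ext i
  fin_cases i <;> simp [planeEquiv, e₀, MeasurableEquiv.finTwoArrow]

theorem continuous_planeEquiv : Continuous planeEquiv := by
  have : (planeEquiv : ℝ × ℝ → Plane) = fun z => WithLp.toLp 2 ![z.1, z.2] := by
    funext z; ext i
    fin_cases i <;> simp [planeEquiv, MeasurableEquiv.finTwoArrow]
  rw [this]
  exact (PiLp.continuous_toLp 2 _).comp (by fun_prop)

theorem norm_e₀ : ‖e₀‖ = 1 := by simp [e₀]

/-- Schwartz functions are integrable along lines. -/
theorem integrable_line (f : 𝓢(Plane, ℂ)) (x : Plane) : Integrable fun t : ℝ => f (x + t • e₀) := by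
  -- The embedding of the line is isometric, hence antilipschitz, so a translate of f pulls back to
  -- a Schwartz function on ℝ.
  let L : ℝ →L[ℝ] Plane := ContinuousLinearMap.toSpanSingleton ℝ e₀
  have hL : AntilipschitzWith 1 L := by
    refine AddMonoidHomClass.antilipschitz_of_bound L fun t => ?_
    simp [L, norm_smul, norm_e₀]
  let g : 𝓢(ℝ, ℂ) := SchwartzMap.compCLMOfAntilipschitz ℂ (L.hasTemperateGrowth) hL
    (f.compSubConstCLM ℂ (-x))
  have := g.integrable (μ := volume)
  refine this.congr (ae_of_all _ fun t => ?_)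
  simp [g, L, add_comm]

theorem integrable_conjKernel_mul_line (f : 𝓢(Plane, ℂ)) {y : ℝ} (hy : 0 < y) (x : Plane) :
    Integrable fun t : ℝ => (conjKernel y t : ℂ) * f (x + t • e₀) :=
  (integrable_line f x).bdd_mul (c := 1 / y)
    (Complex.continuous_ofReal.comp (continuous_conjKernel hy)).aestronglyMeasurable
    (ae_of_all _ fun t => by
      simp only [Complex.norm_real]; exact norm_conjKernel_le hy _)

theorem aestronglyMeasurable_conjConv_plane (f : 𝓢(Plane, ℂ)) {y : ℝ} (hy : 0 < y) :
    AEStronglyMeasurable (fun x : Plane => ∫ t : ℝ, (conjKernel y t : ℂ) * f (x + t • e₀))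
      volume := by
  have hc : Continuous fun z : Plane × ℝ => (conjKernel y z.2 : ℂ) * f (z.1 + z.2 • e₀) := by
    have h1 := continuous_conjKernel hy
    have h2 := f.continuous
    fun_prop
  exact hc.stronglyMeasurable.integral_prod_right'.aestronglyMeasurable

/-- The operator acts on each horizontal line separately, so the one-dimensional bound is integrated
over the lines by Tonelli's theorem. -/
theorem eLpNorm_conjConv_plane_le {p : ℝ≥0∞} (hp : 1 < p) (hp2 : p ≤ 2) :
    ∃ A : ℝ, 0 < A ∧ ∀ (f : 𝓢(Plane, ℂ)) (y : ℝ), 0 < y →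
      eLpNorm (fun x : Plane => ∫ t : ℝ, (conjKernel y t : ℂ) * f (x + t • e₀)) p volume ≤
        ENNReal.ofReal A * eLpNorm f p volume := by
  have hpt : p ≠ ⊤ := (hp2.trans_lt (by simp)).ne
  have hp0 : p ≠ 0 := (zero_lt_one.trans hp).ne'
  have hr1 : 1 < p.toReal := by
    rw [← ENNReal.toReal_one]; exact (ENNReal.toReal_lt_toReal (by simp) hpt).2 hp
  have hr0 : 0 < p.toReal := by linarith
  have hr2 : p.toReal ≤ 2 := by
    have := (ENNReal.toReal_le_toReal hpt (by simp)).2 hp2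
    simpa using this
  obtain ⟨A, hA, h⟩ := eLpNorm_conjConv_le hr1 hr2
  rw [ENNReal.ofReal_toReal hpt] at h
  refine ⟨A, hA, fun f y hy => ?_⟩
  set v : Plane → ℂ := fun x => ∫ t : ℝ, (conjKernel y t : ℂ) * f (x + t • e₀) with hv
  have hvm : AEStronglyMeasurable v volume := aestronglyMeasurable_conjConv_plane f hy
  rw [← eLpNorm_comp_measurePreserving hvm measurePreserving_planeEquiv,
    ← eLpNorm_comp_measurePreserving f.continuous.aestronglyMeasurable measurePreserving_planeEquiv]
  have hslice : ∀ b : ℝ, ∫⁻ a, ‖v (planeEquiv (a, b))‖ₑ ^ p.toReal ≤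
      ENNReal.ofReal A ^ p.toReal * ∫⁻ a, ‖f (planeEquiv (a, b))‖ₑ ^ p.toReal := by
    intro b
    have hcont : Continuous fun a => f (planeEquiv (a, b)) :=
      f.continuous.comp (continuous_planeEquiv.comp (by fun_prop))
    have h_integrable : Integrable fun a => f (planeEquiv (a, b)) := by
      have := integrable_line f (planeEquiv (0, b))
      simpa only [planeEquiv_add_smul, zero_add] using this
    have h1 := h _ hcont.measurable h_integrable y hy
    rw [eLpNorm_eq_lintegral_rpow_enorm_toReal hp0 hpt,
      eLpNorm_eq_lintegral_rpow_enorm_toReal hp0 hpt] at h1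
    have h2 := ENNReal.rpow_le_rpow h1 hr0.le
    rw [ENNReal.mul_rpow_of_nonneg _ _ hr0.le, ← ENNReal.rpow_mul, ← ENNReal.rpow_mul,
      one_div_mul_cancel hr0.ne', ENNReal.rpow_one, ENNReal.rpow_one] at h2
    refine le_trans (le_of_eq ?_) h2
    refine lintegral_congr fun a => ?_
    -- The kernel is odd, so shifting by +t instead of -t only changes the sign.
    have e : v (planeEquiv (a, b)) =
        -∫ t, (conjKernel y (a - t) : ℂ) * f (planeEquiv (t, b)) := by
      rw [hv]
      simp only [planeEquiv_add_smul]
      rw [← integral_add_left_eq_self (fun t => (conjKernel y (a - t) : ℂ) * _) a, ← integral_neg]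
      refine integral_congr_ae (ae_of_all _ fun t => ?_)
      simp [conjKernel, neg_div]
    rw [e, enorm_neg]
  have hm1 : AEMeasurable (fun z : ℝ × ℝ => ‖v (planeEquiv z)‖ₑ ^ p.toReal)
      ((volume : Measure ℝ).prod (volume : Measure ℝ)) :=
    ((hvm.comp_measurePreserving measurePreserving_planeEquiv).enorm).pow_const _
  have hm2 : AEMeasurable (fun z : ℝ × ℝ => ‖f (planeEquiv z)‖ₑ ^ p.toReal)
      ((volume : Measure ℝ).prod (volume : Measure ℝ)) :=
    ((f.continuous.comp continuous_planeEquiv).measurable.enorm.pow_const _).aemeasurable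
  rw [eLpNorm_eq_lintegral_rpow_enorm_toReal hp0 hpt, eLpNorm_eq_lintegral_rpow_enorm_toReal hp0 hpt]
  have e3 : ENNReal.ofReal A = (ENNReal.ofReal A ^ p.toReal) ^ (1 / p.toReal) := by
    rw [← ENNReal.rpow_mul, mul_one_div_cancel hr0.ne', ENNReal.rpow_one]
  rw [e3, ← ENNReal.mul_rpow_of_nonneg _ _ (by positivity)]
  gcongr
  simp only [Function.comp_apply]
  rw [Measure.volume_eq_prod, lintegral_prod_symm _ hm1, lintegral_prod_symm _ hm2,
    ← lintegral_const_mul' _ _ (ENNReal.rpow_ne_top_of_nonneg hr0.le ENNReal.ofReal_ne_top)]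
  exact lintegral_mono hslice

theorem enorm_integral_mul_le {p q : ℝ≥0∞} [p.HolderConjugate q] {u v : Plane → ℂ}
    (hu : AEStronglyMeasurable u volume) (hv : AEStronglyMeasurable v volume) :
    ‖∫ x, u x * v x‖ₑ ≤ eLpNorm u p volume * eLpNorm v q volume := by
  refine (enorm_integral_le_lintegral_enorm _).trans ?_
  rw [← eLpNorm_one_eq_lintegral_enorm]
  have h := eLpNorm_smul_le_mul_eLpNorm (p := p) (q := q) (r := 1) hv hu
  have e : u • v = fun x => u x * v x := rfl
  rwa [e] at h

/-- The kernel whose Fourier transform is `softSign`. -/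
noncomputable def softKernel (y Y t : ℝ) : ℂ :=
  (-(I / Real.pi)) * ((conjKernel y t - conjKernel Y t : ℝ) : ℂ)

theorem integrable_softKernel {y Y : ℝ} (hy : 0 < y) (hY : 0 < Y) : Integrable (softKernel y Y) :=
  (integrable_conjKernel_sub hy hY).ofReal.const_mul _

/-- Fourier inversion writes the symbol as an average of characters, and each character acts as a
translation along `e₀`. -/
theorem multForm_softSign_eq_integral {y Y : ℝ} (hy : 0 < y) (hY : 0 < Y) (f g : 𝓢(Plane, ℂ)) :
    multForm (fun η => (softSign y Y (η 0) : ℂ)) f g =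
      ∫ t, softKernel y Y t * ∫ x, f (x + t • e₀) * g x := by
  rw [multForm_average (B := fun (t : ℝ) (η : Plane) =>
    Complex.exp ((2 * Real.pi * inner ℝ (t • e₀) η : ℝ) * I) * 1) (M := 1)
    (integrable_softKernel hy hY)]
  · refine integral_congr_ae (ae_of_all _ fun t => ?_)
    simp only []
    rw [multForm_exp_mul (fun _ => 1), multForm_one]
    simp
  · refine Continuous.aestronglyMeasurable ?_
    simp only [Function.uncurry_def]
    fun_prop
  · intro t η
    rw [mul_one, Complex.norm_exp_ofReal_mul_I]
  · refine ae_of_all _ fun η => ?_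
    rw [softSign_eq_integral hy hY]
    refine integral_congr_ae (ae_of_all _ fun t => ?_)
    simp [softKernel, e₀, inner_smul_left, EuclideanSpace.inner_single_left]

theorem integrable_softKernel_mul {y Y : ℝ} (hy : 0 < y) (hY : 0 < Y) (f g : 𝓢(Plane, ℂ)) :
    Integrable (Function.uncurry fun (t : ℝ) (x : Plane) =>
      softKernel y Y t * (f (x + t • e₀) * g x)) (volume.prod volume) := by
  have h1 : Integrable (fun z : ℝ × Plane => softKernel y Y z.1 * g z.2) (volume.prod volume) :=
    (integrable_softKernel hy hY).mul_prod (g.integrable (μ := volume))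
  have h2 := h1.mul_bdd (g := fun z => f (z.2 + z.1 • e₀)) (c := SchwartzMap.seminorm ℝ 0 0 f)
    (by
      have := f.continuous
      exact Continuous.aestronglyMeasurable (by fun_prop))
    (ae_of_all _ fun z => f.norm_le_seminorm ℝ _)
  refine h2.congr (ae_of_all _ fun z => ?_)
  simp only [Function.uncurry_def]
  ring

/-- The directional conjugate Poisson integral. -/
noncomputable def lineConj (f : 𝓢(Plane, ℂ)) (y : ℝ) (x : Plane) : ℂ :=
  ∫ t : ℝ, (conjKernel y t : ℂ) * f (x + t • e₀)

theorem multForm_softSign {y Y : ℝ} (hy : 0 < y) (hY : 0 < Y) (f g : 𝓢(Plane, ℂ)) :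
    multForm (fun η => (softSign y Y (η 0) : ℂ)) f g =
      -(I / Real.pi) * ∫ x, (lineConj f y - lineConj f Y) x * g x := by
  rw [multForm_softSign_eq_integral hy hY]
  simp_rw [← integral_const_mul]
  rw [integral_integral_swap (integrable_softKernel_mul hy hY f g)]
  refine integral_congr_ae (ae_of_all _ fun x => ?_)
  simp only [Pi.sub_apply, lineConj]
  rw [← integral_sub (integrable_conjKernel_mul_line f hy x)
    (integrable_conjKernel_mul_line f hY x), ← integral_mul_const, ← integral_const_mul]
  refine integral_congr_ae (ae_of_all _ fun t => ?_)
  simp only [softKernel]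
  push_cast
  ring

theorem IsMult.of_enorm_le {p q : ℝ≥0∞} {C : ℝ} (hC : 0 ≤ C) {b : Plane → ℂ}
    (h : ∀ f g : 𝓢(Plane, ℂ), ‖multForm b f g‖ₑ ≤
      ENNReal.ofReal C * (eLpNorm f p volume * eLpNorm g q volume)) : IsMult p q C b := by
  intro f g
  have hfin : ENNReal.ofReal C * (eLpNorm f p volume * eLpNorm g q volume) ≠ ⊤ :=
    ENNReal.mul_ne_top ENNReal.ofReal_ne_top
      (ENNReal.mul_ne_top (f.memLp p volume).eLpNorm_ne_top (g.memLp q volume).eLpNorm_ne_top)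
  have hb := ENNReal.toReal_mono hfin (h f g)
  rwa [toReal_enorm, ENNReal.toReal_mul, ENNReal.toReal_mul, ENNReal.toReal_ofReal hC,
    ← SchwartzMap.norm_toLp, ← SchwartzMap.norm_toLp] at hb

/-- The two conjugate Poisson integrals are bounded separately and paired with g by Hölder. The
constant depends on neither y nor Y, so the limit to the sign function is available. -/
theorem isMult_softSign {p q : ℝ≥0∞} [p.HolderConjugate q] (hp : 1 < p) (hp2 : p ≤ 2) :
    ∃ C : ℝ, 0 ≤ C ∧ ∀ y Y : ℝ, 0 < y → 0 < Y →
      IsMult p q C fun η => (softSign y Y (η 0) : ℂ) := by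
  obtain ⟨A, hA, h⟩ := eLpNorm_conjConv_plane_le hp hp2
  have hC : 0 ≤ 1 / Real.pi * (A + A) := by positivity
  refine ⟨(1 / Real.pi) * (A + A), hC, fun y Y hy hY => IsMult.of_enorm_le hC ?_⟩
  intro f g
  have hmy : AEStronglyMeasurable (lineConj f y) volume := aestronglyMeasurable_conjConv_plane f hy
  have hmY : AEStronglyMeasurable (lineConj f Y) volume := aestronglyMeasurable_conjConv_plane f hY
  have h1 : eLpNorm (lineConj f y - lineConj f Y) p volume ≤
      ENNReal.ofReal (A + A) * eLpNorm f p volume := by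
    refine (eLpNorm_sub_le hmy hmY hp.le).trans ?_
    rw [ENNReal.ofReal_add hA.le hA.le, add_mul]
    exact add_le_add (h f y hy) (h f Y hY)
  have h2 := enorm_integral_mul_le (p := p) (q := q) (hmy.sub hmY)
      g.continuous.aestronglyMeasurable
  have h3 : ‖-(I / (Real.pi : ℂ))‖ₑ = ENNReal.ofReal (1 / Real.pi) := by
    rw [← ofReal_norm, norm_neg, norm_div, norm_I, Complex.norm_real,
      Real.norm_of_nonneg Real.pi_pos.le]
  rw [multForm_softSign hy hY, enorm_mul, h3, ENNReal.ofReal_mul (by positivity), mul_assoc,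
    ← mul_assoc (ENNReal.ofReal (A + A))]
  exact mul_le_mul_right (h2.trans (mul_le_mul_left h1 _)) _

theorem volume_coord_eq_zero : ∀ᵐ η : Plane, η 0 ≠ 0 := by
  have h : MeasurePreserving planeEquiv volume volume := measurePreserving_planeEquiv
  have hs : MeasurableSet {η : Plane | η 0 ≠ 0} :=
    (measurableSet_eq_fun (f := fun η : Plane => η 0) (by fun_prop) measurable_const).compl
  rw [← h.map_eq, ae_map_iff h.measurable.aemeasurable hs]
  have : ∀ z : ℝ × ℝ, planeEquiv z 0 = z.1 := fun z => by
    simp [planeEquiv, MeasurableEquiv.finTwoArrow]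
  simp only [this]
  have h1 : ∀ᵐ x : ℝ, x ≠ 0 := by simp [ae_iff]
  exact Measure.quasiMeasurePreserving_fst.ae h1

theorem measurable_realSign : Measurable Real.sign := by
  have : Real.sign = fun r : ℝ => if r < 0 then (-1 : ℝ) else if 0 < r then 1 else 0 := rfl
  rw [this]
  exact Measurable.ite measurableSet_Iio measurable_const
    (Measurable.ite measurableSet_Ioi measurable_const measurable_const)

theorem isMult_sign_of_le_two {p q : ℝ≥0∞} [p.HolderConjugate q] (hp : 1 < p) (hp2 : p ≤ 2) :
    ∃ C : ℝ, 0 ≤ C ∧ IsMult p q C fun η => (Real.sign (η 0) : ℂ) := by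
  obtain ⟨C, hC, h⟩ := isMult_softSign (q := q) hp hp2
  refine ⟨C, hC, IsMult.of_tendsto (M := 2)
    (B := fun n η => (softSign (1 / ((n : ℝ) + 1)) ((n : ℝ) + 1) (η 0) : ℂ)) (fun n => ?_)
    (fun n η => ?_) ?_ fun n => h _ _ (by positivity) (by positivity)⟩
  · have := continuous_softSign (1 / ((n : ℝ) + 1)) ((n : ℝ) + 1)
    exact Continuous.aestronglyMeasurable (by fun_prop)
  · rw [Complex.norm_real]
    exact norm_softSign_le (by positivity) (by positivity) _
  · filter_upwards [volume_coord_eq_zero] with η hη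
    exact (Complex.continuous_ofReal.tendsto _).comp (tendsto_softSign hη)

/-- The Hilbert transform in the first variable is bounded on `L^p`, `1 < p < ∞`. -/
theorem isMult_sign {p q : ℝ≥0∞} [hpq : p.HolderConjugate q] (hp : 1 < p) (hpt : p < ⊤) :
    ∃ C : ℝ, 0 ≤ C ∧ IsMult p q C fun η => (Real.sign (η 0) : ℂ) := by
  rcases le_total p 2 with h2 | h2
  · exact isMult_sign_of_le_two hp h2
  · have hqp : q.HolderConjugate p := ENNReal.HolderConjugate.symm
    have hq : 1 < q := (ENNReal.HolderConjugate.lt_top_iff_one_lt p q).1 hpt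
    have hq2 : q ≤ 2 := by
      have h1 := ENNReal.HolderConjugate.one_sub_inv p q
      rw [← ENNReal.inv_le_inv, ← h1, ← ENNReal.one_sub_inv_two]
      exact tsub_le_tsub_left (ENNReal.inv_le_inv.2 h2) 1
    obtain ⟨C, hC, h⟩ := isMult_sign_of_le_two (q := p) hq hq2
    refine ⟨C, hC, ?_⟩
    -- Transposition reflects the symbol, and the sign is odd, so a factor -1 restores it.
    have h3 := h.swap.const_mul (-1)
    simp only [norm_neg, norm_one, one_mul] at h3
    refine h3.congr (ae_of_all _ fun η => ?_)
    simp [Real.sign_neg]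

/-! ### Riesz transforms by the method of rotations. -/

section Riesz

/-- The rotation of the plane by the angle `-θ`. -/
noncomputable def planeRotation (θ : ℝ) : Plane ≃ₗᵢ[ℝ] Plane :=
  (Complex.orthonormalBasisOneI.repr.symm.trans (rotation (Circle.exp (-θ)))).trans
    Complex.orthonormalBasisOneI.repr

theorem planeRotation_apply_zero (θ : ℝ) (η : Plane) :
    planeRotation θ η 0 = Real.cos θ * η 0 + Real.sin θ * η 1 := by
  have h : Complex.orthonormalBasisOneI.repr.symm η = (η 0 : ℂ) + η 1 * I := by
    rw [← Complex.orthonormalBasisOneI.sum_repr_symm]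
    simp [Fin.sum_univ_two]
  have h2 : ((Circle.exp (-θ) : Circle) : ℂ) = Real.cos θ - Real.sin θ * I := by
    rw [Circle.coe_exp]
    push_cast
    rw [Complex.exp_mul_I, Complex.cos_neg, Complex.sin_neg]
    ring
  simp only [planeRotation, LinearIsometryEquiv.trans_apply, rotation_apply, h, h2,
    Complex.orthonormalBasisOneI_repr_apply]
  simp [Complex.cos_ofReal_re, Complex.sin_ofReal_re]

/-- After the shift θ ↦ θ + φ the part with cos θ yields |cos θ| and the part with sin θ is odd.
Thus a linear function of the direction φ is an average of signs of rotated first coordinates. -/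
theorem integral_mul_sign_cos (a b φ : ℝ) :
    ∫ θ in (-Real.pi)..Real.pi, (a * Real.cos θ + b * Real.sin θ) *
      Real.sign (Real.cos (θ - φ)) =
    (∫ θ in (-Real.pi)..Real.pi, |Real.cos θ|) * (a * Real.cos φ + b * Real.sin φ) := by
  have hm : Measurable fun θ => Real.sign (Real.cos θ) :=
    measurable_realSign.comp Real.continuous_cos.measurable
  have hb : ∀ θ, ‖Real.sign (Real.cos θ)‖ ≤ 1 := fun θ => by
    rcases Real.sign_apply_eq (Real.cos θ) with h | h | h <;> simp [h]
  have h_integrable : ∀ g : ℝ → ℝ, Continuous g → ∀ u v : ℝ,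
      IntervalIntegrable (fun θ => g θ * Real.sign (Real.cos θ)) volume u v := by
    intro g hg u v
    rw [intervalIntegrable_iff]
    have := hg.intervalIntegrable (μ := volume) u v
    rw [intervalIntegrable_iff] at this
    exact this.mul_bdd (c := 1) hm.aestronglyMeasurable (ae_of_all _ hb)
  have hper : Function.Periodic (fun θ => (a * Real.cos (θ + φ) + b * Real.sin (θ + φ)) *
      Real.sign (Real.cos θ)) (2 * Real.pi) := by
    intro θ
    simp only []
    rw [show θ + 2 * Real.pi + φ = θ + φ + 2 * Real.pi by ring, Real.cos_add_two_pi,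
      Real.sin_add_two_pi, Real.cos_add_two_pi]
  have h1 : ∫ θ in (-Real.pi)..Real.pi, (a * Real.cos θ + b * Real.sin θ) *
      Real.sign (Real.cos (θ - φ)) = ∫ θ in (-Real.pi)..Real.pi,
      (a * Real.cos (θ + φ) + b * Real.sin (θ + φ)) * Real.sign (Real.cos θ) := by
    have e := intervalIntegral.integral_comp_sub_right (a := -Real.pi) (b := Real.pi)
      (fun θ => (a * Real.cos (θ + φ) + b * Real.sin (θ + φ)) * Real.sign (Real.cos θ)) φ
    simp only [sub_add_cancel] at e
    rw [e]
    -- Periodicity moves the shifted interval back to [-π, π].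
    have e2 := hper.intervalIntegral_add_eq (-Real.pi - φ) (-Real.pi)
    convert e2 using 2 <;> ring
  have hodd : ∫ θ in (-Real.pi)..Real.pi, Real.sin θ * Real.sign (Real.cos θ) = 0 := by
    have e := intervalIntegral.integral_comp_neg (a := -Real.pi) (b := Real.pi)
      (fun θ => Real.sin θ * Real.sign (Real.cos θ))
    simp only [Real.sin_neg, Real.cos_neg, neg_neg, neg_mul, intervalIntegral.integral_neg] at e
    linarith
  have habs : ∀ θ, Real.cos θ * Real.sign (Real.cos θ) = |Real.cos θ| := fun θ => by
    rcases lt_trichotomy (Real.cos θ) 0 with h | h | h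
    · rw [Real.sign_of_neg h, abs_of_neg h]; ring
    · simp [h]
    · rw [Real.sign_of_pos h, abs_of_pos h]; ring
  rw [h1]
  have e3 : ∀ θ, (a * Real.cos (θ + φ) + b * Real.sin (θ + φ)) * Real.sign (Real.cos θ) =
      (a * Real.cos φ + b * Real.sin φ) * (Real.cos θ * Real.sign (Real.cos θ)) +
      (b * Real.cos φ - a * Real.sin φ) * (Real.sin θ * Real.sign (Real.cos θ)) := by
    intro θ
    rw [Real.cos_add, Real.sin_add]; ring
  simp_rw [e3]
  rw [intervalIntegral.integral_add ((h_integrable _ Real.continuous_cos _ _).const_mul _)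
    ((h_integrable _ Real.continuous_sin _ _).const_mul _), intervalIntegral.integral_const_mul,
    intervalIntegral.integral_const_mul, hodd]
  simp_rw [habs]
  ring

theorem integral_abs_cos_pos : 0 < ∫ θ in (-Real.pi)..Real.pi, |Real.cos θ| := by
  have hpi := Real.pi_pos
  have h1 : ∫ θ in (-Real.pi)..Real.pi, Real.cos θ ^ 2 = Real.pi := by
    rw [integral_cos_sq]; simp
  have h2 : ∫ θ in (-Real.pi)..Real.pi, Real.cos θ ^ 2 ≤
      ∫ θ in (-Real.pi)..Real.pi, |Real.cos θ| := by
    refine intervalIntegral.integral_mono_on (by linarith)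
      ((by fun_prop : Continuous fun θ => Real.cos θ ^ 2).intervalIntegrable _ _)
      ((by fun_prop : Continuous fun θ => |Real.cos θ|).intervalIntegrable _ _) fun θ _ => ?_
    have := Real.abs_cos_le_one θ
    rw [← sq_abs]
    nlinarith [abs_nonneg (Real.cos θ)]
  linarith

theorem exists_polar (η : Plane) :
    ∃ φ : ℝ, η 0 = ‖η‖ * Real.cos φ ∧ η 1 = ‖η‖ * Real.sin φ := by
  have h : ‖(⟨η 0, η 1⟩ : ℂ)‖ = ‖η‖ := by
    rw [EuclideanSpace.norm_eq, Fin.sum_univ_two, Complex.norm_def, Complex.normSq_mk]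
    simp [pow_two]
  refine ⟨(⟨η 0, η 1⟩ : ℂ).arg, ?_, ?_⟩
  · rw [← h, Complex.norm_mul_cos_arg]
  · rw [← h, Complex.norm_mul_sin_arg]

/-- The Riesz transforms are bounded on `L^p`, `1 < p < ∞`. -/
theorem isMult_riesz {p q : ℝ≥0∞} [p.HolderConjugate q] (hp : 1 < p) (hpt : p < ⊤) (a b : ℝ) :
    ∃ C : ℝ, 0 ≤ C ∧ IsMult p q C fun η => (((a * η 0 + b * η 1) / ‖η‖ : ℝ) : ℂ) := by
  obtain ⟨C, hC, h⟩ := isMult_sign (q := q) hp hpt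
  set K := ∫ θ in (-Real.pi)..Real.pi, |Real.cos θ| with hK
  have hK0 : 0 < K := integral_abs_cos_pos
  have hpi := Real.pi_pos
  let ν : Measure ℝ := volume.restrict (Set.Ioc (-Real.pi) Real.pi)
  let w : ℝ → ℂ := fun θ => (((a * Real.cos θ + b * Real.sin θ) / K : ℝ) : ℂ)
  have hw : Integrable w ν := by
    have hc : Continuous w := by fun_prop
    exact (hc.intervalIntegrable (μ := volume) (-Real.pi) Real.pi).1
  refine ⟨_, mul_nonneg (integral_nonneg fun _ => norm_nonneg _) hC, IsMult.average (ν := ν) (w := w)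
    (B := fun θ η => (Real.sign (planeRotation θ η 0) : ℂ)) (M := 1) hw ?_ ?_ ?_ ?_⟩
  · refine Measurable.aestronglyMeasurable ?_
    simp only [planeRotation_apply_zero, Function.uncurry_def]
    refine Complex.measurable_ofReal.comp (measurable_realSign.comp ?_)
    exact Continuous.measurable (by fun_prop)
  · intro θ η
    rw [Complex.norm_real]
    rcases Real.sign_apply_eq (planeRotation θ η 0) with h | h | h <;> simp [h]
  · filter_upwards [volume_coord_eq_zero] with η hη
    obtain ⟨φ, h0, h1⟩ := exists_polar η
    have hr : 0 < ‖η‖ := norm_pos_iff.2 (by rintro rfl; simp at hη)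
    have hs : ∀ θ, Real.sign (planeRotation θ η 0) = Real.sign (Real.cos (θ - φ)) := by
      intro θ
      rw [planeRotation_apply_zero, h0, h1, Real.cos_sub,
        show Real.cos θ * (‖η‖ * Real.cos φ) + Real.sin θ * (‖η‖ * Real.sin φ) =
          ‖η‖ * (Real.cos θ * Real.cos φ + Real.sin θ * Real.sin φ) by ring]
      -- The sign ignores the positive factor ‖η‖; this makes the average homogeneous of degree
      -- zero.
      simp only [Real.sign, mul_pos_iff_of_pos_left hr, ← not_le, mul_nonneg_iff_of_pos_left hr]
    have e := integral_mul_sign_cos a b φ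
    rw [intervalIntegral.integral_of_le (by linarith), ← hK] at e
    have e2 : ∫ θ, w θ * (Real.sign (planeRotation θ η 0) : ℂ) ∂ν =
        ((K⁻¹ * ∫ θ in Set.Ioc (-Real.pi) Real.pi, (a * Real.cos θ + b * Real.sin θ) *
          Real.sign (Real.cos (θ - φ)) : ℝ) : ℂ) := by
      rw [← integral_const_mul, ← integral_complex_ofReal]
      refine integral_congr_ae (ae_of_all _ fun θ => ?_)
      simp only [w, hs]
      push_cast
      ring
    rw [e2, e]
    congr 1
    rw [h0, h1]
    field_simp
  · exact ae_of_all _ fun θ => h.comp_isometry (planeRotation θ)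

end Riesz

/-! ### Averages: Gaussians, Bessel potentials and power series in them. -/

theorem exp_neg_mul_sq_eq_integral {c : ℝ} (hc : 0 < c) (η : Plane) :
    (Real.exp (-c * ‖η‖ ^ 2) : ℂ) = ∫ y : Plane,
      ((Real.pi / c * Real.exp (-(Real.pi ^ 2 / c) * ‖y‖ ^ 2) : ℝ) : ℂ) *
        Complex.exp ((2 * Real.pi * inner ℝ (-y) η : ℝ) * I) := by
  have hpi := Real.pi_pos
  have hpc : (Real.pi : ℂ) ≠ 0 := by exact_mod_cast hpi.ne'
  have hcc : (c : ℂ) ≠ 0 := by exact_mod_cast hc.ne'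
  have h := fourier_gaussian_innerProductSpace (b := ((Real.pi ^ 2 / c : ℝ) : ℂ)) (V := Plane)
    (by rw [Complex.ofReal_re]; positivity) η
  rw [Real.fourier_eq'] at h
  have hfin : ((Module.finrank ℝ Plane : ℂ) / 2) = 1 := by simp
  rw [hfin, Complex.cpow_one] at h
  have e : ∀ y : Plane, ((Real.pi / c * Real.exp (-(Real.pi ^ 2 / c) * ‖y‖ ^ 2) : ℝ) : ℂ) *
      Complex.exp ((2 * Real.pi * inner ℝ (-y) η : ℝ) * I) =
      (Real.pi / c) * (Complex.exp ((-2 * Real.pi * inner ℝ y η : ℝ) * I) •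
        Complex.exp (-((Real.pi ^ 2 / c : ℝ) : ℂ) * (‖y‖ : ℂ) ^ 2)) := by
    intro y
    rw [inner_neg_left, show (2 * Real.pi * -inner ℝ y η : ℝ) = -2 * Real.pi * inner ℝ y η by ring]
    push_cast
    rw [smul_eq_mul]
    ring
  simp_rw [e]
  rw [integral_const_mul, h]
  push_cast
  rw [← mul_assoc]
  have e1 : (Real.pi : ℂ) / c * (Real.pi / (Real.pi ^ 2 / c)) = 1 := by field_simp
  have e2 : -(Real.pi : ℂ) ^ 2 * (‖η‖ : ℂ) ^ 2 / (Real.pi ^ 2 / c) = -c * (‖η‖ : ℂ) ^ 2 := by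
    field_simp
  rw [e1, e2, one_mul]

/-- The weight is a probability density in dimension two, so the average over translations costs no
constant. -/
theorem integral_gaussianWeight {c : ℝ} (hc : 0 < c) :
    ∫ y : Plane, ‖((Real.pi / c * Real.exp (-(Real.pi ^ 2 / c) * ‖y‖ ^ 2) : ℝ) : ℂ)‖ = 1 := by
  have hpi := Real.pi_pos
  have e : ∀ y : Plane, ‖((Real.pi / c * Real.exp (-(Real.pi ^ 2 / c) * ‖y‖ ^ 2) : ℝ) : ℂ)‖ =
      Real.pi / c * Real.exp (-(Real.pi ^ 2 / c) * ‖y‖ ^ 2) := fun y => by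
    rw [Complex.norm_real, Real.norm_of_nonneg (by positivity)]
  simp_rw [e]
  rw [integral_const_mul, GaussianFourier.integral_rexp_neg_mul_sq_norm (by positivity)]
  have hfin : ((Module.finrank ℝ Plane : ℝ) / 2) = 1 := by simp
  rw [hfin, Real.rpow_one]
  field_simp

/-- Multiplying the symbol by a Gaussian does not increase the norm. -/
theorem IsMult.gaussian_mul {p q : ℝ≥0∞} {C : ℝ} {b : Plane → ℂ} {M : ℝ} (h : IsMult p q C b)
    (hb : Measurable b) (hM : ∀ η, ‖b η‖ ≤ M) {c : ℝ} (hc : 0 < c) :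
    IsMult p q C fun η => (Real.exp (-c * ‖η‖ ^ 2) : ℂ) * b η := by
  have hpi := Real.pi_pos
  have := IsMult.average (p := p) (q := q) (C := C) (ν := (volume : Measure Plane))
    (b := fun η => (Real.exp (-c * ‖η‖ ^ 2) : ℂ) * b η) (M := M)
    (w := fun y : Plane => ((Real.pi / c * Real.exp (-(Real.pi ^ 2 / c) * ‖y‖ ^ 2) : ℝ) : ℂ))
    (B := fun y η => Complex.exp ((2 * Real.pi * inner ℝ (-y) η : ℝ) * I) * b η) ?_ ?_ ?_ ?_ ?_
  · rwa [integral_gaussianWeight hc, one_mul] at this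
  -- The Bochner integral of a non-integrable function is 0 by convention, so the value 1 already
  -- forces integrability.
  · by_contra hn
    have h1 := integral_gaussianWeight hc
    rw [integral_undef (fun h => hn ((integrable_norm_iff ?_).1 h))] at h1
    · exact zero_ne_one h1
    · exact Continuous.aestronglyMeasurable (by fun_prop)
  · refine Measurable.aestronglyMeasurable ?_
    simp only [Function.uncurry_def]
    refine Measurable.mul (Continuous.measurable (by fun_prop)) (hb.comp measurable_snd)
  · intro y η
    rw [norm_mul, Complex.norm_exp_ofReal_mul_I, one_mul]
    exact hM η
  · refine ae_of_all _ fun η => ?_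
    rw [exp_neg_mul_sq_eq_integral hc, ← integral_mul_const]
    simp_rw [mul_assoc]
  · exact ae_of_all _ fun y => h.exp_mul (-y)

/-- The symbol `(1 + |ξ|²)⁻¹` at `ξ = 2πη`. -/
noncomputable def besselSymbol (η : Plane) : ℝ := (1 + ‖(2 * Real.pi) • η‖ ^ 2)⁻¹

theorem besselSymbol_pos (η : Plane) : 0 < besselSymbol η := by
  unfold besselSymbol; positivity

theorem besselSymbol_le_one (η : Plane) : besselSymbol η ≤ 1 := by
  unfold besselSymbol
  exact inv_le_one_of_one_le₀ (by linarith [sq_nonneg ‖(2 * Real.pi) • η‖])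

theorem besselSymbol_lt_one {η : Plane} (hη : η ≠ 0) : besselSymbol η < 1 := by
  unfold besselSymbol
  refine inv_lt_one_of_one_lt₀ ?_
  have : 0 < ‖(2 * Real.pi) • η‖ := norm_pos_iff.2 (smul_ne_zero (by positivity) hη)
  have := pow_pos this 2
  linarith

theorem measurable_besselSymbol : Measurable besselSymbol := by
  unfold besselSymbol; fun_prop

/-- The Bessel potentials are contractions. -/
theorem IsMult.bessel_mul {p q : ℝ≥0∞} {C : ℝ} {b : Plane → ℂ} {M : ℝ} (h : IsMult p q C b)
    (hb : Measurable b) (hM : ∀ η, ‖b η‖ ≤ M) {s : ℝ} (hs : 0 < s) :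
    IsMult p q C fun η => ((besselSymbol η ^ s : ℝ) : ℂ) * b η := by
  have hpi := Real.pi_pos
  have hΓ := Real.Gamma_pos_of_pos hs
  let ν : Measure ℝ := volume.restrict (Set.Ioi 0)
  let w : ℝ → ℂ := fun u => ((Real.exp (-u) * u ^ (s - 1) / Real.Gamma s : ℝ) : ℂ)
  have hwR : Integrable (fun u : ℝ => Real.exp (-u) * u ^ (s - 1) / Real.Gamma s) ν :=
    (Real.GammaIntegral_convergent hs).div_const _
  have hw1 : ∫ u, ‖w u‖ ∂ν = 1 := by
    have : ∫ u, ‖w u‖ ∂ν = ∫ u, Real.exp (-u) * u ^ (s - 1) / Real.Gamma s ∂ν := by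
      refine setIntegral_congr_fun measurableSet_Ioi fun u hu => ?_
      have : 0 < u := hu
      simp only [w]
      rw [Complex.norm_real, Real.norm_of_nonneg (by positivity)]
    rw [this, integral_div]
    change (∫ u in Set.Ioi (0 : ℝ), Real.exp (-u) * u ^ (s - 1)) / Real.Gamma s = 1
    rw [← Real.Gamma_eq_integral hs, div_self hΓ.ne']
  have := IsMult.average (p := p) (q := q) (C := C) (ν := ν) (w := w) (M := M)
    (b := fun η => ((besselSymbol η ^ s : ℝ) : ℂ) * b η)
    -- The subordination formula t^s = Γ(s)⁻¹ ∫₀^∞ e^{-u} u^{s-1} e^{-u|ξ|²} du. Averaging asks for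
    -- a bound at every real u, hence |u|, although the measure lives on u > 0.
    (B := fun u η => (Real.exp (-((2 * Real.pi) ^ 2 * |u|) * ‖η‖ ^ 2) : ℂ) * b η)
    hwR.ofReal ?_ ?_ ?_ ?_
  · rwa [hw1, one_mul] at this
  · refine Measurable.aestronglyMeasurable ?_
    simp only [Function.uncurry_def]
    refine Measurable.mul (Continuous.measurable (by fun_prop)) (hb.comp measurable_snd)
  · intro u η
    rw [norm_mul, Complex.norm_real, Real.norm_of_nonneg (Real.exp_pos _).le]
    refine (mul_le_of_le_one_left (norm_nonneg _) (Real.exp_le_one_iff.2 ?_)).trans (hM η)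
    have : 0 ≤ (2 * Real.pi) ^ 2 * |u| * ‖η‖ ^ 2 := by positivity
    linarith
  · refine ae_of_all _ fun η => ?_
    have e := Real.integral_rpow_mul_exp_neg_mul_Ioi hs
      (r := 1 + ‖(2 * Real.pi) • η‖ ^ 2) (by positivity)
    have e2 : besselSymbol η ^ s = ∫ u in Set.Ioi (0 : ℝ),
        (Real.exp (-u) * u ^ (s - 1) / Real.Gamma s) *
          Real.exp (-((2 * Real.pi) ^ 2 * |u|) * ‖η‖ ^ 2) := by
      rw [besselSymbol, ← one_div, eq_comm, ← mul_right_cancel_iff_of_pos hΓ, ← e,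
        ← integral_mul_const]
      refine setIntegral_congr_fun measurableSet_Ioi fun u hu => ?_
      have hu0 : 0 < u := hu
      rw [abs_of_pos hu0, norm_smul, Real.norm_of_nonneg (by positivity : 0 ≤ 2 * Real.pi)]
      have e3 : Real.exp (-((1 + (2 * Real.pi * ‖η‖) ^ 2) * u)) =
          Real.exp (-u) * Real.exp (-((2 * Real.pi) ^ 2 * u) * ‖η‖ ^ 2) := by
        rw [← Real.exp_add]; congr 1; ring
      rw [e3]
      field_simp
    rw [e2, ← integral_complex_ofReal, ← integral_mul_const]
    refine integral_congr_ae (ae_of_all _ fun u => ?_)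
    simp only [w]
    push_cast
    ring
  · filter_upwards [ae_restrict_mem measurableSet_Ioi] with u hu
    have hu0 : 0 < u := hu
    rw [abs_of_pos hu0]
    exact h.gaussian_mul hb hM (by positivity)

/-- Absolutely convergent power series in `(1 - Δ)⁻¹`. -/
theorem IsMult.series_mul {p q : ℝ≥0∞} {C : ℝ} {b b' : Plane → ℂ} {M : ℝ} (h : IsMult p q C b)
    (hb : Measurable b) (hM : ∀ η, ‖b η‖ ≤ M) {d : ℕ → ℝ} (hd : Summable fun k => |d k|)
    (hb' : ∀ᵐ η, ∃ r : ℝ, HasSum (fun k => d k * besselSymbol η ^ k) r ∧ b' η = r * b η) :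
    IsMult p q ((∑' k, |d k|) * C) b' := by
  have hM0 : 0 ≤ M := (norm_nonneg _).trans (hM 0)
  have hdi : Integrable (fun k => (d k : ℂ)) Measure.count := by
    rw [integrable_count_iff]
    simpa using hd
  have hn : ∫ k, ‖(d k : ℂ)‖ ∂Measure.count = ∑' k, |d k| := by
    rw [integral_countable hdi.norm]
    simp
  have := IsMult.average (p := p) (q := q) (C := C) (ν := Measure.count)
    (w := fun k : ℕ => (d k : ℂ)) (M := M) (b := b')
    (B := fun k η => ((besselSymbol η ^ k : ℝ) : ℂ) * b η) hdi ?_ ?_ ?_ ?_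
  · rwa [hn] at this
  · refine Measurable.aestronglyMeasurable (measurable_from_prod_countable_right fun k => ?_)
    simp only [Function.uncurry_apply_pair]
    have := measurable_besselSymbol
    fun_prop
  · intro k η
    rw [norm_mul, Complex.norm_real, Real.norm_of_nonneg (pow_nonneg (besselSymbol_pos η).le k)]
    exact (mul_le_of_le_one_left (norm_nonneg _)
      (pow_le_one₀ (besselSymbol_pos η).le (besselSymbol_le_one η))).trans (hM η)
  · filter_upwards [hb'] with η hη
    obtain ⟨r, hr, e⟩ := hη
    have hi : Integrable (fun k => (d k : ℂ) * (((besselSymbol η ^ k : ℝ) : ℂ) * b η))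
        Measure.count := by
      refine hdi.mul_bdd (c := M) (Measurable.aestronglyMeasurable (by fun_prop))
        (ae_of_all _ fun k => ?_)
      rw [norm_mul, Complex.norm_real, Real.norm_of_nonneg (pow_nonneg (besselSymbol_pos η).le k)]
      exact (mul_le_of_le_one_left (norm_nonneg _)
        (pow_le_one₀ (besselSymbol_pos η).le (besselSymbol_le_one η))).trans (hM η)
    rw [integral_countable hi, e]
    have h2 := (Complex.hasSum_ofReal.2 hr).mul_right (b η)
    rw [← h2.tsum_eq]
    refine tsum_congr fun k => ?_
    simp [mul_assoc]
  · refine ae_of_all _ fun k => ?_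
    -- The power 0 is the identity and lies outside the Gamma integral formula, which needs a
    -- positive exponent.
    rcases Nat.eq_zero_or_pos k with rfl | hk
    · simpa using h
    · simpa only [Real.rpow_natCast] using
        h.bessel_mul hb hM (s := (k : ℝ)) (by exact_mod_cast hk)

/-! ### The binomial series and the multipliers ψ and ρ_j. -/

/-- The coefficients of the binomial series of `(1 - t) ^ s`. -/
noncomputable def binomCoeff (s : ℝ) (k : ℕ) : ℝ := (-1) ^ k * Ring.choose s k

theorem binomCoeff_zero (s : ℝ) : binomCoeff s 0 = 1 := by simp [binomCoeff]

theorem hasSum_binomCoeff (s : ℝ) {t : ℝ} (h0 : 0 ≤ t) (h1 : t < 1) :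
    HasSum (fun k => binomCoeff s k * t ^ k) ((1 - t) ^ s) := by
  have h := (Real.one_add_rpow_hasFPowerSeriesOnBall_zero (a := s)).hasSum (y := -t) (by
    rw [Metric.mem_eball, edist_zero_right]
    rw [← ofReal_norm, norm_neg, Real.norm_of_nonneg h0]
    simpa using h1)
  simp only [zero_add] at h
  rw [← sub_eq_add_neg] at h
  refine h.congr_fun fun k => ?_
  rw [binomialSeries_apply]
  simp [binomCoeff, neg_pow t]
  ring

/-- In (-1)^{k+1} s(s-1)⋯(s-k) the first factor s is positive, and each later factor s-j ≤ 0 is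
compensated by one -1, which leaves one minus sign. -/
theorem binomCoeff_succ_nonpos {s : ℝ} (h0 : 0 < s) (h1 : s ≤ 1) (k : ℕ) :
    binomCoeff s (k + 1) ≤ 0 := by
  have hX : ∀ n : ℕ, (Polynomial.X - (n : Polynomial ℤ)).smeval s = s - n := fun n => by
    rw [Polynomial.smeval_sub, Polynomial.smeval_X, pow_one, Polynomial.smeval_natCast]
    simp
  have key : ∀ k : ℕ, (-1 : ℝ) ^ (k + 1) * (descPochhammer ℤ (k + 1)).smeval s ≤ 0 := by
    intro k
    induction k with
    | zero =>
      rw [zero_add, descPochhammer_one, Polynomial.smeval_X]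
      simpa using h0.le
    | succ k ih =>
      rw [descPochhammer_succ_right, Polynomial.smeval_mul, hX, pow_succ]
      have : 0 ≤ ((k + 1 : ℕ) : ℝ) - s := by push_cast; linarith [(Nat.cast_nonneg k : (0:ℝ) ≤ k)]
      nlinarith
  rw [binomCoeff, Ring.choose_eq_smul, smul_eq_mul, mul_left_comm]
  exact mul_nonpos_of_nonneg_of_nonpos (by positivity) (key k)

/-- The terms after the first have constant sign, so their partial sums at t < 1 are at most 1 -
(1-t)^s ≤ 1 in absolute value. Letting t → 1 in the finite sums gives the bound at the end point. -/
theorem summable_abs_binomCoeff {s : ℝ} (h0 : 0 < s) (h1 : s ≤ 1) :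
    Summable fun k => |binomCoeff s k| := by
  rw [← summable_nat_add_iff 1]
  have e : ∀ k, |binomCoeff s (k + 1)| = -binomCoeff s (k + 1) := fun k =>
    abs_of_nonpos (binomCoeff_succ_nonpos h0 h1 k)
  simp_rw [e]
  refine summable_of_sum_range_le (c := 1)
    (fun k => neg_nonneg.2 (binomCoeff_succ_nonpos h0 h1 k)) fun n => ?_
  have hlim : Tendsto (fun t : ℝ => ∑ k ∈ Finset.range n, -binomCoeff s (k + 1) * t ^ (k + 1))
      (𝓝[<] 1) (𝓝 (∑ k ∈ Finset.range n, -binomCoeff s (k + 1) * (1 : ℝ) ^ (k + 1))) :=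
    ((by fun_prop : Continuous fun t : ℝ => ∑ k ∈ Finset.range n,
      -binomCoeff s (k + 1) * t ^ (k + 1)).tendsto 1).mono_left nhdsWithin_le_nhds
  simp only [one_pow, mul_one] at hlim
  refine le_of_tendsto hlim ?_
  filter_upwards [Ioo_mem_nhdsLT (zero_lt_one (α := ℝ))] with t ht
  have hs := hasSum_binomCoeff s ht.1.le ht.2
  rw [← hasSum_nat_add_iff' 1] at hs
  simp only [Finset.range_one, Finset.sum_singleton, pow_zero, mul_one, binomCoeff_zero] at hs
  have h2 := sum_le_hasSum (Finset.range n) (fun k _ => by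
    have := mul_nonneg (neg_nonneg.2 (binomCoeff_succ_nonpos h0 h1 k)) (pow_nonneg ht.1.le (k + 1))
    linarith) hs.neg
  have h3 : 0 ≤ (1 - t) ^ s := Real.rpow_nonneg (by linarith [ht.2]) _
  calc _ = ∑ k ∈ Finset.range n, -(binomCoeff s (k + 1) * t ^ (k + 1)) := by simp
    _ ≤ _ := h2
    _ ≤ 1 := by linarith

theorem hasSum_binomCoeff_succ (s : ℝ) {t : ℝ} (h0 : 0 < t) (h1 : t < 1) :
    HasSum (fun k => binomCoeff s (k + 1) * t ^ k) (((1 - t) ^ s - 1) / t) := by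
  have hs := hasSum_binomCoeff s h0.le h1
  rw [← hasSum_nat_add_iff' 1] at hs
  simp only [Finset.range_one, Finset.sum_singleton, pow_zero, mul_one, binomCoeff_zero] at hs
  refine (hs.div_const t).congr_fun fun k => ?_
  rw [pow_succ]
  field_simp

/-- The bounded factor `((1 - t)^s - 1) / t` of the symbols. -/
noncomputable def psiSymbol (s : ℝ) (η : Plane) : ℝ :=
  ((1 - besselSymbol η) ^ s - 1) / besselSymbol η

theorem ae_ne_zero_plane : ∀ᵐ η : Plane, η ≠ 0 := by
  filter_upwards [volume_coord_eq_zero] with η hη h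
  simp [h] at hη

theorem IsMult.psi_mul {p q : ℝ≥0∞} {C : ℝ} {b : Plane → ℂ} {M : ℝ} (h : IsMult p q C b)
    (hb : Measurable b) (hM : ∀ η, ‖b η‖ ≤ M) {s : ℝ} (h0 : 0 < s) (h1 : s ≤ 1) :
    IsMult p q ((∑' k, |binomCoeff s (k + 1)|) * C) fun η => (psiSymbol s η : ℂ) * b η := by
  refine h.series_mul (d := fun k => binomCoeff s (k + 1)) hb hM
    ((summable_nat_add_iff 1).2 (summable_abs_binomCoeff h0 h1)) ?_
  filter_upwards [ae_ne_zero_plane] with η hη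
  exact ⟨_, hasSum_binomCoeff_succ s (besselSymbol_pos η) (besselSymbol_lt_one hη), rfl⟩

/-- The symbols `ξ_j (1 + |ξ|²)^{-1/2}` at `ξ = 2πη`. -/
noncomputable def rhoSymbol (j : Fin 2) (η : Plane) : ℝ :=
  (2 * Real.pi) * η j * (1 + ‖(2 * Real.pi) • η‖ ^ 2) ^ (-(1 / 2) : ℝ)

/-- ξ_j(1+|ξ|²)^{-1/2} is the Riesz symbol ξ_j/|ξ| times (1-t)^{1/2}, an absolutely convergent
series in the Bessel symbol t. -/
theorem isMult_rho {p q : ℝ≥0∞} [p.HolderConjugate q] (hp : 1 < p) (hpt : p < ⊤) (j : Fin 2) :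
    ∃ C : ℝ, 0 ≤ C ∧ IsMult p q C fun η => (rhoSymbol j η : ℂ) := by
  obtain ⟨C, hC, h⟩ := isMult_riesz (q := q) hp hpt (if j = 0 then 1 else 0) (if j = 0 then 0 else 1)
  have e : ∀ η : Plane, ((if j = 0 then 1 else 0) * η 0 + (if j = 0 then 0 else 1) * η 1 : ℝ) =
      η j := by
    intro η; fin_cases j <;> simp
  simp_rw [e] at h
  refine ⟨_, mul_nonneg (tsum_nonneg fun _ => abs_nonneg _) hC, h.series_mul (M := 1)
    (d := binomCoeff (1 / 2)) (Measurable.complex_ofReal (by fun_prop)) (fun η => ?_)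
    (summable_abs_binomCoeff (by norm_num) (by norm_num)) ?_⟩
  · rw [Complex.norm_real, norm_div, norm_norm]
    exact div_le_one_of_le₀ (PiLp.norm_apply_le η j) (norm_nonneg _)
  · filter_upwards [ae_ne_zero_plane] with η hη
    refine ⟨_, hasSum_binomCoeff (1 / 2) (besselSymbol_pos η).le (besselSymbol_lt_one hη), ?_⟩
    rw [← Complex.ofReal_mul]
    congr 1
    have hr : 0 < ‖η‖ := norm_pos_iff.2 hη
    have hpi := Real.pi_pos
    set A := 1 + ‖(2 * Real.pi) • η‖ ^ 2 with hA
    have hA0 : 0 < A := by positivity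
    have hn : ‖(2 * Real.pi) • η‖ = 2 * Real.pi * ‖η‖ := by
      rw [norm_smul, Real.norm_of_nonneg (by positivity)]
    have e1 : 1 - besselSymbol η = (2 * Real.pi * ‖η‖) ^ 2 * A⁻¹ := by
      rw [besselSymbol, ← hA]
      field_simp
      rw [hA, hn]; ring
    rw [e1, Real.mul_rpow (by positivity) (by positivity), ← Real.sqrt_eq_rpow,
      Real.sqrt_sq (by positivity), rhoSymbol, ← hA, Real.rpow_neg hA0.le, Real.inv_rpow hA0.le]
    field_simp

/-! ### From bounded forms to operators on L^p and their derivatives. -/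

/-- The converse of Hölder's inequality. -/
theorem norm_le_of_forall_integral_mul_le {p q : ℝ≥0∞} [Fact (1 ≤ p)] [Fact (1 ≤ q)]
    [p.HolderConjugate q] (hp : 1 < p) (hpt : p < ⊤) (K : Lp ℂ p (volume : Measure Plane)) {M : ℝ}
    (hM : 0 ≤ M) (h : ∀ G : Lp ℂ q (volume : Measure Plane), ‖∫ x, K x * G x‖ ≤ M * ‖G‖) : ‖K‖ ≤ M := by
  have hr1 : 1 < p.toReal := by
    rw [← ENNReal.toReal_one]; exact (ENNReal.toReal_lt_toReal (by simp) hpt.ne).2 hp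
  have hpq : p.toReal.HolderConjugate q.toReal := ENNReal.HolderConjugate.toReal hr1
  have hq1 : 1 < q := (ENNReal.HolderConjugate.lt_top_iff_one_lt p q).1 hpt
  have hqt : q ≠ ⊤ := by
    have : q.HolderConjugate p := ENNReal.HolderConjugate.symm
    exact ((ENNReal.HolderConjugate.lt_top_iff_one_lt q p).2 hp).ne
  set r := p.toReal with hr
  set r' := q.toReal with hr'
  have hp0 : p ≠ 0 := (zero_lt_one.trans hp).ne'
  have hq0 : q ≠ 0 := (zero_lt_one.trans hq1).ne'
  -- The extremal function: K g = |K|^r = |g|^{r'}. Where K = 0 the conjugate factor makes g zero,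
  -- whatever the value of the power.
  set g : Plane → ℂ := fun x => (starRingEnd ℂ) (K x) * ((‖K x‖ ^ (r - 2) : ℝ) : ℂ) with hg
  have hKm : AEStronglyMeasurable (K : Plane → ℂ) volume := Lp.aestronglyMeasurable K
  have hgm : AEStronglyMeasurable g volume :=
    (Complex.continuous_conj.comp_aestronglyMeasurable hKm).mul
      (Complex.continuous_ofReal.comp_aestronglyMeasurable
        (hKm.norm.aemeasurable.pow_const _).aestronglyMeasurable)
  have hgn : ∀ x, ‖g x‖ = ‖K x‖ ^ (r - 1) := by
    intro x
    rw [hg]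
    simp only [norm_mul, RCLike.norm_conj, Complex.norm_real]
    rw [Real.norm_of_nonneg (Real.rpow_nonneg (norm_nonneg _) _)]
    rcases (norm_nonneg (K x)).eq_or_lt with h0 | h0
    · rw [← h0, zero_mul, Real.zero_rpow (by linarith)]
    · rw [show r - 1 = 1 + (r - 2) by ring, Real.rpow_add h0, Real.rpow_one]
  have hgn' : ∀ x, ‖g x‖ ^ r' = ‖K x‖ ^ r := by
    intro x
    rw [hgn, ← Real.rpow_mul (norm_nonneg _), hpq.sub_one_mul_conj]
  have hKg : ∀ x, K x * g x = ((‖K x‖ ^ r : ℝ) : ℂ) := by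
    intro x
    rw [hg]
    simp only []
    rw [← mul_assoc, Complex.mul_conj, Complex.normSq_eq_norm_sq, ← Complex.ofReal_mul]
    congr 1
    rcases (norm_nonneg (K x)).eq_or_lt with h0 | h0
    · rw [← h0, Real.zero_rpow (by linarith : r ≠ 0)]; simp
    · rw [← Real.rpow_natCast, ← Real.rpow_add h0]; congr 1; push_cast; ring
  have hi : Integrable fun x => ‖K x‖ ^ r := (Lp.memLp K).integrable_norm_rpow hp0 hpt.ne
  have hgL : MemLp g q volume := by
    rw [← integrable_norm_rpow_iff hgm hq0 hqt]
    simpa only [← hr', hgn'] using hi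
  set S := ∫ x, ‖K x‖ ^ r with hS
  have hS0 : 0 ≤ S := integral_nonneg fun x => Real.rpow_nonneg (norm_nonneg _) _
  have hKS : ‖K‖ = S ^ r⁻¹ := by
    rw [Lp.norm_def, (Lp.memLp K).eLpNorm_eq_integral_rpow_norm hp0 hpt.ne,
      ENNReal.toReal_ofReal (by positivity)]
  have hGS : ‖hgL.toLp g‖ = S ^ r'⁻¹ := by
    rw [Lp.norm_toLp, hgL.eLpNorm_eq_integral_rpow_norm hq0 hqt,
      ENNReal.toReal_ofReal (by positivity)]
    simp only [← hr', hgn']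
    rfl
  have h1 := h (hgL.toLp g)
  have h2 : ∫ x, K x * hgL.toLp g x = (S : ℂ) := by
    rw [hS, ← integral_complex_ofReal]
    refine integral_congr_ae ?_
    filter_upwards [hgL.coeFn_toLp] with x hx
    rw [hx, hKg]
  rw [h2, hGS, Complex.norm_real, Real.norm_of_nonneg hS0] at h1
  rw [hKS]
  rcases hS0.eq_or_lt with h0 | h0
  · rw [← h0, Real.zero_rpow (inv_ne_zero (by linarith))]
    exact hM
  · have e : S = S ^ r⁻¹ * S ^ r'⁻¹ := by
      rw [← Real.rpow_add h0, hpq.inv_add_inv_eq_one, Real.rpow_one]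
    have hpos : 0 < S ^ r'⁻¹ := Real.rpow_pos_of_pos h0 _
    nth_rewrite 1 [e] at h1
    exact le_of_mul_le_mul_right h1 hpos

theorem continuous_integral_mul {p q : ℝ≥0∞} [Fact (1 ≤ p)] [Fact (1 ≤ q)]
    [p.HolderConjugate q] (K : Lp ℂ p (volume : Measure Plane)) :
    Continuous fun G : Lp ℂ q (volume : Measure Plane) => ∫ x, K x * G x := by
  have h := ((ContinuousLinearMap.mul ℂ ℂ).lpPairing (volume : Measure Plane) p q K).continuous
  refine h.congr fun G => ?_
  rw [ContinuousLinearMap.lpPairing_eq_integral]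
  rfl

/-- A bounded function that defines a functional on Schwartz functions, bounded for the `L^q` norm,
belongs to `L^p`. -/
theorem eLpNorm_le_of_forall_schwartz {p q : ℝ≥0∞} [Fact (1 ≤ p)] [Fact (1 ≤ q)]
    [p.HolderConjugate q] (hp : 1 < p) (hpt : p < ⊤) {u : Plane → ℂ}
    (hu : AEStronglyMeasurable u volume) {B : ℝ} (hB : ∀ x, ‖u x‖ ≤ B) {M : ℝ} (hM : 0 ≤ M)
    (h : ∀ g : 𝓢(Plane, ℂ), ‖∫ x, u x * g x‖ ≤ M * ‖g.toLp q volume‖) :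
    eLpNorm u p volume ≤ ENNReal.ofReal M := by
  have hqt : q ≠ ⊤ := by
    have : q.HolderConjugate p := ENNReal.HolderConjugate.symm
    exact ((ENNReal.HolderConjugate.lt_top_iff_one_lt q p).2 hp).ne
  -- As u is only known to be bounded, cutting it off makes it p-integrable, so that the converse
  -- Hölder inequality applies. Here χ_n = 1 on the ball of radius n + 1.
  let χ : (n : ℕ) → ContDiffBump (0 : Plane) := fun n =>
    ⟨n + 1, n + 2, by positivity, by linarith⟩
  let X : ℕ → Plane → ℂ := fun n x => (χ n x : ℂ)
  have hXs : ∀ n, ContDiff ℝ ∞ (X n) := fun n =>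
    Complex.ofRealCLM.contDiff.comp (χ n).contDiff
  have hXc : ∀ n, HasCompactSupport (X n) := fun n =>
    (χ n).hasCompactSupport.comp_left Complex.ofReal_zero
  have hX1 : ∀ n x, ‖X n x‖ ≤ 1 := fun n x => by
    simp only [X]
    rw [Complex.norm_real, Real.norm_of_nonneg (χ n).nonneg]
    exact (χ n).le_one
  have hXg : ∀ n, (X n).HasTemperateGrowth := fun n =>
    ((hXc n).toSchwartzMap (hXs n)).hasTemperateGrowth
  have hXL : ∀ n, MemLp (X n) p volume := fun n =>
    (hXs n).continuous.memLp_of_hasCompactSupport (hXc n)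
  have hkm : ∀ n, AEStronglyMeasurable (fun x => X n x * u x) volume := fun n =>
    (hXs n).continuous.aestronglyMeasurable.mul hu
  have hkL : ∀ n, MemLp (fun x => X n x * u x) p volume := fun n =>
    (hXL n).of_le_mul (c := B) (hkm n) (ae_of_all _ fun x => by
      rw [norm_mul, mul_comm]
      exact mul_le_mul_of_nonneg_right (hB x) (norm_nonneg _))
  have hbound : ∀ n, eLpNorm (fun x => X n x * u x) p volume ≤ ENNReal.ofReal M := by
    intro n
    have hK : ‖(hkL n).toLp _‖ ≤ M := by
      refine norm_le_of_forall_integral_mul_le (q := q) hp hpt _ hM fun G => ?_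
      have hd : DenseRange (SchwartzMap.toLpCLM ℝ (E := Plane) ℂ q volume) :=
        SchwartzMap.denseRange_toLpCLM hqt
      refine hd.induction_on (p := fun G => ‖∫ x, (hkL n).toLp _ x * G x‖ ≤ M * ‖G‖) G
        (isClosed_le (continuous_integral_mul _).norm (by fun_prop)) fun g => ?_
      rw [SchwartzMap.toLpCLM_apply]
      -- The cut-off passes to the test function, which stays Schwartz and whose L^q norm does not
      -- grow.
      have e : ∫ x, (hkL n).toLp _ x * g.toLp q volume x =
          ∫ x, u x * SchwartzMap.smulLeftCLM ℂ (X n) g x := by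
        refine integral_congr_ae ?_
        filter_upwards [(hkL n).coeFn_toLp, g.coeFn_toLp q volume] with x h1 h2
        rw [h1, h2, SchwartzMap.smulLeftCLM_apply_apply (hXg n), smul_eq_mul]
        ring
      rw [e]
      refine (h _).trans ?_
      gcongr
      rw [SchwartzMap.norm_toLp, SchwartzMap.norm_toLp]
      refine ENNReal.toReal_mono (g.memLp q volume).eLpNorm_ne_top (eLpNorm_mono fun x => ?_)
      rw [SchwartzMap.smulLeftCLM_apply_apply (hXg n), norm_smul]
      exact mul_le_of_le_one_left (norm_nonneg _) (hX1 n x)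
    rw [Lp.norm_toLp] at hK
    rw [← ENNReal.ofReal_toReal (hkL n).eLpNorm_ne_top]
    exact ENNReal.ofReal_le_ofReal hK
  -- Fatou's lemma removes the cut-off.
  refine (Lp.eLpNorm_lim_le_liminf_eLpNorm hkm u (ae_of_all _ fun x => ?_)).trans
    (liminf_le_of_le (by isBoundedDefault) fun b hb => ?_)
  · refine tendsto_const_nhds.congr' ?_
    obtain ⟨N, hN⟩ := exists_nat_ge ‖x‖
    filter_upwards [eventually_ge_atTop N] with n hn
    have : χ n x = 1 := (χ n).one_of_mem_closedBall (by
      rw [mem_closedBall_zero_iff]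
      have : (N : ℝ) ≤ n := by exact_mod_cast hn
      change ‖x‖ ≤ (n : ℝ) + 1
      linarith)
    simp [X, this]
  · obtain ⟨n, hn⟩ := hb.exists
    exact hn.trans (hbound n)

theorem integral_fourierInv_mul {v : Plane → ℂ} (hv : Integrable v) (g : 𝓢(Plane, ℂ)) :
    ∫ x, 𝓕⁻ v x * g x = ∫ η, v η * 𝓕⁻ g η := by
  have h := VectorFourier.integral_fourierIntegral_smul_eq_flip (e := Real.fourierChar)
    (μ := (volume : Measure Plane)) (ν := (volume : Measure Plane)) (L := -innerₗ Plane)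
    (f := v) (g := (g : Plane → ℂ)) Real.continuous_fourierChar (by
      simp only [LinearMap.neg_apply, innerₗ_apply_apply]; fun_prop) hv
    (g.integrable (μ := volume))
  have e : (-innerₗ Plane).flip = -innerₗ Plane := by
    ext x y
    simp [real_inner_comm]
  rw [e] at h
  simp only [smul_eq_mul] at h
  rw [SchwartzMap.fourierInv_coe]
  exact h

/-- `multForm b f g` is the pairing of `T_b f` with `g`. -/
theorem integral_multiplier_mul {b : Plane → ℂ} (hb : Measurable b) {B : ℝ}
    (hB : ∀ η, ‖b η‖ ≤ B) (f g : 𝓢(Plane, ℂ)) :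
    ∫ x, 𝓕⁻ (fun η => b η * 𝓕 (f : Plane → ℂ) η) x * g x = multForm b f g := by
  have hi : Integrable fun η => b η * 𝓕 (f : Plane → ℂ) η := by
    rw [← SchwartzMap.fourier_coe]
    exact (𝓕 f).integrable.bdd_mul hb.aestronglyMeasurable (ae_of_all _ hB)
  rw [integral_fourierInv_mul hi]
  refine integral_congr_ae (ae_of_all _ fun η => ?_)
  simp only [SchwartzMap.fourier_coe]
  ring

theorem integrable_mul_fourier {b : Plane → ℂ} (hb : Measurable b) {B : ℝ}
    (hB : ∀ η, ‖b η‖ ≤ B) (f : 𝓢(Plane, ℂ)) :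
    Integrable fun η => b η * 𝓕 (f : Plane → ℂ) η := by
  rw [← SchwartzMap.fourier_coe]
  exact (𝓕 f).integrable.bdd_mul hb.aestronglyMeasurable (ae_of_all _ hB)

theorem continuous_fourierInv_of_integrable {v : Plane → ℂ} (hv : Integrable v) :
    Continuous (𝓕⁻ v) :=
  VectorFourier.fourierIntegral_continuous Real.continuous_fourierChar
    (by simp only [LinearMap.neg_apply, innerₗ_apply_apply]; fun_prop) hv

theorem norm_fourierInv_le (v : Plane → ℂ) (x : Plane) : ‖𝓕⁻ v x‖ ≤ ∫ η, ‖v η‖ :=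
  VectorFourier.norm_fourierIntegral_le_integral_norm _ _ _ _ _

/-- A bound for the form of a multiplier bounds the multiplier on `L^p`. -/
theorem IsMult.eLpNorm_le {p q : ℝ≥0∞} [Fact (1 ≤ p)] [Fact (1 ≤ q)] [p.HolderConjugate q]
    (hp : 1 < p) (hpt : p < ⊤) {C : ℝ} (hC : 0 ≤ C) {b : Plane → ℂ} (h : IsMult p q C b)
    (hb : Measurable b) {B : ℝ} (hB : ∀ η, ‖b η‖ ≤ B) (f : 𝓢(Plane, ℂ)) :
    eLpNorm (𝓕⁻ (fun η => b η * 𝓕 (f : Plane → ℂ) η)) p volume ≤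
      ENNReal.ofReal (C * ‖f.toLp p volume‖) := by
  refine eLpNorm_le_of_forall_schwartz (q := q) hp hpt
    (continuous_fourierInv_of_integrable (integrable_mul_fourier hb hB f)).aestronglyMeasurable
    (norm_fourierInv_le _) (by positivity) fun g => ?_
  rw [integral_multiplier_mul hb hB, mul_assoc]
  exact h f g

/-- Products of multipliers, one of which is smooth. -/
theorem IsMult.mul {p q : ℝ≥0∞} [Fact (1 ≤ p)] [Fact (1 ≤ q)] [p.HolderConjugate q]
    (hp : 1 < p) (hpt : p < ⊤) {C₁ C₂ : ℝ} (hC₁ : 0 ≤ C₁) (hC₂ : 0 ≤ C₂) {b₁ b₂ : Plane → ℂ}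
    (h₁ : IsMult p q C₁ b₁) (h₂ : IsMult p q C₂ b₂) (hb : b₂.HasTemperateGrowth) {B : ℝ}
    (hB : ∀ η, ‖b₂ η‖ ≤ B) : IsMult p q (C₁ * C₂) fun η => b₁ η * b₂ η := by
  intro f g
  -- Temperate growth makes T_{b₂} f a Schwartz function, to which the form of b₁ applies. The
  -- symbols ρ_j qualify; the Riesz symbols, singular at 0, do not.
  set F : 𝓢(Plane, ℂ) := SchwartzMap.fourierMultiplierCLM ℂ b₂ f with hF
  have hm : Measurable b₂ := hb.1.continuous.measurable
  have e1 : ∀ η, 𝓕 F η = b₂ η * 𝓕 f η := by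
    intro η
    rw [hF, SchwartzMap.fourierMultiplierCLM_apply, FourierTransform.fourier_fourierInv_eq,
      SchwartzMap.smulLeftCLM_apply_apply hb, smul_eq_mul]
  have e2 : multForm (fun η => b₁ η * b₂ η) f g = multForm b₁ F g := by
    refine integral_congr_ae (ae_of_all _ fun η => ?_)
    simp only [e1]
    ring
  have e3 : (F : Plane → ℂ) = 𝓕⁻ (fun η => b₂ η * 𝓕 (f : Plane → ℂ) η) := by
    rw [hF, SchwartzMap.fourierMultiplierCLM_apply, SchwartzMap.fourierInv_coe,
      SchwartzMap.smulLeftCLM_apply hb]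
    simp only [smul_eq_mul, SchwartzMap.fourier_coe]
  have e4 : ‖F.toLp p volume‖ ≤ C₂ * ‖f.toLp p volume‖ := by
    rw [SchwartzMap.norm_toLp, e3]
    exact ENNReal.toReal_le_of_le_ofReal (by positivity) (h₂.eLpNorm_le hp hpt hC₂ hm hB f)
  rw [e2]
  calc _ ≤ C₁ * (‖F.toLp p volume‖ * ‖g.toLp q volume‖) := h₁ F g
    _ ≤ C₁ * ((C₂ * ‖f.toLp p volume‖) * ‖g.toLp q volume‖) := by gcongr
    _ = _ := by ring

theorem fourierInv_add_of_integrable {u v : Plane → ℂ} (hu : Integrable u) (hv : Integrable v) :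
    𝓕⁻ (fun η => u η + v η) = 𝓕⁻ u + 𝓕⁻ v := by
  have := VectorFourier.fourierIntegral_add (e := Real.fourierChar)
    (μ := (volume : Measure Plane)) (L := -innerₗ Plane) Real.continuous_fourierChar
    (by simp only [LinearMap.neg_apply, innerₗ_apply_apply]; fun_prop) hu hv
  exact this

/-- The extension of a multiplier to `L^p`. -/
theorem exists_isLqMultiplier {p q : ℝ≥0∞} [Fact (1 ≤ p)] [Fact (1 ≤ q)] [p.HolderConjugate q]
    (hp : 1 < p) (hpt : p < ⊤) {C : ℝ} (hC : 0 ≤ C) {a : Plane → ℂ}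
    (h : IsMult p q C fun η => a ((2 * Real.pi) • η)) (ha : Measurable a) {B : ℝ}
    (hB : ∀ ξ, ‖a ξ‖ ≤ B) :
    ∃ T : Lp ℂ p (volume : Measure Plane) →L[ℂ] Lp ℂ p (volume : Measure Plane),
      IsLqMultiplier a p T ∧ ∀ f, ‖T f‖ ≤ C * ‖f‖ := by
  set b : Plane → ℂ := fun η => a ((2 * Real.pi) • η) with hb
  have hbm : Measurable b := ha.comp (by fun_prop)
  have hbB : ∀ η, ‖b η‖ ≤ B := fun η => hB _
  have hi := integrable_mul_fourier hbm hbB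
  have hle := h.eLpNorm_le hp hpt hC hbm hbB
  have hL : ∀ f : 𝓢(Plane, ℂ), MemLp (multiplierOnSchwartz a f) p volume := fun f =>
    ⟨(continuous_fourierInv_of_integrable (hi f)).aestronglyMeasurable,
      (hle f).trans_lt ENNReal.ofReal_lt_top⟩
  have hadd : ∀ f g : 𝓢(Plane, ℂ), multiplierOnSchwartz a (f + g) =
      multiplierOnSchwartz a f + multiplierOnSchwartz a g := by
    intro f g
    rw [multiplierOnSchwartz, multiplierOnSchwartz, multiplierOnSchwartz,
      ← fourierInv_add_of_integrable (hi f) (hi g)]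
    congr 1
    funext η
    rw [← SchwartzMap.fourier_coe, FourierTransform.fourier_add, add_apply,
      SchwartzMap.fourier_coe, SchwartzMap.fourier_coe]
    simp only [hb]
    ring
  have hsmul : ∀ (c : ℂ) (f : 𝓢(Plane, ℂ)), multiplierOnSchwartz a (c • f) =
      c • multiplierOnSchwartz a f := by
    intro c f
    have := VectorFourier.fourierIntegral_const_smul Real.fourierChar
      (volume : Measure Plane) (-innerₗ Plane) (fun η => b η * 𝓕 (f : Plane → ℂ) η) c
    rw [multiplierOnSchwartz, multiplierOnSchwartz]
    refine Eq.trans ?_ this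
    change 𝓕⁻ (fun η => b η * 𝓕 ((c • f : 𝓢(Plane, ℂ)) : Plane → ℂ) η) =
      𝓕⁻ (c • fun η => b η * 𝓕 (f : Plane → ℂ) η)
    congr 1
    funext η
    rw [← SchwartzMap.fourier_coe, FourierTransform.fourier_smul, smul_apply,
      SchwartzMap.fourier_coe]
    simp only [hb, Pi.smul_apply, smul_eq_mul]
    ring
  let S : 𝓢(Plane, ℂ) →ₗ[ℂ] Lp ℂ p (volume : Measure Plane) :=
    { toFun := fun f => (hL f).toLp _
      map_add' := fun f g => by
        rw [← MemLp.toLp_add]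
        exact MemLp.toLp_congr _ _ (by rw [hadd])
      map_smul' := fun c f => by
        rw [RingHom.id_apply, ← MemLp.toLp_const_smul]
        exact MemLp.toLp_congr _ _ (by rw [hsmul]) }
  let E : 𝓢(Plane, ℂ) →ₗ[ℂ] Lp ℂ p (volume : Measure Plane) :=
    (SchwartzMap.toLpCLM ℂ (E := Plane) ℂ p volume).toLinearMap
  have hd : DenseRange E := SchwartzMap.denseRange_toLpCLM (F := ℂ) (E := Plane) hpt.ne
  have hS : ∀ f, ‖S f‖ ≤ C * ‖E f‖ := by
    intro f
    change ‖(hL f).toLp _‖ ≤ C * ‖f.toLp p volume‖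
    rw [Lp.norm_toLp]
    exact ENNReal.toReal_le_of_le_ofReal (by positivity) (hle f)
  refine ⟨S.extendOfNorm E, fun f => ?_, LinearMap.norm_extendOfNorm_apply_le hd C hS⟩
  have := LinearMap.extendOfNorm_eq hd ⟨C, hS⟩ f
  change S.extendOfNorm E (f.toLp p volume) = (hL f).toLp _ at this
  rw [this]
  exact (hL f).coeFn_toLp

/-- If the symbols of two multipliers differ by the factor `i ξ_j`, then the second operator is
the distributional derivative of the first one. -/
theorem lineDeriv_multiplier {p : ℝ≥0∞} [Fact (1 ≤ p)] (hpt : p < ⊤)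
    {a a' : Plane → ℂ} (ha : Measurable a) (ha' : Measurable a') {B B' : ℝ}
    (hB : ∀ ξ, ‖a ξ‖ ≤ B) (hB' : ∀ ξ, ‖a' ξ‖ ≤ B') (j : Fin 2)
    (haa : ∀ ξ, a' ξ = I * ξ j * a ξ)
    {T T' : Lp ℂ p (volume : Measure Plane) →L[ℂ] Lp ℂ p (volume : Measure Plane)}
    (hT : IsLqMultiplier a p T) (hT' : IsLqMultiplier a' p T')
    (f : Lp ℂ p (volume : Measure Plane)) :
    ∂_{(EuclideanSpace.single j 1 : Plane)} (T f : 𝓢'(Plane, ℂ)) = (T' f : 𝓢'(Plane, ℂ)) := by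
  have hd : DenseRange (SchwartzMap.toLpCLM ℂ (E := Plane) ℂ p volume) :=
    SchwartzMap.denseRange_toLpCLM hpt.ne
  let m : Plane := EuclideanSpace.single j 1
  have hc1 : Continuous fun f : Lp ℂ p (volume : Measure Plane) =>
      ∂_{m} (T f : 𝓢'(Plane, ℂ)) :=
    (continuous_lineDerivOp m).comp
      ((Lp.toTemperedDistributionCLM ℂ (volume : Measure Plane) p).continuous.comp T.continuous)
  have hc2 : Continuous fun f : Lp ℂ p (volume : Measure Plane) => (T' f : 𝓢'(Plane, ℂ)) :=
    (Lp.toTemperedDistributionCLM ℂ (volume : Measure Plane) p).continuous.comp T'.continuous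
  -- Both sides are continuous from L^p to tempered distributions, so Schwartz f suffice.
  refine congrFun (hd.equalizer hc1 hc2 (funext fun f => ?_)) f
  ext g
  simp only [Function.comp_apply, SchwartzMap.toLpCLM_apply]
  rw [TemperedDistribution.lineDerivOp_apply_apply, Lp.toTemperedDistribution_apply,
    Lp.toTemperedDistribution_apply]
  have hbm : ∀ {a : Plane → ℂ}, Measurable a → Measurable fun η : Plane => a ((2 * Real.pi) • η) :=
    fun ha => ha.comp (by fun_prop)
  have e : ∀ {a : Plane → ℂ} {B : ℝ}
      {T : Lp ℂ p (volume : Measure Plane) →L[ℂ] Lp ℂ p (volume : Measure Plane)}, Measurable a →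
      (∀ ξ, ‖a ξ‖ ≤ B) → IsLqMultiplier a p T → ∀ g : 𝓢(Plane, ℂ),
      ∫ x, g x • T (f.toLp p volume) x = multForm (fun η => a ((2 * Real.pi) • η)) f g := by
    intro a B T ha hB hT g
    rw [← integral_multiplier_mul (hbm ha) (fun η => hB _)]
    refine integral_congr_ae ?_
    filter_upwards [hT f] with x hx
    rw [hx, smul_eq_mul, mul_comm]
    rfl
  rw [e ha hB hT, e ha' hB' hT']
  refine integral_congr_ae (ae_of_all _ fun η => ?_)
  simp only [haa]
  -- The minus sign of the distributional derivative cancels the one in 𝓕⁻(∂_m g) = -2πi⟨η, m⟩ 𝓕⁻ g.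
  rw [show -∂_{m} g = ∂_{m} (-g) by rw [lineDerivOp_neg], SchwartzMap.fourierInv_lineDerivOp_eq]
  have ht : (inner ℝ · m : Plane → ℝ).HasTemperateGrowth := by fun_prop
  rw [smul_apply, SchwartzMap.smulLeftCLM_apply_apply ht, FourierTransform.fourierInv_neg]
  simp [m, EuclideanSpace.inner_single_right]
  ring

/-! ### The Hörmander–Mikhlin condition. -/

/-- The Mikhlin condition for a real function on an open set of the plane. -/
def MikhlinOn (U : Set Plane) (a : Plane → ℝ) : Prop :=
  ContDiffOn ℝ ∞ a U ∧ ∀ k : ℕ, ∃ C : ℝ, ∀ ξ ∈ U, ‖iteratedFDeriv ℝ k a ξ‖ * ‖ξ‖ ^ k ≤ C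

theorem MikhlinOn.congr {U : Set Plane} {a b : Plane → ℝ} (hU : IsOpen U) (ha : MikhlinOn U a)
    (hab : Set.EqOn b a U) : MikhlinOn U b := by
  refine ⟨ha.1.congr hab, fun k => ?_⟩
  obtain ⟨C, hC⟩ := ha.2 k
  refine ⟨C, fun ξ hξ => ?_⟩
  have : b =ᶠ[𝓝 ξ] a := hab.eventuallyEq_of_mem (hU.mem_nhds hξ)
  rw [(this.iteratedFDeriv ℝ k).eq_of_nhds]
  exact hC ξ hξ

theorem MikhlinOn.sub {U : Set Plane} {a b : Plane → ℝ} (hU : IsOpen U) (ha : MikhlinOn U a)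
    (hb : MikhlinOn U b) : MikhlinOn U (fun ξ => a ξ - b ξ) := by
  refine ⟨ha.1.sub hb.1, fun k => ?_⟩
  obtain ⟨C, hC⟩ := ha.2 k
  obtain ⟨D, hD⟩ := hb.2 k
  refine ⟨C + D, fun ξ hξ => ?_⟩
  have ha' := ((ha.1 ξ hξ).of_le (m := k) (by exact_mod_cast le_top))
  have hb' := ((hb.1 ξ hξ).of_le (m := k) (by exact_mod_cast le_top))
  have h := iteratedFDerivWithin_sub_apply ha' hb' hU.uniqueDiffOn hξ
  rw [iteratedFDerivWithin_of_isOpen k hU hξ, iteratedFDerivWithin_of_isOpen k hU hξ,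
    iteratedFDerivWithin_of_isOpen k hU hξ] at h
  change ‖iteratedFDeriv ℝ k (a - b) ξ‖ * _ ≤ _
  rw [h]
  calc _ ≤ (‖iteratedFDeriv ℝ k a ξ‖ + ‖iteratedFDeriv ℝ k b ξ‖) * ‖ξ‖ ^ k := by
        gcongr; exact norm_sub_le _ _
    _ ≤ C + D := by rw [add_mul]; exact add_le_add (hC ξ hξ) (hD ξ hξ)

theorem MikhlinOn.mul {U : Set Plane} {a b : Plane → ℝ} (hU : IsOpen U) (ha : MikhlinOn U a)
    (hb : MikhlinOn U b) : MikhlinOn U (fun ξ => a ξ * b ξ) := by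
  refine ⟨ha.1.mul hb.1, fun k => ?_⟩
  choose A hA using ha.2
  choose B hB using hb.2
  refine ⟨∑ i ∈ Finset.range (k + 1), (k.choose i : ℝ) * (A i * B (k - i)), fun ξ hξ => ?_⟩
  have h := norm_iteratedFDerivWithin_mul_le ha.1 hb.1 hU.uniqueDiffOn hξ (n := k)
    (by exact_mod_cast le_top)
  simp only [iteratedFDerivWithin_of_isOpen _ hU hξ] at h
  refine (mul_le_mul_of_nonneg_right h (by positivity)).trans ?_
  rw [Finset.sum_mul]
  refine Finset.sum_le_sum fun i hi => ?_
  have hi' : i ≤ k := Nat.lt_succ_iff.1 (Finset.mem_range.1 hi)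
  calc _ = (k.choose i : ℝ) * ((‖iteratedFDeriv ℝ i a ξ‖ * ‖ξ‖ ^ i) *
        (‖iteratedFDeriv ℝ (k - i) b ξ‖ * ‖ξ‖ ^ (k - i))) := by
        rw [← Nat.add_sub_cancel' hi', pow_add, Nat.add_sub_cancel' hi']; ring
    _ ≤ _ := by
        gcongr
        · exact le_trans (by positivity) (hA i ξ hξ)
        · exact hA i ξ hξ
        · exact hB _ ξ hξ

/-- The Faà di Bruno estimate: the derivatives of g are bounded on the compact set K that contains
the values of a, and those of a of order i are O(|ξ|^{-i}). -/
theorem MikhlinOn.comp {U : Set Plane} {a : Plane → ℝ} (hU : IsOpen U) (h0 : (0 : Plane) ∉ U)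
    (ha : MikhlinOn U a) {V K : Set ℝ} (hV : IsOpen V) (hK : IsCompact K) (hKV : K ⊆ V)
    (haK : Set.MapsTo a U K) {g : ℝ → ℝ} (hg : ContDiffOn ℝ ∞ g V) :
    MikhlinOn U (fun ξ => g (a ξ)) := by
  have haV : Set.MapsTo a U V := haK.mono_right hKV
  refine ⟨hg.comp ha.1 haV, fun k => ?_⟩
  choose A hA using ha.2
  have hgb : ∀ i : ℕ, ∃ C, ∀ x ∈ K, ‖iteratedFDerivWithin ℝ i g V x‖ ≤ C := fun i =>
    hK.exists_bound_of_continuousOn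
      ((hg.continuousOn_iteratedFDerivWithin (m := i) (by exact_mod_cast le_top)
        hV.uniqueDiffOn).mono hKV)
  choose B hB using hgb
  set M : ℝ := ∑ i ∈ Finset.range (k + 1), |B i|
  -- D ≥ 1 gives A_i ≤ D ≤ D^i for i ≥ 1, the geometric form that the composition estimate requires.
  set D : ℝ := 1 + ∑ i ∈ Finset.range (k + 1), |A i|
  have hD1 : 1 ≤ D := le_add_of_nonneg_right (Finset.sum_nonneg fun _ _ => abs_nonneg _)
  refine ⟨k.factorial * M * D ^ k, fun ξ hξ => ?_⟩
  have hξ0 : 0 < ‖ξ‖ := norm_pos_iff.2 fun h => h0 (h ▸ hξ)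
  have h := norm_iteratedFDerivWithin_comp_le hg ha.1 (n := k) (by exact_mod_cast le_top)
    hV.uniqueDiffOn hU.uniqueDiffOn haV hξ (C := M) (D := D / ‖ξ‖)
    (fun i hi => (hB i _ (haK hξ)).trans <| (le_abs_self _).trans <|
      Finset.single_le_sum (f := fun i => |B i|) (fun _ _ => abs_nonneg _)
        (Finset.mem_range.2 (Nat.lt_succ_of_le hi)))
    (fun i hi1 hi => by
      rw [iteratedFDerivWithin_of_isOpen _ hU hξ, div_pow, le_div_iff₀ (by positivity)]
      have : |A i| ≤ D := le_add_of_nonneg_of_le zero_le_one <|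
        Finset.single_le_sum (f := fun i => |A i|) (fun _ _ => abs_nonneg _)
          (Finset.mem_range.2 (Nat.lt_succ_of_le hi))
      exact (hA i ξ hξ).trans <| (le_abs_self _).trans <| this.trans <|
        le_self_pow₀ hD1 (by omega))
  rw [iteratedFDerivWithin_of_isOpen _ hU hξ, div_pow, ← mul_div_assoc,
    le_div_iff₀ (by positivity)] at h
  exact h

/-- By scaling, the derivative of order k at ξ is |ξ|^{d-k} times the one at ξ/|ξ|, bounded on the
unit circle. The bound on |ξ|^d over U admits positive degrees near 0 and negative ones near
infinity. -/
theorem mikhlinOn_of_homogeneous {U : Set Plane} (h0 : (0 : Plane) ∉ U)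
    {a : Plane → ℝ} {d M : ℝ} (ha : ContDiffOn ℝ ∞ a {0}ᶜ)
    (hom : ∀ c : ℝ, 0 < c → ∀ ξ : Plane, ξ ≠ 0 → a (c • ξ) = c ^ d * a ξ)
    (hM : ∀ ξ ∈ U, ‖ξ‖ ^ d ≤ M) : MikhlinOn U a := by
  have hU0 : U ⊆ {0}ᶜ := fun ξ hξ h => h0 (Set.mem_singleton_iff.1 h ▸ hξ)
  have hop : IsOpen ({0}ᶜ : Set Plane) := isOpen_compl_singleton
  refine ⟨ha.mono hU0, fun k => ?_⟩
  obtain ⟨B, hB⟩ : ∃ B, ∀ x ∈ Metric.sphere (0 : Plane) 1,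
      ‖iteratedFDerivWithin ℝ k a {0}ᶜ x‖ ≤ B :=
    (isCompact_sphere _ _).exists_bound_of_continuousOn
      ((ha.continuousOn_iteratedFDerivWithin (m := k) (by exact_mod_cast le_top)
        hop.uniqueDiffOn).mono fun x hx h => by
          rw [Set.mem_singleton_iff.1 h] at hx; simp at hx)
  refine ⟨M * B, fun ξ hξ => ?_⟩
  have hξ0 : ξ ≠ 0 := hU0 hξ
  have hr : 0 < ‖ξ‖ := norm_pos_iff.2 hξ0
  set g : Plane →L[ℝ] Plane := ‖ξ‖⁻¹ • ContinuousLinearMap.id ℝ Plane with hg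
  have hgx : ∀ x, g x = ‖ξ‖⁻¹ • x := fun x => rfl
  have hpre : g ⁻¹' {0}ᶜ = {0}ᶜ := by
    ext x; simp [hgx, hr.ne']
  have hc := g.iteratedFDerivWithin_comp_right ha hop.uniqueDiffOn
    (by rw [hpre]; exact hop.uniqueDiffOn) (x := ξ) (by simp [hgx, hξ0]) (i := k)
    (by exact_mod_cast le_top)
  rw [hpre] at hc
  have heq : Set.EqOn a (‖ξ‖ ^ d • (a ∘ g)) {0}ᶜ := by
    intro x hx
    have := hom ‖ξ‖⁻¹ (by positivity) x hx
    simp only [Pi.smul_apply, Function.comp_apply, hgx, this, smul_eq_mul]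
    rw [← mul_assoc, ← Real.mul_rpow hr.le (by positivity), mul_inv_cancel₀ hr.ne',
      Real.one_rpow, one_mul]
  have hcd : ContDiffOn ℝ ∞ (a ∘ g) {0}ᶜ := by
    have := ha.comp (g.contDiff.contDiffOn (s := {0}ᶜ)) (fun x hx => hpre.ge hx)
    exact this
  have hs : iteratedFDeriv ℝ k a ξ = ‖ξ‖ ^ d • iteratedFDerivWithin ℝ k (a ∘ g) {0}ᶜ ξ := by
    rw [← iteratedFDerivWithin_of_isOpen k hop hξ0, iteratedFDerivWithin_congr heq hξ0 k,
      iteratedFDerivWithin_const_smul_apply ((hcd ξ hξ0).of_le (by exact_mod_cast le_top))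
        hop.uniqueDiffOn hξ0]
  have hgn : ‖g‖ ≤ ‖ξ‖⁻¹ := by
    rw [hg, norm_smul, norm_inv, norm_norm]
    exact mul_le_of_le_one_right (by positivity) ContinuousLinearMap.norm_id_le
  have hbd : ‖iteratedFDerivWithin ℝ k (a ∘ g) {0}ᶜ ξ‖ ≤ B * ‖ξ‖⁻¹ ^ k := by
    rw [hc]
    refine (ContinuousMultilinearMap.norm_compContinuousLinearMap_le _ _).trans ?_
    rw [Finset.prod_const, Finset.card_univ, Fintype.card_fin]
    have := hB (g ξ) (by simp [hgx, norm_smul, hr.ne'])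
    gcongr
    exact (norm_nonneg _).trans this
  rw [hs, norm_smul, Real.norm_of_nonneg (by positivity)]
  calc ‖ξ‖ ^ d * ‖iteratedFDerivWithin ℝ k (a ∘ g) {0}ᶜ ξ‖ * ‖ξ‖ ^ k
      ≤ ‖ξ‖ ^ d * (B * ‖ξ‖⁻¹ ^ k) * ‖ξ‖ ^ k := by gcongr
    _ = ‖ξ‖ ^ d * B := by rw [inv_pow]; field_simp
    _ ≤ M * B := by
        have : 0 ≤ B := (norm_nonneg _).trans (hB (g ξ) (by simp [hgx, norm_smul, hr.ne']))
        gcongr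
        exact hM ξ hξ

theorem contDiffOn_norm_rpow (d : ℝ) : ContDiffOn ℝ ∞ (fun ξ : Plane => ‖ξ‖ ^ d) {0}ᶜ := by
  intro ξ hξ
  exact ((contDiffAt_norm ℝ hξ).rpow_const_of_ne (norm_ne_zero_iff.2 hξ)).contDiffWithinAt

theorem contDiffOn_coord (j : Fin 2) (s : Set Plane) : ContDiffOn ℝ ∞ (fun ξ : Plane => ξ j) s :=
  (EuclideanSpace.proj j : Plane →L[ℝ] ℝ).contDiff.contDiffOn

theorem mikhlinOn_norm_rpow {U : Set Plane} (h0 : (0 : Plane) ∉ U) {d M : ℝ}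
    (hM : ∀ ξ ∈ U, ‖ξ‖ ^ d ≤ M) : MikhlinOn U fun ξ => ‖ξ‖ ^ d :=
  mikhlinOn_of_homogeneous h0 (contDiffOn_norm_rpow d) (fun c hc ξ _ => by
    rw [norm_smul, Real.norm_of_nonneg hc.le, Real.mul_rpow hc.le (norm_nonneg _)]) hM

theorem contDiffOn_one_add_rpow (s : ℝ) :
    ContDiffOn ℝ ∞ (fun x : ℝ => (1 + x) ^ s) (Set.Ioi (-1)) := by
  intro x hx
  have hx' : (-1 : ℝ) < x := hx
  have : ContDiffAt ℝ ∞ (fun x : ℝ => 1 + x) x := by fun_prop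
  exact (this.rpow_const_of_ne (by linarith)).contDiffWithinAt

/-- The difference quotient ((1+x)^s - 1)/x has a removable singularity at 0, seen from the power
series there. -/
theorem contDiffOn_dslope_one_add_rpow (s : ℝ) :
    ContDiffOn ℝ ∞ (dslope (fun x : ℝ => (1 + x) ^ s) 0) (Set.Ioi (-1)) := by
  intro x hx
  refine ContDiffAt.contDiffWithinAt ?_
  rcases eq_or_ne x 0 with rfl | h
  · exact (Real.one_add_rpow_hasFPowerSeriesAt_zero
      (a := s)).has_fpower_series_dslope_fslope.analyticAt.contDiffAt
  · have h1 : ContDiffAt ℝ ∞ (fun x : ℝ => (x - 0)⁻¹ • ((1 + x) ^ s - (1 + 0) ^ s)) x :=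
      ((contDiffAt_id.sub contDiffAt_const).inv (by simpa using h)).smul
        (((contDiffOn_one_add_rpow s).contDiffAt (Ioi_mem_nhds hx)).sub contDiffAt_const)
    refine h1.congr_of_eventuallyEq ?_
    filter_upwards [isOpen_ne.mem_nhds h] with y hy
    rw [dslope_of_ne _ hy, slope_def_module]

/-- On a bounded set |ξ|^α and ξ₁ satisfy the condition by homogeneity of positive degree, and the
other factors are smooth functions of |ξ|². -/
theorem mikhlinOn_symbolMTilde_small {α : ℝ} (hα : 0 < α) :
    MikhlinOn {ξ | ξ ≠ 0 ∧ ‖ξ‖ < 2} (symbolMTilde α) := by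
  set U : Set Plane := {ξ | ξ ≠ 0 ∧ ‖ξ‖ < 2}
  have hU : IsOpen U := isOpen_ne.inter (isOpen_lt continuous_norm continuous_const)
  have h0 : (0 : Plane) ∉ U := fun h => h.1 rfl
  have hb : ∀ d : ℝ, 0 ≤ d → ∀ ξ ∈ U, ‖ξ‖ ^ d ≤ 2 ^ d := fun d hd ξ hξ =>
    Real.rpow_le_rpow (norm_nonneg _) hξ.2.le hd
  have hsq : MikhlinOn U fun ξ => ‖ξ‖ ^ (2 : ℝ) := mikhlinOn_norm_rpow h0 (hb 2 (by norm_num))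
  have hα' : MikhlinOn U fun ξ => ‖ξ‖ ^ α := mikhlinOn_norm_rpow h0 (hb α hα.le)
  have hc : MikhlinOn U fun ξ => ξ 0 :=
    mikhlinOn_of_homogeneous h0 (contDiffOn_coord 0 _) (d := 1) (fun c _ ξ _ => by simp)
      (hb 1 zero_le_one)
  have hg : ∀ s : ℝ, MikhlinOn U fun ξ => (1 + ‖ξ‖ ^ (2 : ℝ)) ^ s := fun s =>
    hsq.comp hU h0 isOpen_Ioi (isCompact_Icc (a := (0 : ℝ)) (b := 2 ^ (2 : ℝ)))
      (fun x hx => by simpa using (neg_one_lt_zero.trans_le hx.1))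
      (fun ξ hξ => ⟨by positivity, hb 2 (by norm_num) ξ hξ⟩) (contDiffOn_one_add_rpow s)
  refine ((hg (1 / 2)).mul hU (((hα'.mul hU hc).mul hU (hg (-(α / 2)))).sub hU hc)).congr hU ?_
  intro ξ hξ
  have h : (0 : ℝ) ≤ 1 + ‖ξ‖ ^ 2 := by positivity
  simp only [symbolMTilde, symbolM, Real.rpow_two, Real.rpow_neg h, add_comm (‖ξ‖ ^ 2), div_eq_mul_inv]

/-- With x = |ξ|⁻² one has m̃ = (ξ₁/|ξ|)(1+x)^{1/2}·((1+x)^{-α/2} - 1)/x. The quotient is smooth up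
to x = 0; the gain |ξ|⁻² in it compensates the growth of ξ₁(1+|ξ|²)^{1/2}. -/
theorem mikhlinOn_symbolMTilde_large (α : ℝ) :
    MikhlinOn {ξ | 1 < ‖ξ‖} (symbolMTilde α) := by
  set U : Set Plane := {ξ | 1 < ‖ξ‖}
  have hU : IsOpen U := isOpen_lt continuous_const continuous_norm
  have h0 : (0 : Plane) ∉ U := fun h => by
    have : (1 : ℝ) < ‖(0 : Plane)‖ := h
    norm_num at this
  have hle : ∀ ξ ∈ U, ‖ξ‖ ^ (-2 : ℝ) ≤ 1 := fun ξ hξ =>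
    Real.rpow_le_one_of_one_le_of_nonpos (le_of_lt hξ) (by norm_num)
  have hsq : MikhlinOn U fun ξ => ‖ξ‖ ^ (-2 : ℝ) := mikhlinOn_norm_rpow h0 hle
  have hc : MikhlinOn U fun ξ => ξ 0 * ‖ξ‖ ^ (-1 : ℝ) :=
    mikhlinOn_of_homogeneous h0 ((contDiffOn_coord 0 _).mul (contDiffOn_norm_rpow _)) (d := 0)
      (M := 1) (fun c hc ξ _ => by
        have : c * c ^ (-1 : ℝ) = 1 := by rw [Real.rpow_neg_one]; exact mul_inv_cancel₀ hc.ne'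
        simp only [PiLp.smul_apply, smul_eq_mul, norm_smul, Real.norm_of_nonneg hc.le,
          Real.mul_rpow hc.le (norm_nonneg _), Real.rpow_zero]
        linear_combination (ξ 0 * ‖ξ‖ ^ (-1 : ℝ)) * this)
      (fun ξ _ => by simp)
  have hmap : Set.MapsTo (fun ξ : Plane => ‖ξ‖ ^ (-2 : ℝ)) U (Set.Icc 0 1) :=
    fun ξ hξ => ⟨by positivity, hle ξ hξ⟩
  have hsub : Set.Icc (0 : ℝ) 1 ⊆ Set.Ioi (-1) := fun x hx => by
    simpa using (neg_one_lt_zero.trans_le hx.1)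
  have hg := hsq.comp hU h0 isOpen_Ioi isCompact_Icc hsub hmap (contDiffOn_one_add_rpow (1 / 2))
  have hd := hsq.comp hU h0 isOpen_Ioi isCompact_Icc hsub hmap
    (contDiffOn_dslope_one_add_rpow (-(α / 2)))
  refine ((hc.mul hU hg).mul hU hd).congr hU ?_
  intro ξ hξ
  have hξ1 : (1 : ℝ) < ‖ξ‖ := hξ
  have hr : 0 < ‖ξ‖ := zero_lt_one.trans hξ1
  have hx : ‖ξ‖ ^ (-2 : ℝ) = (‖ξ‖ ^ 2)⁻¹ := by
    rw [Real.rpow_neg hr.le, Real.rpow_two]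
  have hfac : 1 + ‖ξ‖ ^ 2 = ‖ξ‖ ^ 2 * (1 + (‖ξ‖ ^ 2)⁻¹) := by field_simp; ring
  have hp : 0 < 1 + (‖ξ‖ ^ 2)⁻¹ := by positivity
  have hpow : ∀ s : ℝ, (1 + ‖ξ‖ ^ 2) ^ s = ‖ξ‖ ^ (2 * s) * (1 + (‖ξ‖ ^ 2)⁻¹) ^ s := fun s => by
    rw [hfac, Real.mul_rpow (by positivity) hp.le, ← Real.rpow_two, ← Real.rpow_mul hr.le]
  simp only [symbolMTilde, symbolM, add_comm (‖ξ‖ ^ 2) 1, hpow, hx, Real.rpow_neg_one]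
  rw [dslope_of_ne _ (inv_ne_zero (by positivity)), slope_def_field]
  simp only [Real.rpow_neg hp.le, add_zero, Real.one_rpow, sub_zero]
  have e1 : (2 : ℝ) * (1 / 2) = 1 := by norm_num
  have e2 : 2 * (α / 2) = α := by ring
  have hq : 0 < ‖ξ‖ ^ α := by positivity
  have hq' : 0 < (1 + (‖ξ‖ ^ 2)⁻¹) ^ (α / 2) := by positivity
  rw [e1, e2, Real.rpow_one]
  generalize (1 + (‖ξ‖ ^ 2)⁻¹) ^ (α / 2) = A at hq' ⊢
  generalize (1 + (‖ξ‖ ^ 2)⁻¹) ^ ((1 : ℝ) / 2) = B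
  field_simp

theorem hormanderMikhlin_symbolMTilde {α : ℝ} (hα : 0 < α) :
    HormanderMikhlin fun ξ => (symbolMTilde α ξ : ℂ) := by
  obtain ⟨s1, b1⟩ := mikhlinOn_symbolMTilde_small hα
  obtain ⟨s2, b2⟩ := mikhlinOn_symbolMTilde_large α
  have hsm : ∀ ξ : Plane, ξ ≠ 0 → ContDiffAt ℝ ∞ (symbolMTilde α) ξ := fun ξ hξ => by
    rcases lt_or_ge ‖ξ‖ 2 with h | h
    · exact s1.contDiffAt
        ((isOpen_ne.inter (isOpen_lt continuous_norm continuous_const)).mem_nhds ⟨hξ, h⟩)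
    · exact s2.contDiffAt
        ((isOpen_lt continuous_const continuous_norm).mem_nhds (by
          change (1 : ℝ) < ‖ξ‖; linarith))
  refine ⟨fun ξ hξ => ((ofRealCLM.contDiff.contDiffAt).comp ξ (hsm ξ hξ)).contDiffWithinAt,
    fun k => ?_⟩
  obtain ⟨C1, h1⟩ := b1 k
  obtain ⟨C2, h2⟩ := b2 k
  -- The open sets 0 < |ξ| < 2 and |ξ| > 1 overlap and cover the punctured plane.
  refine ⟨max C1 C2, fun ξ hξ => ?_⟩
  have hr : 0 < ‖ξ‖ := norm_pos_iff.2 hξ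
  have hn : ‖iteratedFDeriv ℝ k (fun ξ => (symbolMTilde α ξ : ℂ)) ξ‖ =
      ‖iteratedFDeriv ℝ k (symbolMTilde α) ξ‖ :=
    ofRealLI.norm_iteratedFDeriv_comp_left ((hsm ξ hξ).of_le (m := k) (by exact_mod_cast le_top))
      le_rfl
  rw [hn, le_div_iff₀ (by positivity)]
  rcases lt_or_ge ‖ξ‖ 2 with h | h
  · exact (h1 ξ ⟨hξ, h⟩).trans (le_max_left _ _)
  · exact (h2 ξ (by change (1 : ℝ) < ‖ξ‖; linarith)).trans (le_max_right _ _)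

/-! ### Factorisation and bounds of the symbols. -/

theorem symbolM_eq_psiSymbol (α : ℝ) (η : Plane) :
    symbolM α ((2 * Real.pi) • η) =
      2 * Real.pi * η 0 * besselSymbol η * psiSymbol (α / 2) η := by
  have hb := besselSymbol_pos η
  rw [psiSymbol, mul_assoc _ (besselSymbol η), mul_div_cancel₀ _ hb.ne', symbolM, besselSymbol]
  set A := 1 + ‖(2 * Real.pi) • η‖ ^ 2 with hA
  have hA0 : 0 < A := by positivity
  have h1 : 1 - A⁻¹ = ‖(2 * Real.pi) • η‖ ^ 2 / A := by
    rw [eq_div_iff hA0.ne', sub_mul, inv_mul_cancel₀ hA0.ne', hA]; ring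
  rw [h1, Real.div_rpow (by positivity) hA0.le, ← Real.rpow_natCast_mul (norm_nonneg _)]
  have e : ((2 : ℕ) : ℝ) * (α / 2) = α := by push_cast; ring
  rw [e]
  simp only [PiLp.smul_apply, smul_eq_mul]
  ring

theorem besselSymbol_eq_rpow_mul_rpow (η : Plane) :
    besselSymbol η = (1 + ‖(2 * Real.pi) • η‖ ^ 2) ^ (-(1 / 2) : ℝ) *
      (1 + ‖(2 * Real.pi) • η‖ ^ 2) ^ (-(1 / 2) : ℝ) := by
  rw [← Real.rpow_add (by positivity), besselSymbol, ← Real.rpow_neg_one]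
  norm_num

theorem symbolMTilde_eq_psiSymbol (α : ℝ) (η : Plane) :
    symbolMTilde α ((2 * Real.pi) • η) = psiSymbol (α / 2) η * rhoSymbol 0 η := by
  have h : (0 : ℝ) < 1 + ‖(2 * Real.pi) • η‖ ^ 2 := by positivity
  rw [symbolMTilde, symbolM_eq_psiSymbol, besselSymbol_eq_rpow_mul_rpow, rhoSymbol, add_comm,
    Real.rpow_neg h.le]
  have : (0 : ℝ) < (1 + ‖(2 * Real.pi) • η‖ ^ 2) ^ ((1 : ℝ) / 2) := by positivity
  field_simp

theorem symbolN_eq_psiSymbol (α : ℝ) (η : Plane) :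
    symbolN α ((2 * Real.pi) • η) =
      I * (((besselSymbol η ^ ((1 : ℝ) / 2) : ℝ) : ℂ) *
        ((psiSymbol (α / 2) η : ℂ) * (rhoSymbol 0 η : ℂ))) := by
  rw [symbolN_eq, symbolM_eq_psiSymbol]
  have e : besselSymbol η ^ ((1 : ℝ) / 2) = (1 + ‖(2 * Real.pi) • η‖ ^ 2) ^ (-(1 / 2) : ℝ) := by
    rw [besselSymbol, Real.inv_rpow (by positivity), Real.rpow_neg (by positivity)]
  rw [e, rhoSymbol, besselSymbol_eq_rpow_mul_rpow]
  push_cast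
  ring

theorem gradient_symbolN_eq_psiSymbol (α : ℝ) (j : Fin 2) (η : Plane) :
    I * (((2 * Real.pi) • η) j : ℝ) * symbolN α ((2 * Real.pi) • η) =
      (-1) * ((psiSymbol (α / 2) η : ℂ) * ((rhoSymbol 0 η : ℂ) * (rhoSymbol j η : ℂ))) := by
  rw [symbolN_eq, symbolM_eq_psiSymbol, besselSymbol_eq_rpow_mul_rpow, rhoSymbol, rhoSymbol]
  simp only [PiLp.smul_apply, smul_eq_mul]
  push_cast
  linear_combination ((2 * Real.pi) * η j * (2 * Real.pi) * η 0 *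
    ((1 + ‖(2 * Real.pi) • η‖ ^ 2) ^ (-(1 / 2) : ℝ) : ℝ) *
    ((1 + ‖(2 * Real.pi) • η‖ ^ 2) ^ (-(1 / 2) : ℝ) : ℝ) * psiSymbol (α / 2) η : ℂ) * I_mul_I

theorem abs_rhoSymbol_le_one (j : Fin 2) (η : Plane) : |rhoSymbol j η| ≤ 1 := by
  have h : (0 : ℝ) < 1 + ‖(2 * Real.pi) • η‖ ^ 2 := by positivity
  have hj : |2 * Real.pi * η j| ≤ ‖(2 * Real.pi) • η‖ := by
    simpa using PiLp.norm_apply_le ((2 * Real.pi) • η) j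
  rw [rhoSymbol, abs_mul, abs_of_nonneg (Real.rpow_nonneg h.le _), Real.rpow_neg h.le,
    ← Real.sqrt_eq_rpow, ← div_eq_mul_inv]
  refine div_le_one_of_le₀ (hj.trans (Real.le_sqrt_of_sq_le ?_)) (Real.sqrt_nonneg _)
  linarith

/-- For 0 < s ≤ 1 and 0 ≤ 1-t ≤ 1 one has 1-t ≤ (1-t)^s ≤ 1, so the numerator lies between -t and 0.
-/
theorem abs_psiSymbol_le_one {s : ℝ} (h0 : 0 < s) (h1 : s ≤ 1) (η : Plane) :
    |psiSymbol s η| ≤ 1 := by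
  have hb := besselSymbol_pos η
  have hb1 := besselSymbol_le_one η
  have hx : 0 ≤ 1 - besselSymbol η := by linarith
  have hle : (1 - besselSymbol η) ^ s ≤ 1 := Real.rpow_le_one hx (by linarith) h0.le
  have hge : 1 - besselSymbol η ≤ (1 - besselSymbol η) ^ s :=
    Real.self_le_rpow_of_le_one hx (by linarith) h1
  rw [psiSymbol, abs_div, abs_of_pos hb, abs_of_nonpos (by linarith)]
  exact div_le_one_of_le₀ (by linarith) hb.le

theorem measurable_rhoSymbol (j : Fin 2) : Measurable (rhoSymbol j) := by
  unfold rhoSymbol; fun_prop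

theorem measurable_symbolM (α : ℝ) : Measurable (symbolM α) := by
  unfold symbolM; fun_prop

theorem measurable_symbolN (α : ℝ) : Measurable (symbolN α) := by
  have h := measurable_symbolM α
  simp_rw [funext (symbolN_eq α)]
  fun_prop

theorem hasTemperateGrowth_rhoSymbol (j : Fin 2) :
    (fun η => (rhoSymbol j η : ℂ)).HasTemperateGrowth := by
  have h1 : (fun η : Plane => (2 * Real.pi) • η).HasTemperateGrowth :=
    ((2 * Real.pi) • ContinuousLinearMap.id ℝ Plane).hasTemperateGrowth
  have h2 := (Function.hasTemperateGrowth_one_add_norm_sq_rpow Plane (-(1 / 2))).comp h1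
  have h3 : (fun η : Plane => (2 * Real.pi) * η j).HasTemperateGrowth :=
    ((2 * Real.pi) • (EuclideanSpace.proj j : Plane →L[ℝ] ℝ)).hasTemperateGrowth
  have h4 : (rhoSymbol j).HasTemperateGrowth := h3.mul h2
  exact ofRealCLM.hasTemperateGrowth.comp h4

theorem norm_le_of_forall_two_pi_smul {a : Plane → ℂ} {B : ℝ}
    (h : ∀ η : Plane, ‖a ((2 * Real.pi) • η)‖ ≤ B) (ξ : Plane) : ‖a ξ‖ ≤ B := by
  have := h ((2 * Real.pi)⁻¹ • ξ)
  rwa [smul_inv_smul₀ Real.two_pi_pos.ne'] at this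

theorem norm_symbolMTilde_le {α : ℝ} (h0 : 0 < α) (h2 : α ≤ 2) (ξ : Plane) :
    ‖(symbolMTilde α ξ : ℂ)‖ ≤ 1 := by
  refine norm_le_of_forall_two_pi_smul (a := fun ξ => (symbolMTilde α ξ : ℂ)) (fun η => ?_) ξ
  rw [symbolMTilde_eq_psiSymbol, norm_real, Real.norm_eq_abs, abs_mul]
  exact mul_le_one₀ (abs_psiSymbol_le_one (by linarith) (by linarith) η) (abs_nonneg _)
    (abs_rhoSymbol_le_one 0 η)

theorem norm_symbolN_le {α : ℝ} (h0 : 0 < α) (h2 : α ≤ 2) (ξ : Plane) : ‖symbolN α ξ‖ ≤ 1 := by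
  refine norm_le_of_forall_two_pi_smul (fun η => ?_) ξ
  rw [symbolN_eq_psiSymbol, norm_mul, norm_mul, norm_mul, norm_I, norm_real, norm_real, norm_real,
    one_mul, Real.norm_of_nonneg (Real.rpow_nonneg (besselSymbol_pos η).le _)]
  exact mul_le_one₀
    (Real.rpow_le_one (besselSymbol_pos η).le (besselSymbol_le_one η) (by norm_num))
    (by positivity)
    (mul_le_one₀ (abs_psiSymbol_le_one (by linarith) (by linarith) η) (abs_nonneg _)
      (abs_rhoSymbol_le_one 0 η))

theorem norm_gradient_symbolN_le {α : ℝ} (h0 : 0 < α) (h2 : α ≤ 2) (j : Fin 2) (ξ : Plane) :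
    ‖I * (ξ j : ℝ) * symbolN α ξ‖ ≤ 1 := by
  refine norm_le_of_forall_two_pi_smul (a := fun ξ => I * (ξ j : ℝ) * symbolN α ξ) (fun η => ?_) ξ
  rw [gradient_symbolN_eq_psiSymbol, norm_mul, norm_mul, norm_mul, norm_neg, norm_one, norm_real,
    norm_real, norm_real, one_mul]
  exact mul_le_one₀ (abs_psiSymbol_le_one (by linarith) (by linarith) η) (by positivity)
    (mul_le_one₀ (abs_rhoSymbol_le_one 0 η) (abs_nonneg _) (abs_rhoSymbol_le_one j η))

/-! ### Assembly of the operators. -/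

/-- A vector field in `L^q` with prescribed components. -/
theorem exists_lp_with_components {q : ℝ≥0∞} [Fact (1 ≤ q)]
    (g : Fin 2 → Lp ℂ q (volume : Measure Plane)) :
    ∃ G : Lp (EuclideanSpace ℂ (Fin 2)) q (volume : Measure Plane),
      (∀ j, (EuclideanSpace.proj j : EuclideanSpace ℂ (Fin 2) →L[ℂ] ℂ).compLp G = g j) ∧
      ‖G‖ ≤ ‖g 0‖ + ‖g 1‖ := by
  let e : Fin 2 → ℂ →L[ℂ] EuclideanSpace ℂ (Fin 2) := fun j =>
    ContinuousLinearMap.toSpanSingleton ℂ (EuclideanSpace.single j 1)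
  have he : ∀ j, ‖(e j).compLp (g j)‖ ≤ ‖g j‖ := fun j => by
    refine ((e j).norm_compLp_le (g j)).trans_eq ?_
    simp [e]
  refine ⟨(e 0).compLp (g 0) + (e 1).compLp (g 1), fun j => ?_,
    (norm_add_le _ _).trans (add_le_add (he 0) (he 1))⟩
  refine Lp.ext ?_
  filter_upwards [(EuclideanSpace.proj j : EuclideanSpace ℂ (Fin 2) →L[ℂ] ℂ).coeFn_compLp
      ((e 0).compLp (g 0) + (e 1).compLp (g 1)),
    Lp.coeFn_add ((e 0).compLp (g 0)) ((e 1).compLp (g 1)),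
    (e 0).coeFn_compLp (g 0), (e 1).coeFn_compLp (g 1)] with x h1 h2 h3 h4
  rw [h1, h2, Pi.add_apply, h3, h4]
  fin_cases j <;> simp [e]

theorem exists_multiplier_symbolMTilde {α : ℝ} (h0 : 0 < α) (h2 : α ≤ 2) {p q : ℝ≥0∞}
    [Fact (1 ≤ p)] [Fact (1 ≤ q)] [p.HolderConjugate q] (hp : 1 < p) (hpt : p < ⊤) :
    ∃ T : Lp ℂ p (volume : Measure Plane) →L[ℂ] Lp ℂ p (volume : Measure Plane),
      IsLqMultiplier (fun ξ => (symbolMTilde α ξ : ℂ)) p T ∧ ∃ C : ℝ, ∀ f, ‖T f‖ ≤ C * ‖f‖ := by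
  obtain ⟨C, hC, h⟩ := isMult_rho (q := q) hp hpt 0
  have hm := measurable_symbolM α
  have h' := h.psi_mul (s := α / 2) (measurable_rhoSymbol 0).complex_ofReal (M := 1)
    (fun η => by rw [norm_real]; exact abs_rhoSymbol_le_one 0 η) (by linarith) (by linarith)
  obtain ⟨T, hT, hb⟩ := exists_isLqMultiplier hp hpt
    (mul_nonneg (tsum_nonneg fun _ => abs_nonneg _) hC) (a := fun ξ => (symbolMTilde α ξ : ℂ))
    (h'.congr (.of_forall fun η => by simp only [symbolMTilde_eq_psiSymbol, ofReal_mul]))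
    (by unfold symbolMTilde; fun_prop) (norm_symbolMTilde_le h0 h2)
  exact ⟨T, hT, _, hb⟩

theorem exists_multiplier_symbolN {α : ℝ} (h0 : 0 < α) (h2 : α ≤ 2) {p q : ℝ≥0∞}
    [Fact (1 ≤ p)] [Fact (1 ≤ q)] [p.HolderConjugate q] (hp : 1 < p) (hpt : p < ⊤) :
    ∃ N : Lp ℂ p (volume : Measure Plane) →L[ℂ] Lp ℂ p (volume : Measure Plane),
      IsLqMultiplier (symbolN α) p N ∧ ∃ C : ℝ, ∀ f, ‖N f‖ ≤ C * ‖f‖ := by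
  obtain ⟨C, hC, h⟩ := isMult_rho (q := q) hp hpt 0
  have hρ : ∀ η, ‖(rhoSymbol 0 η : ℂ)‖ ≤ 1 := fun η => by
    rw [norm_real]; exact abs_rhoSymbol_le_one 0 η
  have hψ : ∀ η, ‖(psiSymbol (α / 2) η : ℂ)‖ ≤ 1 := fun η => by
    rw [norm_real]; exact abs_psiSymbol_le_one (by linarith) (by linarith) η
  have hψm : Measurable (psiSymbol (α / 2)) := by
    have := measurable_besselSymbol
    unfold psiSymbol; fun_prop
  have h' := ((h.psi_mul (s := α / 2) (measurable_rhoSymbol 0).complex_ofReal hρ (by linarith)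
    (by linarith)).bessel_mul (s := 1 / 2)
      (hψm.complex_ofReal.mul (measurable_rhoSymbol 0).complex_ofReal) (M := 1)
      (fun η => by rw [norm_mul]; exact mul_le_one₀ (hψ η) (norm_nonneg _) (hρ η))
      (by norm_num)).const_mul I
  obtain ⟨T, hT, hb⟩ := exists_isLqMultiplier hp hpt
    (mul_nonneg (norm_nonneg _) (mul_nonneg (tsum_nonneg fun _ => abs_nonneg _) hC))
    (a := symbolN α) (h'.congr (.of_forall fun η => (symbolN_eq_psiSymbol α η).symm))
    (measurable_symbolN α) (norm_symbolN_le h0 h2)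
  exact ⟨T, hT, _, hb⟩

/-- The half power of t in N and that in its factor ρ₁ absorb ξ_j and ξ₁: the symbol is -ψ ρ₁ ρ_j, a
product of two smooth multipliers followed by the series ψ. -/
theorem exists_multiplier_gradient_symbolN {α : ℝ} (h0 : 0 < α) (h2 : α ≤ 2) {p q : ℝ≥0∞}
    [Fact (1 ≤ p)] [Fact (1 ≤ q)] [p.HolderConjugate q] (hp : 1 < p) (hpt : p < ⊤) (j : Fin 2) :
    ∃ N : Lp ℂ p (volume : Measure Plane) →L[ℂ] Lp ℂ p (volume : Measure Plane),
      IsLqMultiplier (fun ξ => I * (ξ j : ℝ) * symbolN α ξ) p N ∧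
        ∃ C : ℝ, ∀ f, ‖N f‖ ≤ C * ‖f‖ := by
  obtain ⟨C, hC, h⟩ := isMult_rho (q := q) hp hpt 0
  obtain ⟨D, hD, k⟩ := isMult_rho (q := q) hp hpt j
  have hρ : ∀ j η, ‖(rhoSymbol j η : ℂ)‖ ≤ 1 := fun j η => by
    rw [norm_real]; exact abs_rhoSymbol_le_one j η
  have hm := measurable_symbolN α
  have h' := ((h.mul hp hpt hC hD k (hasTemperateGrowth_rhoSymbol j) (hρ j)).psi_mul (s := α / 2)
    ((measurable_rhoSymbol 0).complex_ofReal.mul (measurable_rhoSymbol j).complex_ofReal) (M := 1)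
    (fun η => by rw [norm_mul]; exact mul_le_one₀ (hρ 0 η) (norm_nonneg _) (hρ j η))
    (by linarith) (by linarith)).const_mul (-1)
  obtain ⟨T, hT, hb⟩ := exists_isLqMultiplier hp hpt
    (mul_nonneg (norm_nonneg _)
      (mul_nonneg (tsum_nonneg fun _ => abs_nonneg _) (mul_nonneg hC hD)))
    (a := fun ξ => I * (ξ j : ℝ) * symbolN α ξ)
    (h'.congr (.of_forall fun η => (gradient_symbolN_eq_psiSymbol α j η).symm))
    (by fun_prop) (norm_gradient_symbolN_le h0 h2 j)
  exact ⟨T, hT, _, hb⟩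

theorem exists_smoothing_multiplier_symbolN {α : ℝ} (h0 : 0 < α) (h2 : α ≤ 2) {p q : ℝ≥0∞}
    [Fact (1 ≤ p)] [Fact (1 ≤ q)] [p.HolderConjugate q] (hp : 1 < p) (hpt : p < ⊤) :
    ∃ N : Lp ℂ p (volume : Measure Plane) →L[ℂ] Lp ℂ p (volume : Measure Plane),
      IsLqMultiplier (symbolN α) p N ∧
      ∃ C : ℝ, ∀ f, ∃ G : Lp (EuclideanSpace ℂ (Fin 2)) p (volume : Measure Plane),
        IsGradient (N f) G ∧ ‖N f‖ + ‖G‖ ≤ C * ‖f‖ := by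
  obtain ⟨N, hN, C, hC⟩ := exists_multiplier_symbolN (q := q) h0 h2 hp hpt
  choose N' hN' D hD using exists_multiplier_gradient_symbolN (q := q) h0 h2 hp hpt
  have hm := measurable_symbolN α
  refine ⟨N, hN, C + (D 0 + D 1), fun f => ?_⟩
  obtain ⟨G, hG, hGn⟩ := exists_lp_with_components fun j => N' j f
  refine ⟨G, fun j => ?_, ?_⟩
  · rw [hG j]
    exact lineDeriv_multiplier hpt hm (by fun_prop) (norm_symbolN_le h0 h2)
      (norm_gradient_symbolN_le h0 h2 j) j (fun ξ => rfl) hN (hN' j) f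
  · linarith [hC f, hD 0 f, hD 1 f]

end

theorem lemma2p2 (α : ℝ) (hα : 1 < α) (hα' : α < 2) :
    HormanderMikhlin (fun ξ => (symbolMTilde α ξ : ℂ)) ∧
    ∀ (q : ℝ≥0∞) [Fact (1 ≤ q)], 1 < q → q < ⊤ →
      (∃ T : Lp ℂ q (volume : Measure Plane) →L[ℂ] Lp ℂ q (volume : Measure Plane),
        IsLqMultiplier (fun ξ => (symbolMTilde α ξ : ℂ)) q T ∧
        ∃ C : ℝ, ∀ f, ‖T f‖ ≤ C * ‖f‖) ∧
      (∃ N : Lp ℂ q (volume : Measure Plane) →L[ℂ] Lp ℂ q (volume : Measure Plane),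
        IsLqMultiplier (symbolN α) q N ∧
        ∃ C : ℝ, ∀ f, ∃ G : Lp (EuclideanSpace ℂ (Fin 2)) q (volume : Measure Plane),
          IsGradient (N f) G ∧ ‖N f‖ + ‖G‖ ≤ C * ‖f‖) := by
  have h0 : 0 < α := by linarith
  refine ⟨hormanderMikhlin_symbolMTilde h0, fun q _ hq hqt => ?_⟩
  -- The dual exponent, against which the bilinear forms are tested.
  have hc : q.HolderConjugate (1 - q⁻¹)⁻¹ := .inv_one_sub_inv' hq.le
  have : Fact (1 ≤ (1 - q⁻¹)⁻¹) := ⟨ENNReal.HolderConjugate.one_le _ q⟩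
  exact ⟨exists_multiplier_symbolMTilde (q := (1 - q⁻¹)⁻¹) h0 hα'.le hq hqt,
    exists_smoothing_multiplier_symbolN (q := (1 - q⁻¹)⁻¹) h0 hα'.le hq hqt⟩
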